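/- Let $n\ge 3$, and let $\mathsf C_n$ be the circular Hecke--Kiselman monoid (type $\widetilde A$, a linearly oriented cycle with $n$ vertices): generators $x_1,\dots,x_n$, indices modulo $n$; relations $x_i^2=x_i$; $x_ix_j=x_jx_i$ for $1<i-j<n-1$; $x_ix_{i+1}x_i=x_{i+1}x_ix_{i+1}=x_ix_{i+1}$ for all $i$. Identify the circle $\mathbb S^1$ with $\mathbb R/n\mathbb Z$. An $\tilde n$-diagram is a system of $n$ strands on the cylinder $\mathbb S^1\times[0,1]$, each projecting bijectively onto $[0,1]$, joining the points $(k,0)$ to the points $(l,1)$ $(k,l\in\{1,\dots,n\})$, with finitely many double points, all interior, and no other multiple points, which up to isotopy (through such systems, preserving the double points) is a product of the elementary diagrams $\tilde d_i$, where only the neighbouring strands $i,i+1$ cross (indices mod $n$), once. Diagrams are multiplied by stacking, the first factor being at the bottom. Let $\mathsf{DC}_n$ be the set of $\tilde n$-diagrams modulo isotopy and the local 2-moves (two consecutive crossings of two strands $\leftrightarrow$ one crossing) and 3-moves (the pictures of $d_1d_2d_1$, $d_2d_1d_2$ and $d_1d_2$ on three strands, read from bottom to top, are interchanged inside a rectangle).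 An $\tilde n$-web is an $\tilde n$-diagram without contractible bigons or contractible triangles: in the universal cover $\mathbb R\times[0,1]$, any two lifted strands meet at most once, and no three lifted strands meet pairwise. Let $\mathsf{WC}_n$ be the set of $\tilde n$-webs up to isotopy. Let $\operatorname{IIC}_n$ be the set of couples of integer sequences $((a_t),(b_t))_{1\le t\le k}$, $0\le k<n$, with $$1\le a_1<\dots<a_k\le n,\qquad b_1<\dots<b_k<b_1+n,\qquad a_t<b_t\ \text{ for all } t.$$ Then stacking makes $\mathsf{DC}_n$ a monoid, and the following maps are well defined and bijective: 1. the monoid map $\tilde\varepsilon\colon\mathsf C_n\to\mathsf{DC}_n$, $x_i\mapsto\tilde d_i$; 2. the map $\tilde\iota\colon\mathsf{WC}_n\to\mathsf{DC}_n$ induced by the inclusion of $\tilde n$-webs into $\tilde n$-diagrams; 3. the map $\tilde\varrho\colon\mathsf{WC}_n\to\operatorname{IIC}_n$ that sends a web to its right sequence couple: $(a_t)$ is the increasing sequence of the lower endpoints, in $\{1,\dots,n\}$, of the strands that go in the positive direction of the circle, i.e. whose lift to $\mathbb R\times[0,1]$ starting at $(a_t,0)$ ends at a point $(b_t,1)$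 with $b_t>a_t$. (Thus $b_t=s_t+nh_t$, with $s_t\in\{1,\dots,n\}$ the upper endpoint of the strand and $h_t$ the number of times it crosses $\{n+\frac12\}\times[0,1]$.) Moreover, let $x_i$ act on $\mathbb N^n$ by applying $\sigma_i$ to the components $i,i+1$ (for $i=n$: to the components $n,1$), with $\sigma_i(a,b)=(a,a)$ for $i<n$ and $\sigma_n(a,b)=(a,a+n)$; applying the letters of a word from left to right, this defines a (right) action of $\mathsf C_n$. For $x\in\mathsf C_n$, let $y$ be the result of the action of $x$ on $(1,2,\dots,n)$. For each $a\in\{1,\dots,n\}$ congruent modulo $n$ to an entry of $y$, let $m$ be the largest such entry, $s$ the rightmost place where $m$ occurs in $y$, and $b=s+m-a$; the pairs with $b\neq a$, ordered by $a$, form the couple $\tilde\varrho(\tilde\iota^{-1}(\tilde\varepsilon(x)))\in\operatorname{IIC}_n$. Hence two words represent the same element of $\mathsf C_n$ if and only if their couples coincide. There is a single program for a unit-cost random access machine (with addition, subtraction, comparison with $0$, and indexed memory access) and a constant $K$ such that, for all $n\ge3$ and all words $w$ in $x_1,\dots,x_n$, the program computes the couple of $w$ in at most $K\max\{n,\operatorname{length}(w)\}$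 steps. -/

import Mathlib

open scoped unitInterval

noncomputable section

namespace HeckeKiselman

/-! ### The circular Hecke–Kiselman monoid -/

/-- Cyclic successor on `Fin n`. The index `i : Fin n` stands for the number `i + 1` of
`{1, …, n}`. -/
def nxt {n : ℕ} (i : Fin n) : Fin n := ⟨(i.val + 1) % n, Nat.mod_lt _ i.pos⟩

/-- The defining relations of the monoid `C_n`: idempotence of generators, far commutativity, and
`x_i x_{i+1} x_i = x_{i+1} x_i x_{i+1} = x_i x_{i+1}`, indices being taken modulo `n`. -/
inductive Rel (n : ℕ) : FreeMonoid (Fin n) → FreeMonoid (Fin n) → Prop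
  | idem (i : Fin n) : Rel n (.of i * .of i) (.of i)
  | far (i j : Fin n) (h₁ : j.val + 1 < i.val) (h₂ : i.val + 1 < j.val + n) :
      Rel n (.of i * .of j) (.of j * .of i)
  | braid (i : Fin n) :
      Rel n (.of i * .of (nxt i) * .of i) (.of (nxt i) * .of i * .of (nxt i))
  | kiselman (i : Fin n) :
      Rel n (.of (nxt i) * .of i * .of (nxt i)) (.of i * .of (nxt i))

/-- The circular Hecke–Kiselman monoid `C_n`. -/
abbrev CMonoid (n : ℕ) : Type := PresentedMonoid (Rel n)

/-- The generator `x_{i+1}` of `C_n`. -/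
def gen {n : ℕ} (i : Fin n) : CMonoid n := PresentedMonoid.of (Rel n) i

/-- The element of `C_n` represented by a word in the generators. -/
def ofWord {n : ℕ} (w : List (Fin n)) : CMonoid n := (w.map gen).prod

/-! ### Diagrams on the cylinder -/

/-- An extended diagram: `n` strands on the cylinder `(ℝ / nℤ) × [0,1]`. Strands are oriented
upwards and numbered by their lower endpoints; the height is a strictly increasing bijection
along each strand, endpoints are marked points, and the map is injective except for finitely many
double points, which lie in the interior. -/
structure ExtDiagram (n : ℕ) where
  toFun : Fin n × I → AddCircle (n : ℝ) × I
  continuous_toFun : Continuous toFun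
  height_strictMono : ∀ i, StrictMono fun t : I => (toFun (i, t)).2
  lower : ∀ i, toFun (i, 0) = ((((i.val : ℝ) + 1 : ℝ) : AddCircle (n : ℝ)), 0)
  /-- Number of the upper endpoint of a strand. -/
  top : Fin n → Fin n
  upper : ∀ i, toFun (i, 1) = (((((top i).val : ℝ) + 1 : ℝ) : AddCircle (n : ℝ)), 1)
  finite_double : {x | ∃ y, y ≠ x ∧ toFun x = toFun y}.Finite
  at_most_double : ∀ x y z, toFun x = toFun y → toFun y = toFun z → x = y ∨ y = z ∨ x = z
  double_interior : ∀ x y, x ≠ y → toFun x = toFun y → x.2 ≠ 0 ∧ x.2 ≠ 1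

/-- Isotopy of diagrams: a continuous family of diagrams in which the double points persist (two
points of the strands are identified at some time if and only if they are identified at the
beginning), i.e. an isotopy of 4-valent graphs on the cylinder through diagrams. The
parametrization of the strands is irrelevant: the family ends in a reparametrization of `D'`. -/
def Isotopic {n : ℕ} (D D' : ExtDiagram n) : Prop :=
  ∃ (H : I → ExtDiagram n) (r : Fin n → (I ≃o I)),
    Continuous (fun p : I × (Fin n × I) => (H p.1).toFun p.2) ∧ H 0 = D ∧
    (∀ i t, (H 1).toFun (i, t) = D'.toFun (i, r i t)) ∧
    ∀ s x y, (H s).toFun x = (H s).toFun y ↔ D.toFun x = D.toFun y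

/-- The trivial diagram: all strands are vertical. -/
def ExtDiagram.trivial (n : ℕ) : ExtDiagram n := by
  have key : Function.Injective (fun x : Fin n × I =>
      ((((x.1.val : ℝ) + 1 : ℝ) : AddCircle (n : ℝ)), x.2)) := by
    rintro ⟨i, t⟩ ⟨j, u⟩ h
    simp only [Prod.mk.injEq] at h
    obtain ⟨h, rfl⟩ := h
    have hn : 0 < n := i.pos
    have : Fact (0 < (n : ℝ)) := ⟨by exact_mod_cast hn⟩
    have hi : (i.val : ℝ) + 1 ≤ n := by exact_mod_cast i.isLt
    have hj : (j.val : ℝ) + 1 ≤ n := by exact_mod_cast j.isLt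
    have hi0 : (0 : ℝ) ≤ i.val := Nat.cast_nonneg _
    have hj0 : (0 : ℝ) ≤ j.val := Nat.cast_nonneg _
    rw [AddCircle.coe_eq_coe_iff_of_mem_Ico (a := 1) ⟨by linarith, by linarith⟩
      ⟨by linarith, by linarith⟩] at h
    have : i = j := Fin.ext (by exact_mod_cast add_right_cancel h)
    rw [this]
  exact
  { toFun := fun x => ((((x.1.val : ℝ) + 1 : ℝ) : AddCircle (n : ℝ)), x.2)
    continuous_toFun := by
      refine Continuous.prodMk ?_ continuous_snd
      exact (continuous_of_discreteTopology
        (f := fun i : Fin n => (((i.val : ℝ) + 1 : ℝ) : AddCircle (n : ℝ)))).comp continuous_fst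
    height_strictMono := fun i => strictMono_id
    lower := fun i => rfl
    top := id
    upper := fun i => rfl
    finite_double := by
      convert Set.finite_empty
      ext x
      simp only [Set.mem_ofPred_eq, Set.mem_empty_iff_false, iff_false]
      rintro ⟨y, hy, h⟩
      exact hy (key h).symm
    at_most_double := fun x y z h _ => Or.inl (key h)
    double_interior := fun x y hne h => absurd (key h) hne }

/-- The `x`-coordinate (before reduction modulo `n`), at height `t`, of the `j`-th strand of the
`i`-th elementary diagram: the neighbours `i` and `i + 1` cross, other strands are vertical. -/
def elemCoord {n : ℕ} (i j : Fin n) (t : ℝ) : ℝ :=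
  if j = i then (j.val : ℝ) + 1 + t else if j = nxt i then (j.val : ℝ) + 1 - t else (j.val : ℝ) + 1

theorem nxt_spec {n : ℕ} (i : Fin n) :
    ∃ d : ℤ, ((nxt i).val : ℝ) = (i.val : ℝ) + 1 - d * n := by
  refine ⟨((i.val + 1) / n : ℕ), ?_⟩
  have h := Nat.mod_add_div (i.val + 1) n
  have h' : (((i.val + 1) % n : ℕ) : ℝ) + (n : ℝ) * (((i.val + 1) / n : ℕ) : ℝ)
      = (i.val : ℝ) + 1 := by exact_mod_cast h
  simp only [nxt, Int.cast_natCast]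
  linarith

theorem fin_eq_of_sub {n : ℕ} (j k : Fin n) (m : ℤ)
    (h : (j.val : ℝ) - k.val = m * n) : j = k := by
  have hz : (j.val : ℤ) - k.val = m * n := by exact_mod_cast h
  have h1 := j.isLt
  have h2 := k.isLt
  have hm : m = 0 := by
    by_contra hne
    rcases lt_or_gt_of_ne hne with h | h
    · have : m * (n : ℤ) ≤ -1 * n := by
        apply mul_le_mul_of_nonneg_right <;> omega
      omega
    · have : 1 * (n : ℤ) ≤ m * n := by
        apply mul_le_mul_of_nonneg_right <;> omega
      omega
  subst hm
  exact Fin.ext (by omega)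

theorem coe_eq_coe {n : ℕ} {a b : ℝ} (h : (a : AddCircle (n : ℝ)) = b) :
    ∃ m : ℤ, a - b = m * n := by
  have h' : ((a - b : ℝ) : AddCircle (n : ℝ)) = 0 := by
    rw [AddCircle.coe_sub, h, sub_self]
  obtain ⟨m, hm⟩ := (AddCircle.coe_eq_zero_iff (n : ℝ)).1 h'
  exact ⟨m, by rw [← hm]; simp⟩

theorem coe_eq_coe_of {n : ℕ} {a b : ℝ} (m : ℤ) (h : a - b = m * n) :
    (a : AddCircle (n : ℝ)) = b := by
  rw [← sub_eq_zero, ← AddCircle.coe_sub, AddCircle.coe_eq_zero_iff]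
  exact ⟨m, by rw [h]; simp⟩

theorem elem_double {n : ℕ} (hn : 3 ≤ n) (i j k : Fin n) (t : I) (hjk : j ≠ k)
    (h : ((elemCoord i j t : ℝ) : AddCircle (n : ℝ)) = (elemCoord i k t : ℝ)) :
    (j = i ∨ j = nxt i) ∧ (t : ℝ) = 1 / 2 := by
  -- by symmetry it suffices to treat one order of the two strands
  have base : ∀ (j k : Fin n), j ≠ k →
      ((elemCoord i j t : ℝ) : AddCircle (n : ℝ)) = (elemCoord i k t : ℝ) →
      (j = i ∨ (j ≠ i ∧ j = nxt i ∧ k ≠ i) ∨ (j ≠ i ∧ j ≠ nxt i ∧ k ≠ i ∧ k ≠ nxt i)) →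
      (j = i ∨ j = nxt i) ∧ (k = i ∨ k = nxt i) ∧ (t : ℝ) = 1 / 2 := by
    intro j k hjk h hc
    obtain ⟨m, hm⟩ := coe_eq_coe h
    obtain ⟨d, hd⟩ := nxt_spec i
    have ht0 := t.2.1
    have ht1 := t.2.2
    have hn' : (3 : ℝ) ≤ n := by exact_mod_cast hn
    have int01 : ∀ z : ℤ, (t : ℝ) = z → z = 0 ∨ z = 1 := by
      intro z hz
      have h0 : (0 : ℝ) ≤ z := hz ▸ ht0
      have h1 : (z : ℝ) ≤ 1 := hz ▸ ht1
      have h0' : 0 ≤ z := by exact_mod_cast h0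
      have h1' : z ≤ 1 := by exact_mod_cast h1
      omega
    rcases hc with rfl | ⟨hji, rfl, hki⟩ | ⟨hji, hjn, hki, hkn⟩
    · by_cases hk : k = nxt j
      · subst hk
        refine ⟨Or.inl rfl, Or.inr rfl, ?_⟩
        simp only [elemCoord, if_true, if_neg hjk.symm] at hm
        have e : 2 * (t : ℝ) - 1 = ((m - d : ℤ) : ℝ) * n := by push_cast; linarith
        have hz : m - d = 0 := by
          by_contra hne
          rcases lt_or_gt_of_ne hne with h | h
          · have h1 : ((m - d : ℤ) : ℝ) ≤ -1 := by exact_mod_cast (by omega : m - d ≤ -1)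
            nlinarith
          · have h1 : (1 : ℝ) ≤ ((m - d : ℤ) : ℝ) := by exact_mod_cast (by omega : 1 ≤ m - d)
            nlinarith
        rw [hz] at e
        push_cast at e
        linarith
      · exfalso
        simp only [elemCoord, if_true, if_neg hjk.symm, if_neg hk] at hm
        have e : (t : ℝ) = ((m * n - j.val + k.val : ℤ) : ℝ) := by push_cast; linarith
        rcases int01 _ e with hz | hz
        · rw [hz] at e
          exact hjk (fin_eq_of_sub j k m (by push_cast at e; linarith))
        · rw [hz] at e
          refine hk (fin_eq_of_sub k (nxt j) (d - m) ?_)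
          push_cast at e ⊢
          linarith
    · exfalso
      simp only [elemCoord, if_neg hji, if_true, if_neg hki, if_neg hjk.symm] at hm
      have e : (t : ℝ) = (((nxt i).val - k.val - m * n : ℤ) : ℝ) := by push_cast; linarith
      rcases int01 _ e with hz | hz
      · rw [hz] at e
        exact hjk (fin_eq_of_sub _ k m (by push_cast at e; linarith))
      · rw [hz] at e
        refine hki (fin_eq_of_sub k i (-d - m) ?_)
        push_cast at e ⊢
        linarith
    · exfalso
      simp only [elemCoord, if_neg hji, if_neg hjn, if_neg hki, if_neg hkn] at hm
      exact hjk (fin_eq_of_sub j k m (by linarith))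
  by_cases hj : j = i
  · obtain ⟨h1, -, h3⟩ := base j k hjk h (Or.inl hj)
    exact ⟨h1, h3⟩
  by_cases hk : k = i
  · obtain ⟨-, h2, h3⟩ := base k j hjk.symm h.symm (Or.inl hk)
    exact ⟨h2, h3⟩
  by_cases hj' : j = nxt i
  · obtain ⟨h1, -, h3⟩ := base j k hjk h (Or.inr (Or.inl ⟨hj, hj', hk⟩))
    exact ⟨h1, h3⟩
  by_cases hk' : k = nxt i
  · obtain ⟨-, h2, h3⟩ := base k j hjk.symm h.symm (Or.inr (Or.inl ⟨hk, hk', hj⟩))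
    exact ⟨h2, h3⟩
  · obtain ⟨h1, -, h3⟩ := base j k hjk h (Or.inr (Or.inr ⟨hj, hj', hk, hk'⟩))
    exact ⟨h1, h3⟩

theorem nxt_ne {n : ℕ} (hn : 3 ≤ n) (i : Fin n) : nxt i ≠ i := by
  intro h
  have h' : (i.val + 1) % n = i.val := congrArg Fin.val h
  have hi := i.isLt
  rcases Nat.lt_or_ge (i.val + 1) n with h1 | h1
  · rw [Nat.mod_eq_of_lt h1] at h'
    omega
  · have : i.val + 1 = n := by omega
    rw [this, Nat.mod_self] at h'
    omega

/-- The elementary diagram with one crossing, between the neighbouring strands `i` and `i + 1`. -/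
def ExtDiagram.elem {n : ℕ} (hn : 3 ≤ n) (i : Fin n) : ExtDiagram n := by
  have key : ∀ x y : Fin n × I, x ≠ y →
      (((elemCoord i x.1 x.2 : ℝ) : AddCircle (n : ℝ)), x.2)
        = (((elemCoord i y.1 y.2 : ℝ) : AddCircle (n : ℝ)), y.2) →
      (x.1 = i ∨ x.1 = nxt i) ∧ (x.2 : ℝ) = 1 / 2 := by
    rintro ⟨j, t⟩ ⟨k, u⟩ hne h
    simp only [Prod.mk.injEq] at h
    obtain ⟨h, rfl⟩ := h
    exact elem_double hn i j k t (fun e => hne (by rw [e])) h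
  have half : ∀ t : I, (t : ℝ) = 1 / 2 → t = ⟨1 / 2, by norm_num, by norm_num⟩ :=
    fun t ht => Subtype.ext ht
  exact
  { toFun := fun x => (((elemCoord i x.1 x.2 : ℝ) : AddCircle (n : ℝ)), x.2)
    continuous_toFun := by
      refine Continuous.prodMk ?_ continuous_snd
      refine (AddCircle.continuous_mk' (n : ℝ)).comp ?_
      rw [continuous_prod_of_discrete_left]
      intro j
      unfold elemCoord
      dsimp only
      split_ifs <;> fun_prop
    height_strictMono := fun i => strictMono_id
    lower := by
      intro j
      simp only [elemCoord, Set.Icc.coe_zero, add_zero, sub_zero, ite_self]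
    top := fun j => if j = i then nxt i else if j = nxt i then i else j
    upper := by
      intro j
      obtain ⟨d, hd⟩ := nxt_spec i
      refine Prod.ext ?_ rfl
      simp only [elemCoord, Set.Icc.coe_one]
      split_ifs with h1 h2
      · subst h1
        exact coe_eq_coe_of d (by linarith)
      · subst h2
        exact coe_eq_coe_of (-d) (by push_cast; linarith)
      · rfl
    finite_double := by
      refine Set.Finite.subset
        ((Set.finite_univ (α := Fin n)).prod
          (Set.finite_singleton (⟨1 / 2, by norm_num, by norm_num⟩ : I))) ?_
      rintro x ⟨y, hne, h⟩
      exact ⟨Set.mem_univ _, half _ (key x y hne.symm h).2⟩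
    at_most_double := by
      intro x y z h1 h2
      by_contra hcon
      push Not at hcon
      obtain ⟨hxy, hyz, hxz⟩ := hcon
      obtain ⟨ax, bx⟩ := key x y hxy h1
      obtain ⟨ay, -⟩ := key y z hyz h2
      obtain ⟨az, -⟩ := key z y hyz.symm h2.symm
      have e1 : x.2 = y.2 := congrArg (fun z : AddCircle (n : ℝ) × I => z.2) h1
      have e2 : y.2 = z.2 := congrArg (fun z : AddCircle (n : ℝ) × I => z.2) h2
      rcases ax with ax | ax <;> rcases ay with ay | ay <;> rcases az with az | az <;>
        first
        | exact hxy (Prod.ext (ax.trans ay.symm) e1)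
        | exact hyz (Prod.ext (ay.trans az.symm) e2)
        | exact hxz (Prod.ext (ax.trans az.symm) (e1.trans e2))
    double_interior := by
      intro x y hne h
      have := (key x y hne h).2
      constructor
      · intro e
        rw [e] at this
        norm_num at this
      · intro e
        rw [e] at this
        norm_num at this }

/-- `t ↦ 2t` (truncated at `1`). -/
def dbl (t : I) : I := Set.projIcc 0 1 zero_le_one (2 * (t : ℝ))

/-- `t ↦ 2t - 1` (truncated at `0`). -/
def dbl' (t : I) : I := Set.projIcc 0 1 zero_le_one (2 * (t : ℝ) - 1)

/-- The lower half of the unit interval. -/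
def lowHalf (t : I) : I := ⟨(t : ℝ) / 2, by linarith [t.2.1], by linarith [t.2.2]⟩

/-- The upper half of the unit interval. -/
def highHalf (t : I) : I := ⟨(1 + (t : ℝ)) / 2, by linarith [t.2.1], by linarith [t.2.2]⟩

theorem dbl_coe {t : I} (h : (t : ℝ) ≤ 1 / 2) : (dbl t : ℝ) = 2 * t := by
  have := t.2.1
  simp only [dbl]
  rw [Set.projIcc_of_mem zero_le_one (⟨by linarith, by linarith⟩ : 2 * (t : ℝ) ∈ Set.Icc 0 1)]

theorem dbl'_coe {t : I} (h : 1 / 2 ≤ (t : ℝ)) : (dbl' t : ℝ) = 2 * t - 1 := by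
  have := t.2.2
  simp only [dbl']
  rw [Set.projIcc_of_mem zero_le_one (⟨by linarith, by linarith⟩ : 2 * (t : ℝ) - 1 ∈ Set.Icc 0 1)]

theorem top_injective {n : ℕ} (D : ExtDiagram n) : Function.Injective D.top := by
  intro i j h
  by_contra hne
  have : D.toFun (i, 1) = D.toFun (j, 1) := by rw [D.upper, D.upper, h]
  exact (D.double_interior (i, 1) (j, 1) (fun e => hne (congrArg Prod.fst e)) this).2 rfl

/-- The underlying map of the composite: stack the second diagram on top of the first and
shrink. -/
def compFun {n : ℕ} (D D' : ExtDiagram n) (x : Fin n × I) : AddCircle (n : ℝ) × I :=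
  if (x.2 : ℝ) ≤ 1 / 2 then
    ((D.toFun (x.1, dbl x.2)).1, lowHalf (D.toFun (x.1, dbl x.2)).2)
  else
    ((D'.toFun (D.top x.1, dbl' x.2)).1, highHalf (D'.toFun (D.top x.1, dbl' x.2)).2)

theorem compFun_eq {n : ℕ} (D D' : ExtDiagram n) {x y : Fin n × I}
    (h : compFun D D' x = compFun D D' y) :
    ((x.2 : ℝ) ≤ 1 / 2 ∧ (y.2 : ℝ) ≤ 1 / 2 ∧
      D.toFun (x.1, dbl x.2) = D.toFun (y.1, dbl y.2)) ∨
    (1 / 2 < (x.2 : ℝ) ∧ 1 / 2 < (y.2 : ℝ) ∧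
      D'.toFun (D.top x.1, dbl' x.2) = D'.toFun (D.top y.1, dbl' y.2)) := by
  have pos : ∀ z : Fin n × I, 1 / 2 < (z.2 : ℝ) →
      (0 : ℝ) < (D'.toFun (D.top z.1, dbl' z.2)).2 := by
    intro z hz
    have h0 : (0 : I) < dbl' z.2 := by
      rw [← Subtype.coe_lt_coe, dbl'_coe hz.le]
      simp only [Set.Icc.coe_zero]
      linarith
    have h1 := D'.height_strictMono (D.top z.1) h0
    simp only [D'.lower] at h1
    exact_mod_cast h1
  unfold compFun at h
  split_ifs at h with hx hy hy
  · refine Or.inl ⟨hx, hy, ?_⟩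
    simp only [Prod.mk.injEq] at h
    have h2 := congrArg (fun z : I => (z : ℝ)) h.2
    simp only [lowHalf] at h2
    exact Prod.ext h.1 (Subtype.ext (by linarith))
  · exfalso
    simp only [Prod.mk.injEq] at h
    have h2 := congrArg (fun z : I => (z : ℝ)) h.2
    simp only [lowHalf, highHalf] at h2
    linarith [pos y (not_le.1 hy), (D.toFun (x.1, dbl x.2)).2.2.2]
  · exfalso
    simp only [Prod.mk.injEq] at h
    have h2 := congrArg (fun z : I => (z : ℝ)) h.2
    simp only [lowHalf, highHalf] at h2
    linarith [pos x (not_le.1 hx), (D.toFun (y.1, dbl y.2)).2.2.2]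
  · refine Or.inr ⟨not_le.1 hx, not_le.1 hy, ?_⟩
    simp only [Prod.mk.injEq] at h
    have h2 := congrArg (fun z : I => (z : ℝ)) h.2
    simp only [highHalf] at h2
    exact Prod.ext h.1 (Subtype.ext (by linarith))

theorem low_inj {n : ℕ} {x y : Fin n × I} (hx : (x.2 : ℝ) ≤ 1 / 2) (hy : (y.2 : ℝ) ≤ 1 / 2)
    (h : (x.1, dbl x.2) = (y.1, dbl y.2)) : x = y := by
  simp only [Prod.mk.injEq] at h
  have e := congrArg Subtype.val h.2
  have e1 : (dbl x.2 : ℝ) = dbl y.2 := e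
  rw [dbl_coe hx, dbl_coe hy] at e1
  exact Prod.ext h.1 (Subtype.ext (by linarith))

theorem high_inj {n : ℕ} (D : ExtDiagram n) {x y : Fin n × I} (hx : 1 / 2 < (x.2 : ℝ))
    (hy : 1 / 2 < (y.2 : ℝ)) (h : (D.top x.1, dbl' x.2) = (D.top y.1, dbl' y.2)) : x = y := by
  simp only [Prod.mk.injEq] at h
  have e1 : (dbl' x.2 : ℝ) = dbl' y.2 := congrArg Subtype.val h.2
  rw [dbl'_coe hx.le, dbl'_coe hy.le] at e1
  exact Prod.ext (top_injective D h.1) (Subtype.ext (by linarith))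

theorem compFun_continuous {n : ℕ} (D D' : ExtDiagram n) : Continuous (compFun D D') := by
  have c1 : Continuous dbl := continuous_projIcc.comp (by fun_prop)
  have c2 : Continuous dbl' := continuous_projIcc.comp (by fun_prop)
  have c3 : Continuous lowHalf := Continuous.subtype_mk (by fun_prop) _
  have c4 : Continuous highHalf := Continuous.subtype_mk (by fun_prop) _
  have c5 : Continuous D.top := continuous_of_discreteTopology
  have a1 : Continuous fun x : Fin n × I => D.toFun (x.1, dbl x.2) :=
    D.continuous_toFun.comp (continuous_fst.prodMk (c1.comp continuous_snd))
  have a2 : Continuous fun x : Fin n × I => D'.toFun (D.top x.1, dbl' x.2) :=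
    D'.continuous_toFun.comp ((c5.comp continuous_fst).prodMk (c2.comp continuous_snd))
  refine Continuous.if_le ?_ ?_ (by fun_prop) continuous_const ?_
  · exact (continuous_fst.comp a1).prodMk (c3.comp (continuous_snd.comp a1))
  · exact (continuous_fst.comp a2).prodMk (c4.comp (continuous_snd.comp a2))
  · intro x hx
    have e1 : dbl x.2 = 1 := Subtype.ext (by rw [dbl_coe hx.le, hx]; norm_num)
    have e2 : dbl' x.2 = 0 := Subtype.ext (by rw [dbl'_coe hx.ge, hx]; norm_num)
    rw [e1, e2, D.upper, D'.lower]
    refine Prod.ext rfl (Subtype.ext ?_)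
    simp [lowHalf, highHalf]

/-- Composition of diagrams: in `D.comp D'` the diagram `D` is at the bottom and `D'` is on top. -/
def ExtDiagram.comp {n : ℕ} (D D' : ExtDiagram n) : ExtDiagram n where
  toFun := compFun D D'
  continuous_toFun := compFun_continuous D D'
  height_strictMono := by
    intro i t u htu
    have htu' : (t : ℝ) < u := htu
    simp only [compFun]
    split_ifs with h1 h2 h2
    · have h : dbl t < dbl u := by
        rw [← Subtype.coe_lt_coe, dbl_coe h1, dbl_coe h2]
        linarith
      have h3 : ((D.toFun (i, dbl t)).2 : ℝ) < (D.toFun (i, dbl u)).2 := D.height_strictMono i h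
      rw [← Subtype.coe_lt_coe]
      simp only [lowHalf]
      linarith
    · have h : (0 : I) < dbl' u := by
        rw [← Subtype.coe_lt_coe, dbl'_coe (not_le.1 h2).le]
        simp only [Set.Icc.coe_zero]
        linarith
      have h3 := D'.height_strictMono (D.top i) h
      simp only [D'.lower] at h3
      have h4 : (0 : ℝ) < (D'.toFun (D.top i, dbl' u)).2 := by exact_mod_cast h3
      have h5 := (D.toFun (i, dbl t)).2.2.2
      rw [← Subtype.coe_lt_coe]
      simp only [lowHalf, highHalf]
      linarith
    · exfalso
      linarith
    · have h : dbl' t < dbl' u := by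
        rw [← Subtype.coe_lt_coe, dbl'_coe (not_le.1 h1).le, dbl'_coe (not_le.1 h2).le]
        linarith
      have h3 : ((D'.toFun (D.top i, dbl' t)).2 : ℝ) < (D'.toFun (D.top i, dbl' u)).2 :=
        D'.height_strictMono (D.top i) h
      rw [← Subtype.coe_lt_coe]
      simp only [highHalf]
      linarith
  lower := by
    intro i
    have e : dbl 0 = 0 := Subtype.ext (by rw [dbl_coe (by norm_num)]; norm_num)
    simp only [compFun]
    rw [if_pos (by norm_num), e, D.lower]
    exact Prod.ext rfl (Subtype.ext (by simp [lowHalf]))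
  top := fun i => D'.top (D.top i)
  upper := by
    intro i
    have e : dbl' 1 = 1 := Subtype.ext (by rw [dbl'_coe (by norm_num)]; norm_num)
    simp only [compFun]
    rw [if_neg (by norm_num), e, D'.upper]
    exact Prod.ext rfl (Subtype.ext (by simp [highHalf]))
  finite_double := by
    have f1 : ({x : Fin n × I | (x.2 : ℝ) ≤ 1 / 2} ∩ (fun x => (x.1, dbl x.2)) ⁻¹'
        {x | ∃ y, y ≠ x ∧ D.toFun x = D.toFun y}).Finite := by
      refine Set.Finite.of_finite_image
        (f := fun x : Fin n × I => (x.1, dbl x.2)) (D.finite_double.subset ?_) ?_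
      · rintro _ ⟨x, ⟨-, hx⟩, rfl⟩
        exact hx
      · rintro x ⟨hx, -⟩ y ⟨hy, -⟩ h
        exact low_inj hx hy h
    have f2 : ({x : Fin n × I | 1 / 2 < (x.2 : ℝ)} ∩ (fun x => (D.top x.1, dbl' x.2)) ⁻¹'
        {x | ∃ y, y ≠ x ∧ D'.toFun x = D'.toFun y}).Finite := by
      refine Set.Finite.of_finite_image
        (f := fun x : Fin n × I => (D.top x.1, dbl' x.2)) (D'.finite_double.subset ?_) ?_
      · rintro _ ⟨x, ⟨-, hx⟩, rfl⟩
        exact hx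
      · rintro x ⟨hx, -⟩ y ⟨hy, -⟩ h
        exact high_inj D hx hy h
    refine (f1.union f2).subset ?_
    rintro x ⟨y, hne, h⟩
    rcases compFun_eq D D' h with ⟨hx, hy, e⟩ | ⟨hx, hy, e⟩
    · exact Or.inl ⟨hx, (y.1, dbl y.2), fun e' => hne (low_inj hy hx e'), e⟩
    · exact Or.inr ⟨hx, (D.top y.1, dbl' y.2), fun e' => hne (high_inj D hy hx e'), e⟩
  at_most_double := by
    intro x y z h1 h2
    rcases compFun_eq D D' h1 with ⟨hx, hy, e⟩ | ⟨hx, hy, e⟩ <;>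
      rcases compFun_eq D D' h2 with ⟨hy', hz, e'⟩ | ⟨hy', hz, e'⟩
    · rcases D.at_most_double _ _ _ e e' with h | h | h
      · exact Or.inl (low_inj hx hy h)
      · exact Or.inr (Or.inl (low_inj hy hz h))
      · exact Or.inr (Or.inr (low_inj hx hz h))
    · exfalso; linarith
    · exfalso; linarith
    · rcases D'.at_most_double _ _ _ e e' with h | h | h
      · exact Or.inl (high_inj D hx hy h)
      · exact Or.inr (Or.inl (high_inj D hy hz h))
      · exact Or.inr (Or.inr (high_inj D hx hz h))
  double_interior := by
    intro x y hne h
    rcases compFun_eq D D' h with ⟨hx, hy, e⟩ | ⟨hx, hy, e⟩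
    · have h1 := D.double_interior _ _ (fun e' => hne (low_inj hx hy e')) e
      constructor
      · intro h0
        apply h1.1
        exact Subtype.ext (by simp only; rw [dbl_coe hx, h0]; norm_num)
      · intro h0
        rw [h0] at hx
        norm_num at hx
    · have h1 := D'.double_interior _ _ (fun e' => hne (high_inj D hx hy e')) e
      constructor
      · intro h0
        rw [h0] at hx
        norm_num at hx
      · intro h0
        apply h1.2
        exact Subtype.ext (by simp only; rw [dbl'_coe hx.le, h0]; norm_num)

/-- Diagrams proper: the submonoid generated, up to isotopy, by the elementary diagrams. -/
inductive IsTilde {n : ℕ} (hn : 3 ≤ n) : ExtDiagram n → Prop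
  | trivial : IsTilde hn (ExtDiagram.trivial n)
  | elem (i : Fin n) : IsTilde hn (ExtDiagram.elem hn i)
  | comp {D D' : ExtDiagram n} : IsTilde hn D → IsTilde hn D' → IsTilde hn (D.comp D')
  | isotopic {D D' : ExtDiagram n} : IsTilde hn D → Isotopic D D' → IsTilde hn D'

/-- Diagrams on the cylinder with `n` strands, generated by the elementary ones. -/
def Diagram {n : ℕ} (hn : 3 ≤ n) : Type := {D : ExtDiagram n // IsTilde hn D}

/-- The trivial diagram. -/
def Diagram.trivial {n : ℕ} (hn : 3 ≤ n) : Diagram hn := ⟨ExtDiagram.trivial n, .trivial⟩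

/-- The elementary diagrams. -/
def Diagram.elem {n : ℕ} (hn : 3 ≤ n) (i : Fin n) : Diagram hn := ⟨ExtDiagram.elem hn i, .elem i⟩

/-- Stack-and-shrink composition (the first factor is at the bottom). -/
def Diagram.comp {n : ℕ} {hn : 3 ≤ n} (D D' : Diagram hn) : Diagram hn :=
  ⟨D.1.comp D'.1, .comp D.2 D'.2⟩

/-! ### Local moves -/

/-- The part of the cylinder covered by the strands. -/
def ExtDiagram.support {n : ℕ} (D : ExtDiagram n) : Set (AddCircle (n : ℝ) × ℝ) :=
  Set.range fun x => ((D.toFun x).1, ((D.toFun x).2 : ℝ))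

/-- Planar picture of a braid word on the strands `1, …, k` (read from bottom to top), in the
strip `ℝ × [0,1]`: the letter `i` is a crossing of the neighbours `i` and `i + 1`. -/
def planarPicture (k : ℕ) : List ℕ → Set (ℝ × ℝ)
  | [] => {p | (0 ≤ p.2 ∧ p.2 ≤ 1) ∧ ∃ j : ℕ, (1 ≤ j ∧ j ≤ k) ∧ p.1 = j}
  | i :: w =>
      {p | (0 ≤ p.2 ∧ p.2 ≤ 1 / 2) ∧ ∃ j : ℕ, (1 ≤ j ∧ j ≤ k) ∧
        p.1 = if j = i then j + 2 * p.2 else if j = i + 1 then j - 2 * p.2 else (j : ℝ)} ∪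
      {p | (1 / 2 ≤ p.2 ∧ p.2 ≤ 1) ∧ (p.1, 2 * p.2 - 1) ∈ planarPicture k w}

/-- `D'` is obtained from `D` by replacing, inside a rectangle drawn on the cylinder, the picture
of the braid word `u` on `k` strands by that of `v`, and leaving `D` unchanged outside of it. -/
def LocalMove {n : ℕ} (k : ℕ) (u v : List ℕ) (D D' : ExtDiagram n) : Prop :=
  ∃ x₀ c y₀ h : ℝ, 0 < c ∧ c * (k - 1 / 2) < n ∧ 0 ≤ y₀ ∧ 0 < h ∧ y₀ + h ≤ 1 ∧
    let box : Set (ℝ × ℝ) := Set.Icc (3 / 4) ((k : ℝ) + 1 / 4) ×ˢ Set.Icc 0 1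
    let φ : ℝ × ℝ → AddCircle (n : ℝ) × ℝ :=
      fun p => (((x₀ + c * p.1 : ℝ) : AddCircle (n : ℝ)), y₀ + h * p.2)
    (∀ z, z ∉ φ '' box → (z ∈ D.support ↔ z ∈ D'.support)) ∧
    ∀ p ∈ box, (φ p ∈ D.support ↔ p ∈ planarPicture k u) ∧
      (φ p ∈ D'.support ↔ p ∈ planarPicture k v)

/-- One step of the equivalence defining the diagrammatic monoid: an isotopy, a 2-move (two
consecutive crossings of two strands are replaced by a single one) or one of the 3-moves. -/
def Step {n : ℕ} {hn : 3 ≤ n} (D D' : Diagram hn) : Prop :=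
  Isotopic D.1 D'.1 ∨ LocalMove 2 [1, 1] [1] D.1 D'.1 ∨
    LocalMove 3 [1, 2, 1] [2, 1, 2] D.1 D'.1 ∨ LocalMove 3 [2, 1, 2] [1, 2] D.1 D'.1

/-- The underlying set of the diagrammatic circular Hecke–Kiselman monoid: diagrams up to the
equivalence relation generated by isotopies and 2- and 3-moves. -/
def DC {n : ℕ} (hn : 3 ≤ n) : Type := Quot (Step (hn := hn))

/-- The class of a diagram. -/
def DC.mk {n : ℕ} {hn : 3 ≤ n} (D : Diagram hn) : DC hn := Quot.mk _ D

/-! ### Webs -/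

/-- The lift of the `i`-th strand to the universal cover `ℝ × [0,1]` of the cylinder that starts
at the point `i + 1` (only the `x`-coordinate is recorded). -/
def ExtDiagram.lift {n : ℕ} (D : ExtDiagram n) (i : Fin n) : C(I, ℝ) :=
  (AddCircle.isCoveringMap_coe (n : ℝ)).liftPath
    ⟨fun t => (D.toFun (i, t)).1, by have := D.continuous_toFun; fun_prop⟩
    ((i.val : ℝ) + 1) (by simp [D.lower])

/-- All the strands of the preimage of a diagram in the universal cover: translates by multiples
of `n` of the lifts of its strands. -/
def ExtDiagram.liftedStrand {n : ℕ} (D : ExtDiagram n) (s : Fin n × ℤ) : Set (ℝ × I) :=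
  Set.range fun t : I => (D.lift s.1 t + s.2 * n, (D.toFun (s.1, t)).2)

/-- Two strands form a contractible bigon: two arcs with common endpoints delimit a contractible
part of the cylinder if and only if they lift to arcs with common endpoints. -/
def ExtDiagram.HasContractibleBigon {n : ℕ} (D : ExtDiagram n) : Prop :=
  ∃ s s' : Fin n × ℤ, s ≠ s' ∧ (D.liftedStrand s ∩ D.liftedStrand s').Nontrivial

/-- Three strands form a contractible triangle: they have pairwise intersecting lifts. -/
def ExtDiagram.HasContractibleTriangle {n : ℕ} (D : ExtDiagram n) : Prop :=
  ∃ s₁ s₂ s₃ : Fin n × ℤ, s₁ ≠ s₂ ∧ s₂ ≠ s₃ ∧ s₁ ≠ s₃ ∧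
    (D.liftedStrand s₁ ∩ D.liftedStrand s₂).Nonempty ∧
    (D.liftedStrand s₂ ∩ D.liftedStrand s₃).Nonempty ∧
    (D.liftedStrand s₁ ∩ D.liftedStrand s₃).Nonempty

/-- Webs: diagrams without contractible bigons or triangles. -/
def Web {n : ℕ} (hn : 3 ≤ n) : Type :=
  {D : Diagram hn // ¬ D.1.HasContractibleBigon ∧ ¬ D.1.HasContractibleTriangle}

/-- The set of webs up to isotopy. -/
def WC {n : ℕ} (hn : 3 ≤ n) : Type := Quot fun W W' : Web hn => Isotopic W.1.1 W'.1.1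

/-- The isotopy class of a web. -/
def WC.mk {n : ℕ} {hn : 3 ≤ n} (W : Web hn) : WC hn := Quot.mk _ W

/-- The map induced by the inclusion of webs into diagrams. -/
def webInclusion {n : ℕ} {hn : 3 ≤ n} : WC hn → DC hn :=
  Quot.map (fun W => W.1) fun _ _ h => Or.inl h

/-! ### Integer sequences -/

/-- `n`-close increasing couples of increasing integer sequences `(a_t)`, `(b_t)`. For increasing
`(b_t)`, the last condition means that the last `b_t` is smaller than the first one plus `n`. -/
structure IsIIC (n : ℕ) (c : List ℤ × List ℤ) : Prop where
  size_lt : c.1.length < n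
  a_lt_b : List.Forall₂ (· < ·) c.1 c.2
  a_increasing : c.1.Pairwise (· < ·)
  a_mem : ∀ a ∈ c.1, 1 ≤ a ∧ a ≤ n
  b_increasing : c.2.Pairwise (· < ·)
  b_close : ∀ b ∈ c.2, ∀ b' ∈ c.2, b' < b + n

/-- The set of `n`-close increasing couples of increasing integer sequences. -/
def IIC (n : ℕ) : Type := {c : List ℤ × List ℤ // IsIIC n c}

/-- The number `b = s + n * h` associated with a strand: `s ∈ {1, …, n}` is its upper endpoint and
`h` is the (algebraic) number of times that it crosses the segment `{n + 1/2} × [0,1]` in the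
positive direction. This is the endpoint, an integer, of its lift. -/
def ExtDiagram.upperEnd {n : ℕ} (D : ExtDiagram n) (i : Fin n) : ℤ := ⌊D.lift i 1⌋

/-- The right sequence couple of a diagram: the sequence of lower endpoints `a` of its right
strands, in increasing order, and the sequence of the corresponding numbers `b`. A strand is right
if it goes in the positive direction of the circle, which is determined by the endpoints of its
lift. -/
def ExtDiagram.rightCouple {n : ℕ} (D : ExtDiagram n) : List ℤ × List ℤ :=
  let right := (List.finRange n).filter fun i => decide ((i.val : ℤ) + 1 < D.upperEnd i)
  (right.map fun i => (i.val : ℤ) + 1, right.map D.upperEnd)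

/-! ### The action on integer sequences, and the normal form -/

/-- The map `σ_{i+1}` acting on `ℕⁿ`: it sends the components `(a, b)` at the cyclically
neighbouring places `i + 1`, `i + 2` to `(a, a)`, or to `(a, a + n)` if these places are `n`
and `1`. -/
def sigma {n : ℕ} (i : Fin n) (y : Fin n → ℕ) : Fin n → ℕ :=
  Function.update y (nxt i) (if i.val + 1 = n then y i + n else y i)

/-- The sequence `(1, 2, …, n)`. -/
def start (n : ℕ) : Fin n → ℕ := fun i => i.val + 1

/-- The largest entry of `y` congruent to `a` modulo `n`. -/
def maxEntry {n : ℕ} (y : Fin n → ℕ) (a : ℕ) : ℕ :=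
  (Finset.univ.filter fun j => y j ≡ a [MOD n]).sup y

/-- The rightmost place where this largest entry occurs in `y` (places are `1, …, n`). -/
def maxPlace {n : ℕ} (y : Fin n → ℕ) (a : ℕ) : ℕ :=
  (Finset.univ.filter fun j => y j = maxEntry y a).sup fun j => j.val + 1

/-- The number `b = s + m - a`, with `m` the largest entry congruent to `a` and `s` its rightmost
place. -/
def bValue {n : ℕ} (y : Fin n → ℕ) (a : ℕ) : ℤ := maxPlace y a + maxEntry y a - a

/-- The couple of sequences read off from `y`: the `a ∈ {1, …, n}` congruent to some entry of `y`,
in increasing order, and the corresponding `b`, the pairs with `b = a` being discarded. -/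
def coupleOf {n : ℕ} (y : Fin n → ℕ) : List ℤ × List ℤ :=
  let as := ((List.range n).map (· + 1)).filter fun a =>
    decide ((∃ j, y j ≡ a [MOD n]) ∧ bValue y a ≠ a)
  (as.map fun a => (a : ℤ), as.map (bValue y))

/-- The normal form of a word: let its letters act, from left to right, on `(1, 2, …, n)`, and
read off the couple of sequences. -/
def normalForm {n : ℕ} (w : List (Fin n)) : List ℤ × List ℤ :=
  coupleOf (w.foldl (fun y i => sigma i y) (start n))

/-! ### Running time -/

/-- Programs of a unit-cost random access machine over the integers, with finitely many registers
and arrays, whose operations are assignment of constants, addition, subtraction, indexed reading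
and writing, and control flow depending on the positivity of a register. -/
inductive Prog
  | const (x : ℕ) (c : ℤ)
  | add (x y z : ℕ)
  | sub (x y z : ℕ)
  | load (x a y : ℕ)
  | store (a y x : ℕ)
  | seq (p q : Prog)
  | ifPos (x : ℕ) (p q : Prog)
  | whilePos (x : ℕ) (p : Prog)

/-- Memory states: the contents of registers and arrays. -/
structure Mem where
  reg : ℕ → ℤ
  arr : ℕ → ℤ → ℤ

/-- `Exec p s t s'`: started in the state `s`, the program `p` halts after `t` steps in the state
`s'`. -/
inductive Exec : Prog → Mem → ℕ → Mem → Prop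
  | const (x : ℕ) (c : ℤ) (s : Mem) :
      Exec (.const x c) s 1 { s with reg := Function.update s.reg x c }
  | add (x y z : ℕ) (s : Mem) :
      Exec (.add x y z) s 1 { s with reg := Function.update s.reg x (s.reg y + s.reg z) }
  | sub (x y z : ℕ) (s : Mem) :
      Exec (.sub x y z) s 1 { s with reg := Function.update s.reg x (s.reg y - s.reg z) }
  | load (x a y : ℕ) (s : Mem) :
      Exec (.load x a y) s 1 { s with reg := Function.update s.reg x (s.arr a (s.reg y)) }
  | store (a y x : ℕ) (s : Mem) :
      Exec (.store a y x) s 1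
        { s with arr := Function.update s.arr a
                  (Function.update (s.arr a) (s.reg y) (s.reg x)) }
  | seq {p q : Prog} {s s' s'' : Mem} {t t' : ℕ} :
      Exec p s t s' → Exec q s' t' s'' → Exec (.seq p q) s (t + t') s''
  | ifPos_true {x : ℕ} {p q : Prog} {s s' : Mem} {t : ℕ} :
      0 < s.reg x → Exec p s t s' → Exec (.ifPos x p q) s (t + 1) s'
  | ifPos_false {x : ℕ} {p q : Prog} {s s' : Mem} {t : ℕ} :
      ¬ 0 < s.reg x → Exec q s t s' → Exec (.ifPos x p q) s (t + 1) s'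
  | whilePos_true {x : ℕ} {p : Prog} {s s' s'' : Mem} {t t' : ℕ} :
      0 < s.reg x → Exec p s t s' → Exec (.whilePos x p) s' t' s'' →
      Exec (.whilePos x p) s (t + t' + 1) s''
  | whilePos_false {x : ℕ} {p : Prog} {s : Mem} :
      ¬ 0 < s.reg x → Exec (.whilePos x p) s 1 s

/-- The initial state for a word `w` in the generators `x_1, …, x_n`: register `0` contains `n`,
register `1` the length of the word, array `0` the indices of its letters; everything else is
`0`. -/
def inputMem {n : ℕ} (w : List (Fin n)) : Mem where
  reg := fun r => if r = 0 then (n : ℤ) else if r = 1 then (w.length : ℤ) else 0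
  arr := fun a j =>
    if a = 0 ∧ 0 ≤ j then ((w.map fun i => (i.val : ℤ) + 1).getD j.toNat 0) else 0

/-- A state contains the couple of sequences `c` as a result: register `0` contains their size, and
the arrays `1` and `2` contain the sequences. -/
def IsOutput (s : Mem) (c : List ℤ × List ℤ) : Prop :=
  s.reg 0 = c.1.length ∧ c.2.length = c.1.length ∧
    (∀ t < c.1.length, s.arr 1 t = c.1.getD t 0) ∧
    ∀ t < c.2.length, s.arr 2 t = c.2.getD t 0

end HeckeKiselman

end

open HeckeKiselman

/-!
# Webs and the word problem of the circular Hecke–Kiselman monoid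

A word `w` in the generators is a stack of crossings on the cylinder. In the universal cover the
strands are numbered by integers, and two functions `ℤ → ℤ`, both commuting with the translation
by `n`, carry the proof: `strand w p` is the upper endpoint of the strand that starts at `p`, and
`reach w p` is the lower endpoint of the leftmost path that descends from the upper point `p` along
the strands and may change the strand at crossings.

*Reduction to webs.* Call `w` a web word if no strand that crosses at a letter turns back later
(`IsWebWord`). If a letter is put in front of a web word and the result is not a web word, then the
letter occurs a second time, and the relations allow deleting one of the two occurrences; so every
element of the monoid is represented by a web word (`exists_webWord`). A web word is determined, up
to commutations of far letters, by its strands that go to the right (`IsWebWord.commEq`), and these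
can be prescribed arbitrarily within the conditions that define `IIC n` (`IsIIC.exists_webWord`).
In a web word `reach` has the value `a` exactly if the strand from `a` does not go to the left, and
the largest argument with this value is then the upper endpoint of this strand
(`IsWebWord.reach_strand`, `IsWebWord.reach_ne`). So `reach` determines the class of a web word. The
result of the action of `w` on `(1, …, n)` is `reach w` in another notation (`encodes_foldl`), and
the recipe for the couple reads off these largest arguments (`IsWebWord.normalForm_eq`). Since the
action is an action of the monoid, the normal form solves the word problem
(`ofWord_eq_of_normalForm_eq`).

*Diagrams.* Every diagram is isotopic to the diagram of a word (`exists_mk_eq_wordDiagram`). Words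
that differ by commutations of far letters have isotopic diagrams (`Far.isotopic`), by interpolation
in explicit coordinates, and the other relations are realized by local moves
(`localMove_wordDiagram`); this gives the surjective homomorphism `toDC` from the monoid to the
diagrams modulo isotopies and local moves. The diagram of a word has no contractible bigons and
triangles exactly if the word is a web word (`IsWebWord.isWeb`, `isWebWord_of_isWeb`).

*Injectivity.* It remains to see that `reach` is an invariant of the diagrams. The relation
`LeftReach D p x` says that some path descends from `p` along the strands of `D` to a point that is
not to the right of `x`. A local move does not change it, because in all the pictures of local moves
every upper point is joined to the lower left corner (`LeftConnected`, `LeftReach.of_localMove`). An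
isotopy does not change it either, because continuous paths can be replaced by combinatorial climbs
along the strands, which only depend on the double points (`leftReach_iff_climb`,
`Isotopic.leftReach_iff`). For the diagram of a word, the leftmost point that is reached is
`reach w p` (`leftReach_wordDiagram`).

*Running time.* Apart from assignments, the program consists of four loops (`normalFormProg`): they
write `(1, …, n)`, apply the letters, find the largest entry of each residue class together with its
rightmost place, and write the couple. Each pass takes a bounded number of steps, because the
residues are stored along with the entries.
-/

namespace HeckeKiselman

/-! ### Affine permutations and leftmost paths of words -/

/-- The letter `i` acts on the integer positions `p` and `p + 1`, where `p` is a lift of the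
number `i + 1` that `i : Fin n` stands for. -/
def At {n : ℕ} (i : Fin n) (p : ℤ) : Prop := (n : ℤ) ∣ p - (i.val + 1)

instance {n : ℕ} (i : Fin n) (p : ℤ) : Decidable (At i p) := by unfold At; infer_instance

theorem At.dvd {n : ℕ} {i : Fin n} {p q : ℤ} (h : At i p) (h' : At i q) : (n : ℤ) ∣ p - q := by
  have := dvd_sub h h'
  simpa using this

theorem At.not_of_lt {n : ℕ} {i : Fin n} {p q : ℤ} (h : At i p) (h₁ : p < q) (h₂ : q < p + n) :
    ¬ At i q := fun h' => by
  have := Int.le_of_dvd (by omega) (h'.dvd h)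
  omega

theorem At.not_add_one {n : ℕ} (hn : 3 ≤ n) {i : Fin n} {p : ℤ} (h : At i p) : ¬ At i (p + 1) :=
  h.not_of_lt (by omega) (by omega)

theorem At.not_add_two {n : ℕ} (hn : 3 ≤ n) {i : Fin n} {p : ℤ} (h : At i p) : ¬ At i (p + 2) :=
  h.not_of_lt (by omega) (by omega)

theorem At.not_sub_one {n : ℕ} (hn : 3 ≤ n) {i : Fin n} {p : ℤ} (h : At i p) : ¬ At i (p - 1) :=
  fun h' => by
    have := h'.not_add_one hn
    rw [sub_add_cancel] at this
    exact this h

theorem at_add_mul {n : ℕ} {i : Fin n} {p m : ℤ} : At i (p + m * n) ↔ At i p := by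
  unfold At
  rw [show p + m * n - (i.val + 1) = p - (i.val + 1) + n * m by ring]
  exact dvd_add_left (dvd_mul_right _ _)

theorem at_add_n {n : ℕ} {i : Fin n} {p : ℤ} : At i (p + n) ↔ At i p := by
  simpa using at_add_mul (i := i) (p := p) (m := 1)

theorem At.eq {n : ℕ} {i j : Fin n} {p : ℤ} (h : At i p) (h' : At j p) : i = j := by
  have h1 : (n : ℤ) ∣ (i.val : ℤ) - j.val := by
    have := dvd_sub h' h
    simpa using this
  have hi := i.isLt
  have hj := j.isLt
  have h2 : (i.val : ℤ) - j.val = 0 := by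
    apply Int.eq_zero_of_abs_lt_dvd h1
    rw [abs_lt]
    omega
  exact Fin.ext (by omega)

theorem at_self {n : ℕ} (i : Fin n) : At i (i.val + 1) := by simp [At]

theorem exists_at {n : ℕ} (hn : 3 ≤ n) (p : ℤ) : ∃ i : Fin n, ∃ m : ℤ, p = i.val + 1 + m * n := by
  have h0 : 0 ≤ (p - 1) % (n : ℤ) := Int.emod_nonneg _ (by omega)
  have h1 : (p - 1) % (n : ℤ) < n := Int.emod_lt_of_pos _ (by omega)
  refine ⟨⟨((p - 1) % (n : ℤ)).toNat, by omega⟩, (p - 1) / n, ?_⟩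
  have := Int.emod_add_mul_ediv (p - 1) n
  simp only [Int.toNat_of_nonneg h0]
  linarith

theorem at_nxt {n : ℕ} {i : Fin n} {p : ℤ} : At (nxt i) (p + 1) ↔ At i p := by
  unfold At
  have h := Nat.mod_add_div (i.val + 1) n
  have h' : (((i.val + 1) % n : ℕ) : ℤ) + n * (((i.val + 1) / n : ℕ) : ℤ) = i.val + 1 := by
    exact_mod_cast h
  have e : p + 1 - (((nxt i).val : ℤ) + 1) = p - (i.val + 1) + n * (((i.val + 1) / n : ℕ) : ℤ) := by
    simp only [nxt]
    linarith
  rw [e]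
  exact dvd_add_left (dvd_mul_right _ _)

/-- The transposition of the positions that the letter `i` acts on. -/
def swp {n : ℕ} (i : Fin n) (p : ℤ) : ℤ :=
  if At i p then p + 1 else if At i (p - 1) then p - 1 else p

/-- The position below the crossing `i` that is reached from the position `p` above it by the
leftmost descending path. -/
def prj {n : ℕ} (i : Fin n) (p : ℤ) : ℤ := if At i (p - 1) then p - 1 else p

/-- The upper endpoint of the lifted strand that starts at `p`, in the diagram of a word. -/
def strand {n : ℕ} : List (Fin n) → ℤ → ℤ
  | [], p => p
  | i :: u, p => strand u (swp i p)

/-- The lower endpoint of the leftmost descending path from the upper endpoint `p`, in the diagram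
of a word. -/
def reach {n : ℕ} : List (Fin n) → ℤ → ℤ
  | [], p => p
  | i :: u, p => prj i (reach u p)

/-- Words whose diagrams are webs. The condition says that the strands crossing at a letter move
apart, or stay, in the rest of the diagram. -/
def IsWebWord {n : ℕ} : List (Fin n) → Prop
  | [] => True
  | i :: u => IsWebWord u ∧ ∀ p, At i p → strand u p ≤ p ∧ p + 1 ≤ strand u (p + 1)

theorem swp_of_at {n : ℕ} {i : Fin n} {p : ℤ} (h : At i p) : swp i p = p + 1 := if_pos h

theorem swp_of_at' {n : ℕ} (hn : 3 ≤ n) {i : Fin n} {p : ℤ} (h : At i p) : swp i (p + 1) = p := by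
  rw [swp, if_neg (h.not_add_one hn), if_pos (by simpa using h)]
  ring

theorem swp_of_not {n : ℕ} {i : Fin n} {p : ℤ} (h : ¬ At i p) (h' : ¬ At i (p - 1)) :
    swp i p = p := by
  rw [swp, if_neg h, if_neg h']

theorem swp_swp {n : ℕ} (hn : 3 ≤ n) (i : Fin n) (p : ℤ) : swp i (swp i p) = p := by
  by_cases h : At i p
  · rw [swp_of_at h, swp_of_at' hn h]
  by_cases h' : At i (p - 1)
  · have := swp_of_at' hn h'
    rw [sub_add_cancel] at this
    rw [this, swp_of_at h']
    ring
  · rw [swp_of_not h h', swp_of_not h h']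

theorem swp_add_n {n : ℕ} (i : Fin n) (p : ℤ) : swp i (p + n) = swp i p + n := by
  unfold swp
  rw [show p + n - 1 = p - 1 + n by ring]
  simp only [at_add_n]
  split_ifs <;> ring

theorem prj_add_n {n : ℕ} (i : Fin n) (p : ℤ) : prj i (p + n) = prj i p + n := by
  unfold prj
  rw [show p + n - 1 = p - 1 + n by ring]
  simp only [at_add_n]
  split_ifs <;> ring

theorem strand_add_n {n : ℕ} (w : List (Fin n)) (p : ℤ) : strand w (p + n) = strand w p + n := by
  induction w generalizing p with
  | nil => rfl
  | cons i u ih => simp only [strand, swp_add_n, ih]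

theorem reach_add_n {n : ℕ} (w : List (Fin n)) (p : ℤ) : reach w (p + n) = reach w p + n := by
  induction w generalizing p with
  | nil => rfl
  | cons i u ih => simp only [reach, prj_add_n, ih]

theorem add_mul_n {n : ℕ} {f : ℤ → ℤ} (hf : ∀ p, f (p + n) = f p + n) (p m : ℤ) :
    f (p + m * n) = f p + m * n := by
  induction m with
  | zero => simp
  | succ k ih =>
    rw [show p + ((k : ℤ) + 1) * n = p + k * n + n by ring, hf, ih]
    ring
  | pred k ih =>
    have := hf (p + (-(k : ℤ) - 1) * n)
    rw [show p + (-(k : ℤ) - 1) * n + n = p + -(k : ℤ) * n by ring, ih] at this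
    linarith

theorem prj_mono {n : ℕ} (i : Fin n) : Monotone (prj i) := by
  intro p q h
  unfold prj
  rcases h.eq_or_lt with rfl | h
  · rfl
  · split_ifs <;> omega

theorem prj_le {n : ℕ} (i : Fin n) (p : ℤ) : prj i p ≤ p := by
  unfold prj
  split_ifs <;> omega

theorem reach_mono {n : ℕ} (w : List (Fin n)) : Monotone (reach w) := by
  induction w with
  | nil => exact monotone_id
  | cons i u ih => exact fun p q h => prj_mono i (ih h)

theorem reach_append {n : ℕ} (u v : List (Fin n)) (p : ℤ) :
    reach (u ++ v) p = reach u (reach v p) := by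
  induction u with
  | nil => rfl
  | cons i u ih => simp only [List.cons_append, reach, ih]

/-! ### Web words up to commutations -/

/-- Letters that act on disjoint pairs of positions. -/
def Far {n : ℕ} (i j : Fin n) : Prop :=
  ∀ p, At i p → ¬ At j p ∧ ¬ At j (p + 1) ∧ ¬ At j (p - 1)

theorem Far.symm {n : ℕ} {i j : Fin n} (h : Far i j) : Far j i := by
  refine fun p hp => ⟨fun h' => (h p h').1 hp, fun h' => (h _ h').2.2 (by simpa using hp),
    fun h' => (h _ h').2.1 (by simpa using hp)⟩

theorem far_of_at {n : ℕ} {i j : Fin n} {p : ℤ} (h : At i p) (h₀ : ¬ At j p) (h₁ : ¬ At j (p + 1))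
    (h₂ : ¬ At j (p - 1)) : Far i j := by
  intro q hq
  obtain ⟨m, hm⟩ := hq.dvd h
  have e : q = p + m * n := by linarith
  subst e
  rw [show p + m * n + 1 = p + 1 + m * n by ring, show p + m * n - 1 = p - 1 + m * n by ring]
  simp only [at_add_mul]
  exact ⟨h₀, h₁, h₂⟩

theorem Far.swp_eq {n : ℕ} {i j : Fin n} (h : Far i j) {p : ℤ} (hp : At i p) :
    swp j p = p ∧ swp j (p + 1) = p + 1 :=
  ⟨swp_of_not (h p hp).1 (h p hp).2.2,
    swp_of_not (h p hp).2.1 (by rw [add_sub_cancel_right]; exact (h p hp).1)⟩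

theorem Far.swp_comm {n : ℕ} (hn : 3 ≤ n) {i j : Fin n} (h : Far i j) (p : ℤ) :
    swp i (swp j p) = swp j (swp i p) := by
  have key : ∀ (i j : Fin n), Far i j → ∀ p, At i p ∨ At i (p - 1) →
      swp i (swp j p) = swp j (swp i p) := by
    rintro i j h p (hp | hp)
    · rw [(h.swp_eq hp).1, swp_of_at hp, (h.swp_eq hp).2]
    · have h1 := (h.swp_eq hp).2
      have h2 := swp_of_at' hn hp
      rw [sub_add_cancel] at h1 h2
      rw [h1, h2, (h.swp_eq hp).1]
  by_cases hi : At i p ∨ At i (p - 1)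
  · exact key i j h p hi
  by_cases hj : At j p ∨ At j (p - 1)
  · exact (key j i h.symm p hj).symm
  push Not at hi hj
  rw [swp_of_not hi.1 hi.2, swp_of_not hj.1 hj.2, swp_of_not hi.1 hi.2]

/-- Equality of words up to the commutation of far letters. -/
inductive CommEq {n : ℕ} : List (Fin n) → List (Fin n) → Prop
  | refl (w : List (Fin n)) : CommEq w w
  | cons (i : Fin n) {u v : List (Fin n)} : CommEq u v → CommEq (i :: u) (i :: v)
  | swap {i j : Fin n} (u : List (Fin n)) : Far i j → CommEq (i :: j :: u) (j :: i :: u)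
  | trans {u v w : List (Fin n)} : CommEq u v → CommEq v w → CommEq u w

theorem CommEq.symm {n : ℕ} {u v : List (Fin n)} (h : CommEq u v) : CommEq v u := by
  induction h with
  | refl w => exact .refl w
  | cons i _ ih => exact ih.cons i
  | swap u h => exact .swap u h.symm
  | trans _ _ ih ih' => exact ih'.trans ih

theorem CommEq.strand_eq {n : ℕ} (hn : 3 ≤ n) {u v : List (Fin n)} (h : CommEq u v) (p : ℤ) :
    strand u p = strand v p := by
  induction h generalizing p with
  | refl w => rfl
  | cons i _ ih => exact ih _
  | swap u h => simp only [strand, h.swp_comm hn]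
  | trans _ _ ih ih' => exact (ih p).trans (ih' p)

/-- In a web word, a letter can be moved to the front if the left one of the two strands starting
at its positions goes to the right and the other one does not. -/
theorem IsWebWord.exists_front {n : ℕ} (hn : 3 ≤ n) {w : List (Fin n)} (hw : IsWebWord w)
    {i : Fin n} {p : ℤ} (hp : At i p) (h : p < strand w p) (h' : strand w (p + 1) ≤ p + 1) :
    ∃ u, CommEq w (i :: u) ∧ IsWebWord (i :: u) := by
  induction w with
  | nil => simp [strand] at h
  | cons j u ih =>
    obtain ⟨hu, hj⟩ := hw
    by_cases e : At j p
    · obtain rfl := hp.eq e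
      exact ⟨u, .refl _, hu, hj⟩
    by_cases e1 : At j (p + 1)
    · have := (hj _ e1).2
      simp only [strand, swp_of_at e1] at h'
      omega
    by_cases e2 : At j (p - 1)
    · have h1 := (hj _ e2).1
      have h2 := swp_of_at' hn e2
      rw [sub_add_cancel] at h2
      simp only [strand, h2] at h
      omega
    have far := far_of_at hp e e1 e2
    simp only [strand, (far.swp_eq hp).1, (far.swp_eq hp).2] at h h'
    obtain ⟨v, huv, hv, hi⟩ := ih hu h h'
    refine ⟨j :: v, (huv.cons j).trans (.swap v far.symm), ⟨hv, fun q hq => ?_⟩, fun q hq => ?_⟩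
    · have := hj q hq
      simp only [huv.strand_eq hn, strand, (far.symm.swp_eq hq).1, (far.symm.swp_eq hq).2] at this
      exact this
    · simp only [strand, (far.swp_eq hq).1, (far.swp_eq hq).2]
      exact hi q hq

theorem IsWebWord.cons_strand {n : ℕ} (hn : 3 ≤ n) {i : Fin n} {u : List (Fin n)}
    (hw : IsWebWord (i :: u)) {p : ℤ} (hp : At i p) :
    p < strand (i :: u) p ∧ strand (i :: u) (p + 1) < p + 1 := by
  have := hw.2 p hp
  simp only [strand, swp_of_at hp, swp_of_at' hn hp]
  omega

/-- A web word is determined, up to commutations, by the strands that go to the right: its first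
letter can be moved to the front of every other web word with the same such strands, and then be
cancelled. -/
theorem IsWebWord.commEq {n : ℕ} (hn : 3 ≤ n) {u v : List (Fin n)} (hu : IsWebWord u)
    (hv : IsWebWord v) (h : ∀ a, max (strand u a) a = max (strand v a) a) : CommEq u v := by
  induction u generalizing v with
  | nil =>
    cases v with
    | nil => exact .refl _
    | cons i v =>
      have h1 := h (i.val + 1)
      have h2 := (hv.cons_strand hn (at_self i)).1
      rw [max_eq_left h2.le] at h1
      simp only [strand, max_self] at h1 h2
      omega
  | cons i u ih =>
    have h1 := hu.cons_strand hn (at_self i)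
    have h2 := h (i.val + 1)
    have h3 := h (i.val + 1 + 1)
    rw [max_eq_left h1.1.le] at h2
    rw [max_eq_right h1.2.le] at h3
    obtain ⟨v', hvv, hv'⟩ := hv.exists_front hn (at_self i) (by
      by_contra hlt
      rw [max_eq_right (not_lt.1 hlt)] at h2
      omega) ((le_max_left _ _).trans h3.ge)
    refine .trans (.cons i (ih hu.1 hv'.1 fun a => ?_)) hvv.symm
    have h4 := h (swp i a)
    rw [hvv.strand_eq hn] at h4
    simp only [strand, swp_swp hn] at h4
    by_cases ha : At i a
    · rw [max_eq_right (hu.2 a ha).1, max_eq_right (hv'.2 a ha).1]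
    by_cases ha' : At i (a - 1)
    · have e1 := (hu.2 _ ha').2
      have e2 := (hv'.2 _ ha').2
      have e3 := swp_of_at' hn ha'
      rw [sub_add_cancel] at e1 e2 e3
      rw [e3] at h4
      omega
    · rwa [swp_of_not ha ha'] at h4

/-! ### Reduction of words to web words in the monoid -/

theorem gen_idem {n : ℕ} (i : Fin n) : gen i * gen i = gen i :=
  PresentedMonoid.mk_eq_mk_of_rel ((Rel.idem i))

theorem gen_braid {n : ℕ} (i : Fin n) :
    gen i * gen (nxt i) * gen i = gen i * gen (nxt i) :=
  (PresentedMonoid.mk_eq_mk_of_rel ((Rel.braid i))).trans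
    (PresentedMonoid.mk_eq_mk_of_rel ((Rel.kiselman i)))

theorem gen_kiselman {n : ℕ} (i : Fin n) :
    gen (nxt i) * gen i * gen (nxt i) = gen i * gen (nxt i) :=
  PresentedMonoid.mk_eq_mk_of_rel ((Rel.kiselman i))

theorem Far.or_lt {n : ℕ} {i j : Fin n} (h : Far i j) :
    (j.val + 1 < i.val ∧ i.val + 1 < j.val + n) ∨ (i.val + 1 < j.val ∧ j.val + 1 < i.val + n) := by
  have hi := i.isLt
  have hj := j.isLt
  obtain ⟨h0, h1, h2⟩ := h _ (at_self i)
  unfold At at h0 h1 h2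
  have a0 : i.val ≠ j.val := fun e => h0 (by simp [e])
  have a1 : i.val + 1 ≠ j.val := fun e => h1 (by rw [← e]; simp)
  have a2 : i.val ≠ j.val + 1 := fun e => h2 (by rw [e]; simp)
  have a3 : i.val + 1 ≠ j.val + n := fun e => h1 ⟨1, by push_cast [← @Nat.cast_inj ℤ] at e; linarith⟩
  have a4 : i.val + n ≠ j.val + 1 := fun e => h2 ⟨-1, by push_cast [← @Nat.cast_inj ℤ] at e; linarith⟩
  omega

theorem Far.gen_comm {n : ℕ} {i j : Fin n} (h : Far i j) : gen i * gen j = gen j * gen i := by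
  rcases h.or_lt with h | h
  · exact PresentedMonoid.mk_eq_mk_of_rel ((Rel.far i j h.1 h.2))
  · exact (PresentedMonoid.mk_eq_mk_of_rel ((Rel.far j i h.1 h.2))).symm

theorem ofWord_cons {n : ℕ} (i : Fin n) (w : List (Fin n)) : ofWord (i :: w) = gen i * ofWord w := by
  simp [ofWord]

theorem ofWord_append {n : ℕ} (u v : List (Fin n)) : ofWord (u ++ v) = ofWord u * ofWord v := by
  simp [ofWord]

theorem exists_ofWord {n : ℕ} (x : CMonoid n) : ∃ w, x = ofWord w := by
  obtain ⟨f, rfl⟩ := PresentedMonoid.surjective_mk x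
  refine ⟨f.toList, ?_⟩
  induction f using FreeMonoid.inductionOn' with
  | one => rfl
  | of_mul a f ih =>
    rw [map_mul, ih]
    exact (ofWord_cons _ _).symm

theorem CommEq.ofWord_eq {n : ℕ} {u v : List (Fin n)} (h : CommEq u v) : ofWord u = ofWord v := by
  induction h with
  | refl w => rfl
  | cons i _ ih => rw [ofWord_cons, ih, ofWord_cons]
  | swap u h => simp only [ofWord_cons, ← mul_assoc, h.gen_comm]
  | trans _ _ ih ih' => exact ih.trans ih'

theorem far_of_ne {n : ℕ} {i j : Fin n} (h : j ≠ i) (h₁ : nxt j ≠ i) (h₂ : j ≠ nxt i) :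
    Far i j := by
  refine far_of_at (at_self i) (fun h' => h (h'.eq (at_self i)))
    (fun h' => h₂ (h'.eq (at_nxt.2 (at_self i)))) fun h' => h₁ ?_
  have := at_nxt.2 h'
  rw [sub_add_cancel] at this
  exact this.eq (at_self i)

/-- A repetition of the letter `i` can be deleted if its predecessor does not occur in between. -/
theorem gen_mul_ofWord_mul_gen {n : ℕ} {i : Fin n} (v : List (Fin n))
    (hv : ∀ j ∈ v, j ≠ i ∧ nxt j ≠ i) : gen i * ofWord v * gen i = gen i * ofWord v := by
  induction v using List.reverseRecOn with
  | nil => simpa [ofWord] using gen_idem i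
  | append_singleton v j ih =>
    have ih := ih fun k hk => hv k (by simp [hk])
    obtain ⟨h1, h2⟩ := hv j (by simp)
    have e : ofWord (v ++ [j]) = ofWord v * gen j := by simp [ofWord]
    rw [e]
    by_cases h3 : j = nxt i
    · subst h3
      calc gen i * (ofWord v * gen (nxt i)) * gen i
          = gen i * ofWord v * gen (nxt i) * gen i := by simp only [mul_assoc]
        _ = gen i * ofWord v * gen i * gen (nxt i) * gen i := by rw [ih]
        _ = gen i * ofWord v * (gen i * gen (nxt i) * gen i) := by simp only [mul_assoc]
        _ = gen i * ofWord v * gen i * gen (nxt i) := by rw [gen_braid]; simp only [mul_assoc]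
        _ = gen i * (ofWord v * gen (nxt i)) := by rw [ih, mul_assoc]
    · calc gen i * (ofWord v * gen j) * gen i
          = gen i * ofWord v * (gen j * gen i) := by simp only [mul_assoc]
        _ = gen i * ofWord v * gen i * gen j := by
          rw [← (far_of_ne h1 h2 h3).gen_comm]; simp only [mul_assoc]
        _ = gen i * (ofWord v * gen j) := by rw [ih, mul_assoc]

/-- The first one of two letters `i` can be deleted if the successor of `i` does not occur in
between. -/
theorem gen_mul_ofWord_mul_gen' {n : ℕ} {i : Fin n} (v : List (Fin n))
    (hv : ∀ j ∈ v, j ≠ i ∧ j ≠ nxt i) : gen i * ofWord v * gen i = ofWord v * gen i := by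
  induction v with
  | nil => simpa [ofWord] using gen_idem i
  | cons j v ih =>
    have ih := ih fun k hk => hv k (by simp [hk])
    obtain ⟨h1, h2⟩ := hv j (by simp)
    rw [ofWord_cons]
    by_cases h3 : nxt j = i
    · subst h3
      calc gen (nxt j) * (gen j * ofWord v) * gen (nxt j)
          = gen (nxt j) * gen j * (ofWord v * gen (nxt j)) := by simp only [mul_assoc]
        _ = gen (nxt j) * gen j * gen (nxt j) * (ofWord v * gen (nxt j)) := by
          conv_lhs => rw [← ih]
          simp only [mul_assoc]
        _ = gen j * (gen (nxt j) * ofWord v * gen (nxt j)) := by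
          rw [gen_kiselman]; simp only [mul_assoc]
        _ = gen j * ofWord v * gen (nxt j) := by rw [ih]; simp only [mul_assoc]
    · calc gen i * (gen j * ofWord v) * gen i
          = gen i * gen j * (ofWord v * gen i) := by simp only [mul_assoc]
        _ = gen j * (gen i * ofWord v * gen i) := by
          rw [(far_of_ne h1 h3 h2).gen_comm]; simp only [mul_assoc]
        _ = gen j * ofWord v * gen i := by rw [ih]; simp only [mul_assoc]

/-- If the strand of a web word starting at a position of the letter `i` goes to the right, then
`i` occurs in the word, and its predecessor does not occur before it. -/
theorem IsWebWord.split_right {n : ℕ} (hn : 3 ≤ n) {u : List (Fin n)} (hu : IsWebWord u)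
    {i : Fin n} {p : ℤ} (hp : At i p) (h : p < strand u p) :
    ∃ v z, u = v ++ i :: z ∧ ∀ j ∈ v, j ≠ i ∧ nxt j ≠ i := by
  induction u with
  | nil => simp [strand] at h
  | cons j u ih =>
    obtain ⟨hu, hj⟩ := hu
    by_cases e : At j p
    · obtain rfl := hp.eq e
      exact ⟨[], u, rfl, by simp⟩
    by_cases e2 : At j (p - 1)
    · have h1 := (hj _ e2).1
      have h2 := swp_of_at' hn e2
      rw [sub_add_cancel] at h2
      simp only [strand, h2] at h
      omega
    rw [strand, swp_of_not e e2] at h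
    obtain ⟨v, z, rfl, hv⟩ := ih hu h
    refine ⟨j :: v, z, rfl, ?_⟩
    rintro k hk
    rcases List.mem_cons.1 hk with rfl | hk
    · refine ⟨fun h => e (h ▸ hp), fun h => e2 ?_⟩
      rw [← at_nxt, sub_add_cancel, h]
      exact hp
    · exact hv k hk

/-- If the strand of a web word starting to the right of a position of the letter `i` goes to the
left, then `i` occurs in the word, and its successor does not occur before it. -/
theorem IsWebWord.split_left {n : ℕ} {u : List (Fin n)} (hu : IsWebWord u)
    {i : Fin n} {p : ℤ} (hp : At i p) (h : strand u (p + 1) < p + 1) :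
    ∃ v z, u = v ++ i :: z ∧ ∀ j ∈ v, j ≠ i ∧ j ≠ nxt i := by
  induction u with
  | nil => simp [strand] at h
  | cons j u ih =>
    obtain ⟨hu, hj⟩ := hu
    by_cases e : At j p
    · obtain rfl := hp.eq e
      exact ⟨[], u, rfl, by simp⟩
    by_cases e2 : At j (p + 1)
    · have h1 := (hj _ e2).2
      simp only [strand, swp_of_at e2] at h
      omega
    rw [strand, swp_of_not e2 (by simpa using e)] at h
    obtain ⟨v, z, rfl, hv⟩ := ih hu h
    refine ⟨j :: v, z, rfl, ?_⟩
    rintro k hk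
    rcases List.mem_cons.1 hk with rfl | hk
    · exact ⟨fun h => e (h ▸ hp), fun h => e2 (h ▸ at_nxt.2 hp)⟩
    · exact hv k hk

/-- Every element of the monoid is represented by a web word: a word that is not a web word
represents the same element as a shorter one. -/
theorem exists_webWord {n : ℕ} (hn : 3 ≤ n) (w : List (Fin n)) :
    ∃ u, IsWebWord u ∧ u.length ≤ w.length ∧ ofWord w = ofWord u := by
  induction hN : w.length using Nat.strong_induction_on generalizing w with
  | _ N ih =>
  subst hN
  cases w with
  | nil => exact ⟨[], trivial, le_rfl, rfl⟩
  | cons i w =>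
  obtain ⟨u, hu, hlen, e⟩ := ih w.length (by simp) w rfl
  have short : ∀ v : List (Fin n), v.length ≤ u.length → gen i * ofWord u = ofWord v →
      ∃ u, IsWebWord u ∧ u.length ≤ (i :: w).length ∧ ofWord (i :: w) = ofWord u := by
    intro v hv h
    obtain ⟨u', h1, h2, h3⟩ := ih v.length (by simp; omega) v rfl
    refine ⟨u', h1, by simp; omega, ?_⟩
    rw [ofWord_cons, e, h, h3]
  -- If a strand that crosses at the new letter turns back afterwards, then the letter occurs once
  -- more and one of its two occurrences can be deleted.
  by_cases hright : ∃ p, At i p ∧ p < strand u p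
  · obtain ⟨p, hp, h⟩ := hright
    obtain ⟨v, z, rfl, hv⟩ := hu.split_right hn hp h
    refine short (i :: (v ++ z)) (by simp) ?_
    rw [ofWord_append, ofWord_cons, ← mul_assoc, ← mul_assoc, gen_mul_ofWord_mul_gen v hv,
      ofWord_cons, ofWord_append, mul_assoc]
  by_cases hleft : ∃ p, At i p ∧ strand u (p + 1) < p + 1
  · obtain ⟨p, hp, h⟩ := hleft
    obtain ⟨v, z, rfl, hv⟩ := hu.split_left hp h
    refine short (v ++ i :: z) le_rfl ?_
    rw [ofWord_append, ofWord_cons, ← mul_assoc, ← mul_assoc, gen_mul_ofWord_mul_gen' v hv,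
      mul_assoc]
  push Not at hright hleft
  refine ⟨i :: u, ⟨hu, fun p hp => ⟨hright p hp, hleft p hp⟩⟩, by simpa using hlen, ?_⟩
  rw [ofWord_cons, e, ofWord_cons]

/-! ### Fibres of the leftmost path map of a web word -/

/-- In a web word, the leftmost descending paths that end where a strand not going to the left
starts are those from the positions up to the upper endpoint of this strand. -/
theorem IsWebWord.reach_strand {n : ℕ} (hn : 3 ≤ n) {w : List (Fin n)} (hw : IsWebWord w) {a : ℤ}
    (h : a ≤ strand w a) : reach w (strand w a) = a ∧ a < reach w (strand w a + 1) := by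
  induction w generalizing a with
  | nil => simp [strand, reach]
  | cons i u ih =>
    obtain ⟨hu, hi⟩ := hw
    by_cases e : At i a
    · simp only [strand, swp_of_at e, reach]
      obtain ⟨h1, h2⟩ := ih hu (hi a e).2
      rw [h1, prj, if_pos (by simpa using e)]
      refine ⟨by ring, ?_⟩
      unfold prj
      split_ifs <;> omega
    by_cases e' : At i (a - 1)
    · have h1 := (hi _ e').1
      have h2 := swp_of_at' hn e'
      rw [sub_add_cancel] at h2
      simp only [strand, h2] at h
      omega
    simp only [strand, swp_of_not e e', reach] at h ⊢
    obtain ⟨h1, h2⟩ := ih hu h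
    rw [h1, prj, if_neg e']
    refine ⟨rfl, ?_⟩
    unfold prj
    split_ifs with h3
    · rcases (show a + 1 ≤ reach u (strand u a + 1) from h2).eq_or_lt with h4 | h4
      · rw [← h4, add_sub_cancel_right] at h3
        exact absurd h3 e
      · omega
    · exact h2

/-- In a web word, no leftmost descending path ends where a strand going to the left starts. -/
theorem IsWebWord.reach_ne {n : ℕ} {w : List (Fin n)} (hw : IsWebWord w) {a : ℤ}
    (h : strand w a < a) (q : ℤ) : reach w q ≠ a := by
  induction w generalizing a with
  | nil => simp [strand] at h
  | cons i u ih =>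
    obtain ⟨hu, hi⟩ := hw
    by_cases e : At i a
    · have := (hi a e).2
      simp only [strand, swp_of_at e] at h
      omega
    by_cases e' : At i (a - 1)
    · intro h1
      simp only [reach, prj] at h1
      split_ifs at h1 with h2
      · rw [h1] at h2
        exact e h2
      · rw [h1] at h2
        exact h2 e'
    · simp only [strand, swp_of_not e e'] at h
      intro h1
      simp only [reach, prj] at h1
      split_ifs at h1 with h2
      · rw [h1] at h2
        exact e h2
      · exact ih hu h h1

/-- The strands of a web that do not go to the left end in the order in which they start. -/
theorem IsWebWord.strand_lt {n : ℕ} (hn : 3 ≤ n) {w : List (Fin n)} (hw : IsWebWord w) {a b : ℤ}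
    (hab : a < b) (ha : a ≤ strand w a) (hb : b ≤ strand w b) : strand w a < strand w b := by
  induction w generalizing a b with
  | nil => exact hab
  | cons i u ih =>
    obtain ⟨hu, hi⟩ := hw
    have key : ∀ c, c ≤ strand (i :: u) c →
        swp i c ≤ strand u (swp i c) ∧ ¬ At i (c - 1) := by
      intro c hc
      by_cases e : At i c
      · rw [swp_of_at e]
        exact ⟨(hi c e).2, e.not_sub_one hn⟩
      by_cases e' : At i (c - 1)
      · have h1 := (hi _ e').1
        have h2 := swp_of_at' hn e'
        rw [sub_add_cancel] at h2
        simp only [strand, h2] at hc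
        omega
      · simp only [strand, swp_of_not e e'] at hc ⊢
        exact ⟨hc, e'⟩
    obtain ⟨a1, a2⟩ := key a ha
    obtain ⟨b1, b2⟩ := key b hb
    refine ih hu ?_ a1 b1
    by_cases e : At i a
    · rcases (show a + 1 ≤ b from hab).eq_or_lt with h | h
      · rw [← h, add_sub_cancel_right] at b2
        exact absurd e b2
      · rw [swp_of_at e]
        unfold swp
        split_ifs <;> omega
    · rw [swp_of_not e a2]
      unfold swp
      split_ifs <;> omega

/-- In every web, some strand does not go to the right. -/
theorem IsWebWord.exists_le {n : ℕ} (hn : 3 ≤ n) {w : List (Fin n)} (hw : IsWebWord w) :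
    ∃ i : Fin n, strand w (i.val + 1) ≤ i.val + 1 := by
  cases w with
  | nil => exact ⟨⟨0, by omega⟩, le_rfl⟩
  | cons i u => exact ⟨nxt i, by
      have h := (at_nxt.2 (at_self i))
      obtain ⟨m, hm⟩ := h.dvd (at_self (nxt i))
      have h1 := (hw.cons_strand hn (at_self i)).2
      have e : (i.val : ℤ) + 1 + 1 = (nxt i).val + 1 + m * n := by linarith
      rw [e, add_mul_n (strand_add_n _)] at h1
      omega⟩

/-! ### Realization of couples of sequences by web words -/

/-- If a strand of a web goes to the left, then some strand crosses it in the other direction. -/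
theorem IsWebWord.exists_crossing {n : ℕ} (hn : 3 ≤ n) {w : List (Fin n)} (hw : IsWebWord w)
    {p : ℤ} (h : strand w (p + 1) < p + 1) : ∃ a ≤ p, p + 1 ≤ strand w a := by
  induction w with
  | nil => simp [strand] at h
  | cons j u ih =>
    have hw' := hw
    obtain ⟨hu, hj⟩ := hw
    by_cases e : At j p
    · exact ⟨p, le_rfl, (hw'.cons_strand hn e).1⟩
    by_cases e' : At j (p + 1)
    · have := (hj _ e').2
      simp only [strand, swp_of_at e'] at h
      omega
    rw [strand, swp_of_not e' (by simpa using e)] at h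
    obtain ⟨a, ha, ha'⟩ := ih hu h
    refine ⟨swp j a, ?_, by rw [strand, swp_swp hn]; exact ha'⟩
    rcases ha.eq_or_lt with rfl | ha
    · unfold swp
      rw [if_neg e]
      split_ifs <;> omega
    · unfold swp
      split_ifs <;> omega

/-- Every `n`-periodic function of integers that is strictly increasing where it is greater than
the identity, and not greater than the identity everywhere, describes the strands going to the
right of some web. The proof is by induction on the total displacement, which decreases when the
letter at a displaced position followed by a fixed one is removed. -/
theorem exists_webWord_of_periodic {n : ℕ} (hn : 3 ≤ n) (r : ℤ → ℤ) (hper : ∀ p, r (p + n) = r p + n)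
    (hle : ∀ p, p ≤ r p) (hinc : ∀ a b, a < b → a < r a → b < r b → r a < r b)
    (hfix : ∃ a, r a = a) : ∃ w : List (Fin n), IsWebWord w ∧ ∀ a, max (strand w a) a = r a := by
  induction hN : (∑ j : Fin n, (r (j.val + 1) - (j.val + 1))).toNat using Nat.strong_induction_on
    generalizing r with
  | _ N ih =>
  subst hN
  by_cases hid : ∀ a, r a = a
  · exact ⟨[], trivial, fun a => by rw [hid]; exact max_self a⟩
  -- a displaced position followed by a fixed one
  obtain ⟨p, hp, hp'⟩ : ∃ p, p < r p ∧ r (p + 1) = p + 1 := by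
    by_contra hcon
    push Not at hid hcon
    obtain ⟨b, hb⟩ := hid
    obtain ⟨a, ha⟩ := hfix
    have h1 : ∀ k : ℕ, b + k < r (b + k) := by
      intro k
      induction k with
      | zero => simpa using lt_of_le_of_ne (hle b) hb.symm
      | succ k ih =>
        have := lt_of_le_of_ne (hle _) (hcon _ ih).symm
        push_cast
        rwa [← add_assoc]
    have h2 := h1 ((a + |b - a| * n - b).toNat)
    have h3 : b - a ≤ |b - a| * n := by
      refine (le_abs_self _).trans (le_mul_of_one_le_right (abs_nonneg _) (by omega))
    rw [Int.toNat_of_nonneg (by linarith), add_sub_cancel, add_mul_n hper, ha] at h2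
    omega
  obtain ⟨i, m, hm⟩ := exists_at hn p
  have hi : At i p := by rw [hm, at_add_mul]; exact at_self i
  -- The strand starting at `p` crosses the next one; `r'` describes the strands above this
  -- crossing.
  set r' : ℤ → ℤ := fun q => if At i q then q else if At i (q - 1) then r (q - 1) else r q with hr'
  have same : ∀ q, At i q → q < r q ∧ r (q + 1) = q + 1 := by
    intro q hq
    obtain ⟨k, hk⟩ := hq.dvd hi
    have e : q = p + k * n := by linarith
    subst e
    rw [show p + k * n + 1 = p + 1 + k * n by ring, add_mul_n hper, add_mul_n hper]
    omega
  have r1 : ∀ q, At i q → r' q = q := fun q h => if_pos h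
  have r2 : ∀ q, At i q → r' (q + 1) = r q := fun q h => by
    simp only [hr']
    rw [if_neg (h.not_add_one hn), add_sub_cancel_right, if_pos h]
  have r3 : ∀ q, ¬ At i q → ¬ At i (q - 1) → r' q = r q := fun q h h' => by
    simp only [hr']
    rw [if_neg h, if_neg h']
  have hr'le : ∀ q, q ≤ r' q := by
    intro q
    by_cases e : At i q
    · exact (r1 q e).ge
    by_cases e' : At i (q - 1)
    · have := r2 _ e'
      rw [sub_add_cancel] at this
      rw [this]
      have := (same _ e').1
      omega
    · rw [r3 q e e']
      exact hle q
  obtain ⟨u, hu, hur⟩ := ih _ (by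
    have hlt : ∑ j : Fin n, (r' (j.val + 1) - (j.val + 1)) <
        ∑ j : Fin n, (r (j.val + 1) - (j.val + 1)) := by
      rw [← sub_pos, ← Finset.sum_sub_distrib]
      have : ∀ j : Fin n, (r (j.val + 1) - (j.val + 1)) - (r' (j.val + 1) - (j.val + 1)) =
          (if j = i then r (i.val + 1) - (i.val + 1) else 0) -
          (if j = nxt i then r (i.val + 1) - (i.val + 1) - 1 else 0) := by
        intro j
        by_cases e : j = i
        · subst e
          rw [if_pos rfl, if_neg (nxt_ne hn j).symm, r1 _ (at_self j)]
          ring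
        rw [if_neg e]
        by_cases e' : j = nxt i
        · subst e'
          have h1 : At i ((nxt i).val + 1 - 1) := by
            rw [← at_nxt, sub_add_cancel]
            exact at_self _
          have h2 := r2 _ h1
          have h3 := (same _ h1).2
          rw [sub_add_cancel] at h2 h3
          obtain ⟨k, hk⟩ := h1.dvd (at_self i)
          have h4 : ((nxt i).val : ℤ) + 1 - 1 = i.val + 1 + k * n := by linarith
          rw [h2, h3, if_pos rfl, h4, add_mul_n hper]
          linarith
        · rw [if_neg e', r3]
          · ring
          · exact fun h => e ((at_self j).eq h)
          · intro h
            apply e'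
            have := at_nxt.2 h
            rw [sub_add_cancel] at this
            exact (at_self j).eq this
      rw [Finset.sum_congr rfl fun j _ => this j, Finset.sum_sub_distrib]
      simp
    have hnn : 0 ≤ ∑ j : Fin n, (r' (j.val + 1) - (j.val + 1)) :=
      Finset.sum_nonneg fun j _ => sub_nonneg.2 (hr'le _)
    omega) r' (by
      intro q
      simp only [hr']
      rw [show q + n - 1 = q - 1 + n by ring]
      simp only [at_add_n, hper]
      split_ifs <;> rfl) hr'le (by
      -- the displaced positions of `r'` come from those of `r` by moving those of the class of `i`
      have key : ∀ a, a < r' a → ∃ a', r' a = r a' ∧ a' < r a' ∧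
          ((a' = a ∧ ¬ At i a) ∨ (a' = a - 1 ∧ At i a')) := by
        intro a ha
        by_cases e : At i a
        · rw [r1 a e] at ha
          omega
        by_cases e' : At i (a - 1)
        · have := r2 _ e'
          rw [sub_add_cancel] at this
          exact ⟨a - 1, this, (same _ e').1, Or.inr ⟨rfl, e'⟩⟩
        · rw [r3 a e e'] at ha
          exact ⟨a, r3 a e e', ha, Or.inl ⟨rfl, e⟩⟩
      intro a b hab ha hb
      obtain ⟨a', ea, ha', hca⟩ := key a ha
      obtain ⟨b', eb, hb', hcb⟩ := key b hb
      rw [ea, eb]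
      refine hinc _ _ ?_ ha' hb'
      rcases hcb with ⟨h1, h2⟩ | ⟨h1, h2⟩
      · rcases hca with ⟨h3, -⟩ | ⟨h3, -⟩ <;> omega
      · rcases hca with ⟨h3, h4⟩ | ⟨h3, -⟩
        · rcases (show a' ≤ b' by omega).eq_or_lt with h | h
          · rw [h3] at h
            rw [h] at h4
            exact absurd h2 h4
          · exact h
        · omega) ⟨p, r1 p hi⟩ rfl
  have hi' : ∀ q, At i q → strand u q ≤ q ∧ q + 1 ≤ strand u (q + 1) := by
    intro q hq
    have h1 := hur q
    have h2 := hur (q + 1)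
    rw [r1 q hq] at h1
    rw [r2 q hq] at h2
    have h3 := (same q hq).1
    refine ⟨le_of_max_le_left h1.le, ?_⟩
    by_contra hlt
    obtain ⟨a, ha, ha'⟩ := hu.exists_crossing hn (not_le.1 hlt)
    have h4 := hur a
    rw [max_eq_left (by omega)] at h4
    rcases ha.eq_or_lt with rfl | ha
    · omega
    have h5 : ∃ a' < q, r' a = r a' ∧ a' < r a' := by
      by_cases e : At i a
      · rw [r1 a e] at h4
        omega
      by_cases e' : At i (a - 1)
      · have := r2 _ e'
        rw [sub_add_cancel] at this
        exact ⟨a - 1, by omega, this, (same _ e').1⟩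
      · exact ⟨a, ha, r3 a e e', by rw [← r3 a e e', ← h4]; omega⟩
    obtain ⟨a', h6, h7, h8⟩ := h5
    have := hinc _ _ h6 h8 h3
    omega
  refine ⟨i :: u, ⟨hu, hi'⟩, fun a => ?_⟩
  by_cases e : At i a
  · have h1 := hur (a + 1)
    have h3 := (same a e).1
    have h4 := (hi' a e).2
    rw [r2 a e] at h1
    simp only [strand, swp_of_at e]
    omega
  by_cases e' : At i (a - 1)
  · have h1 := hur (a - 1)
    rw [r1 _ e'] at h1
    have h2 := swp_of_at' hn e'
    have h3 := (same _ e').2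
    rw [sub_add_cancel] at h2 h3
    simp only [strand, h2]
    omega
  · have h1 := hur a
    rw [r3 a e e'] at h1
    rw [strand, swp_of_not e e', h1]

/-! ### Couples of sequences -/

/-- The couple of sequences `(a)`, `(g a)` formed by the numbers `a` in `{1, …, n}` with
`a < g a`. -/
def rightPairs (n : ℕ) (g : ℤ → ℤ) : List ℤ × List ℤ :=
  let right := (List.finRange n).filter fun i => decide ((i.val : ℤ) + 1 < g (i.val + 1))
  (right.map fun i => (i.val : ℤ) + 1, right.map fun i => g (i.val + 1))

theorem IsWebWord.isIIC {n : ℕ} (hn : 3 ≤ n) {w : List (Fin n)} (hw : IsWebWord w) :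
    IsIIC n (rightPairs n (strand w)) := by
  have hsort : ((List.finRange n).filter fun i =>
      decide ((i.val : ℤ) + 1 < strand w (i.val + 1))).Pairwise (· < ·) :=
    (List.pairwise_lt_finRange n).filter _
  refine ⟨?_, ?_, ?_, ?_, ?_, ?_⟩
  · simp only [rightPairs, List.length_map]
    have h := List.length_filter_le (fun i : Fin n =>
      decide ((i.val : ℤ) + 1 < strand w (i.val + 1))) (List.finRange n)
    rw [List.length_finRange] at h
    refine lt_of_le_of_ne h fun e => ?_
    have h1 := (List.filter_eq_self).1 ((List.filter_sublist).eq_of_length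
      (e.trans (List.length_finRange (n := n)).symm))
    obtain ⟨i, hi⟩ := hw.exists_le hn
    have := h1 i (List.mem_finRange i)
    simp only [decide_eq_true_eq] at this
    omega
  · simp only [rightPairs, List.forall₂_map_left_iff, List.forall₂_map_right_iff]
    rw [List.forall₂_same]
    intro i hi
    simpa using hi
  · simp only [rightPairs, List.pairwise_map]
    exact hsort.imp fun h => by
      have : _ < _ := Fin.lt_def.1 h
      omega
  · simp only [rightPairs, List.mem_map]
    rintro _ ⟨i, -, rfl⟩
    have := i.isLt
    omega
  · simp only [rightPairs, List.pairwise_map]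
    refine hsort.imp_of_mem fun {i j} hi hj h => ?_
    simp only [List.mem_filter, decide_eq_true_eq] at hi hj
    have : _ < _ := Fin.lt_def.1 h
    exact hw.strand_lt hn (by omega) hi.2.le hj.2.le
  · simp only [rightPairs, List.mem_map]
    rintro _ ⟨i, hi, rfl⟩ _ ⟨j, hj, rfl⟩
    simp only [List.mem_filter, decide_eq_true_eq] at hi hj
    rw [← strand_add_n]
    have := j.isLt
    refine hw.strand_lt hn (by omega) hj.2.le ?_
    rw [strand_add_n]
    omega

/-- A periodic function is determined by its right pairs, up to its values that do not exceed the
argument. -/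
theorem max_eq_of_rightPairs_eq {n : ℕ} (hn : 3 ≤ n) {g g' : ℤ → ℤ}
    (hg : ∀ p, g (p + n) = g p + n) (hg' : ∀ p, g' (p + n) = g' p + n)
    (h : rightPairs n g = rightPairs n g') (a : ℤ) : max (g a) a = max (g' a) a := by
  obtain ⟨i, m, rfl⟩ := exists_at hn a
  rw [add_mul_n hg, add_mul_n hg', max_add_add_right, max_add_add_right]
  congr 1
  simp only [rightPairs, Prod.mk.injEq] at h
  have inj : Function.Injective fun i : Fin n => (i.val : ℤ) + 1 := fun i j h => by
    simpa [Fin.ext_iff] using h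
  have h1 := List.map_injective_iff.2 inj h.1
  have h2 := h.2
  rw [← h1, List.map_inj_left] at h2
  have h3 := congrArg (fun l => i ∈ l) h1
  simp only [List.mem_filter, List.mem_finRange, true_and, decide_eq_true_eq] at h3
  by_cases hi : (i.val : ℤ) + 1 < g (i.val + 1)
  · rw [h2 i (by simpa using hi)]
  · have hi' : ¬ (i.val : ℤ) + 1 < g' (i.val + 1) := by rwa [← h3]
    rw [max_eq_right (not_lt.1 hi), max_eq_right (not_lt.1 hi')]

/-- Every couple in `IIC n` is the couple of the strands of a web that go to the right. -/
theorem IsIIC.exists_webWord {n : ℕ} (hn : 3 ≤ n) {c : List ℤ × List ℤ} (hc : IsIIC n c) :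
    ∃ w : List (Fin n), IsWebWord w ∧ rightPairs n (strand w) = c := by
  obtain ⟨as, bs⟩ := c
  obtain ⟨hlt, hab, has, hmem, hbs, hclose⟩ := hc
  simp only at hlt hab has hmem hbs hclose
  have hlen := hab.length_eq
  have hnd : as.Nodup := has.imp fun h => h.ne
  -- the function given by the couple, extended by fixed points: a number that does not occur in
  -- the first sequence has the index `as.length`, so the default value is taken
  set β : ℤ → ℤ := fun a => bs.getD (as.idxOf a) a with hβ
  have β1 : ∀ t (ht : t < as.length), β as[t] = bs[t]'(hlen ▸ ht) := by
    intro t ht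
    simp only [hβ]
    rw [hnd.idxOf_getElem, List.getD_eq_getElem]
  have β2 : ∀ a, a ∉ as → β a = a := by
    intro a ha
    simp only [hβ]
    rw [List.idxOf_eq_length ha, hlen, List.getD_eq_default _ _ le_rfl]
  have β3 : ∀ t (ht : t < as.length), as[t] < β as[t] := by
    intro t ht
    rw [β1 t ht]
    exact (List.forall₂_iff_get.1 hab).2 t ht (hlen ▸ ht)
  have β4 : ∀ a, a ≤ β a := by
    intro a
    by_cases ha : a ∈ as
    · obtain ⟨t, ht, rfl⟩ := List.getElem_of_mem ha
      exact (β3 t ht).le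
    · exact (β2 a ha).ge
  have β5 : ∀ a, a < β a → ∃ t, ∃ ht : t < as.length, a = as[t] := by
    intro a ha
    by_cases h : a ∈ as
    · obtain ⟨t, ht, rfl⟩ := List.getElem_of_mem h
      exact ⟨t, ht, rfl⟩
    · rw [β2 a h] at ha
      omega
  -- its periodic extension from `{1, …, n}`
  set r : ℤ → ℤ := fun p => β ((p - 1) % n + 1) + (p - 1) / n * n with hr
  have r1 : ∀ (i : Fin n) (m : ℤ), r (i.val + 1 + m * n) = β (i.val + 1) + m * n := by
    intro i m
    have hi : (i.val : ℤ) < n := by exact_mod_cast i.isLt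
    simp only [hr]
    rw [show (i.val : ℤ) + 1 + m * n - 1 = i.val + m * n by ring, Int.add_mul_emod_self_right,
      Int.emod_eq_of_lt (by omega) hi, Int.add_mul_ediv_right _ _ (by omega),
      Int.ediv_eq_zero_of_lt (by omega) hi, zero_add]
  have r0 : ∀ i : Fin n, r (i.val + 1) = β (i.val + 1) := by
    intro i
    simpa using r1 i 0
  obtain ⟨w, hw, hwr⟩ := exists_webWord_of_periodic hn r (by
      intro p
      obtain ⟨i, m, rfl⟩ := exists_at hn p
      rw [show (i.val : ℤ) + 1 + m * n + n = i.val + 1 + (m + 1) * n by ring, r1, r1]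
      ring) (by
      intro p
      obtain ⟨i, m, rfl⟩ := exists_at hn p
      rw [r1]
      linarith [β4 (i.val + 1)]) (by
      intro a b hlt ha hb
      obtain ⟨i, m, rfl⟩ := exists_at hn a
      obtain ⟨j, k, rfl⟩ := exists_at hn b
      rw [r1] at ha hb ⊢
      rw [r1]
      obtain ⟨t, ht, et⟩ := β5 _ (by linarith : (i.val : ℤ) + 1 < β (i.val + 1))
      obtain ⟨u, hu, eu⟩ := β5 _ (by linarith : (j.val : ℤ) + 1 < β (j.val + 1))
      have hi := i.isLt
      have hj := j.isLt
      rw [et, eu, β1 t ht, β1 u hu]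
      rcases lt_trichotomy m k with hmk | rfl | hmk
      · have := hclose _ (List.getElem_mem (hlen ▸ hu)) _ (List.getElem_mem (hlen ▸ ht))
        have : (m + 1) * (n : ℤ) ≤ k * n := by
          apply mul_le_mul_of_nonneg_right <;> omega
        linarith
      · have htu : t < u := by
          by_contra hut
          have : as[u] ≤ as[t] := by
            rcases (not_lt.1 hut).eq_or_lt with h | h
            · subst h; rfl
            · exact (List.pairwise_iff_getElem.1 has _ _ _ _ h).le
          omega
        have := List.pairwise_iff_getElem.1 hbs t u (hlen ▸ ht) (hlen ▸ hu) htu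
        linarith
      · exfalso
        have : (k + 1) * (n : ℤ) ≤ m * n := by
          apply mul_le_mul_of_nonneg_right <;> omega
        linarith) (by
      by_contra hcon
      push Not at hcon
      have h1 : ∀ i : Fin n, (i.val : ℤ) + 1 ∈ as := by
        intro i
        by_contra h
        exact hcon (i.val + 1) (by rw [r0, β2 _ h])
      have h2 : ((List.finRange n).map fun i : Fin n => (i.val : ℤ) + 1).Nodup :=
        (List.nodup_finRange n).map fun i j h => by simpa [Fin.ext_iff] using h
      have h3 : ((List.finRange n).map fun i : Fin n => (i.val : ℤ) + 1) ⊆ as := by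
        intro a ha
        obtain ⟨i, -, rfl⟩ := List.mem_map.1 ha
        exact h1 i
      have := (h2.subperm h3).length_le
      rw [List.length_map, List.length_finRange] at this
      omega)
  refine ⟨w, hw, ?_⟩
  have g1 : ∀ i : Fin n, max (strand w (i.val + 1)) (i.val + 1) = β (i.val + 1) := fun i => by
    rw [hwr, r0]
  have e1 : (rightPairs n (strand w)).1 = as := by
    refine List.Perm.eq_of_pairwise (le := (· < ·)) (fun a b _ _ h h' => (lt_asymm h h').elim)
      (hw.isIIC hn).a_increasing has ?_
    rw [List.perm_ext_iff_of_nodup ((hw.isIIC hn).a_increasing.imp fun h => h.ne) hnd]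
    intro a
    simp only [rightPairs, List.mem_map, List.mem_filter, List.mem_finRange, true_and,
      decide_eq_true_eq]
    constructor
    · rintro ⟨i, hi, rfl⟩
      have := g1 i
      rw [max_eq_left hi.le] at this
      rw [this] at hi
      obtain ⟨t, ht, e⟩ := β5 _ hi
      rw [e]
      exact List.getElem_mem ht
    · intro ha
      have h1 := hmem a ha
      have e : ((a - 1).toNat : ℤ) + 1 = a := by omega
      refine ⟨⟨(a - 1).toNat, by omega⟩, ?_, e⟩
      have h2 := g1 ⟨(a - 1).toNat, by omega⟩
      simp only [e] at h2 ⊢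
      obtain ⟨t, ht, rfl⟩ := List.getElem_of_mem ha
      have := β3 t ht
      omega
  refine Prod.ext e1 ?_
  have e2 : (rightPairs n (strand w)).2 = (rightPairs n (strand w)).1.map β := by
    simp only [rightPairs, List.map_map]
    refine List.map_congr_left fun i hi => ?_
    simp only [List.mem_filter, List.mem_finRange, true_and, decide_eq_true_eq] at hi
    have := g1 i
    rw [max_eq_left hi.le] at this
    exact this
  rw [e2, e1]
  refine List.ext_getElem (by simpa using hlen) fun t h1 h2 => ?_
  rw [List.getElem_map]
  exact β1 t _

/-! ### The action on sequences -/

theorem sigma_comp_self {n : ℕ} (hn : 3 ≤ n) (i : Fin n) (y : Fin n → ℕ) :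
    sigma i (sigma i y) = sigma i y := by
  have := nxt_ne hn i
  unfold sigma
  simp [Function.update_of_ne this.symm]

theorem nxt_injective {n : ℕ} : Function.Injective (nxt (n := n)) := fun i j h => by
  have h1 := at_nxt.2 (at_self i)
  rw [h] at h1
  exact (at_self i).eq (at_nxt.1 h1)

theorem nxt_nxt_ne {n : ℕ} (hn : 3 ≤ n) (i : Fin n) : nxt (nxt i) ≠ i := fun h => by
  have h1 := at_nxt.2 (at_nxt.2 (at_self i))
  rw [h, add_assoc] at h1
  exact (at_self i).not_add_two hn h1

/-- The values of the action are encoded by the leftmost descending paths: the path from the place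
`q` ends at `r - n h` if the entry at this place is `r + n h`, where `r` is a residue in
`{1, …, n}`. -/
def Encodes {n : ℕ} (y : Fin n → ℕ) (f : ℤ → ℤ) : Prop :=
  ∀ q : Fin n, ∃ r h : ℤ, 1 ≤ r ∧ r ≤ n ∧ 0 ≤ h ∧ f (q.val + 1) = r - n * h ∧ (y q : ℤ) = r + n * h

/-- The result of the action of a word on `(1, …, n)` records the leftmost descending paths: a
letter acts on sequences in the same way as it prolongs the paths at their upper ends. -/
theorem encodes_foldl {n : ℕ} (w : List (Fin n)) :
    Encodes (w.foldl (fun y i => sigma i y) (start n)) (reach w) := by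
  induction w using List.reverseRecOn with
  | nil =>
    intro q
    have := q.isLt
    exact ⟨q.val + 1, 0, by omega, by omega, le_rfl, by simp [reach], by simp [start]⟩
  | append_singleton w i ih =>
    intro q
    rw [List.foldl_append, List.foldl_cons, List.foldl_nil, reach_append]
    set y := w.foldl (fun y i => sigma i y) (start n)
    simp only [reach]
    by_cases hq : q = nxt i
    · subst hq
      have h1 : At i ((nxt i).val + 1 - 1) := by
        rw [← at_nxt, sub_add_cancel]
        exact at_self _
      obtain ⟨r, h, hr, hr', hh, e1, e2⟩ := ih i
      simp only [prj, if_pos h1, sigma, Function.update_self]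
      have hi := i.isLt
      by_cases hin : i.val + 1 = n
      · refine ⟨r, h + 1, hr, hr', by omega, ?_, ?_⟩
        · have h2 := reach_add_n w 0
          have e3 : (0 : ℤ) + n = i.val + 1 := by omega
          rw [e3, e1] at h2
          simp only [nxt, hin, Nat.mod_self, Nat.cast_zero, zero_add, sub_self]
          linarith
        · rw [if_pos hin]
          push_cast
          linarith
      · refine ⟨r, h, hr, hr', hh, ?_, ?_⟩
        · have e3 : (nxt i).val = i.val + 1 := Nat.mod_eq_of_lt (by omega)
          rw [e3, ← e1]
          push_cast
          ring_nf
        · rw [if_neg hin]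
          exact e2
    · have h1 : ¬ At i (q.val + 1 - 1) := by
        rw [← at_nxt, sub_add_cancel]
        exact fun h => hq ((at_self q).eq h)
      simp only [prj, if_neg h1, sigma, Function.update_of_ne hq]
      exact ih q

theorem residue_unique {n : ℕ} {r a h m : ℤ} (hr : 1 ≤ r) (hr' : r ≤ n) (ha : 1 ≤ a) (ha' : a ≤ n)
    (e : r - n * h = a - n * m) : r = a ∧ h = m := by
  have hd : (n : ℤ) ∣ r - a := ⟨h - m, by linarith⟩
  have h0 : r - a = 0 := Int.eq_zero_of_abs_lt_dvd hd (by rw [abs_lt]; omega)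
  have h1 : r = a := by omega
  refine ⟨h1, ?_⟩
  have h2 : (n : ℤ) * h = n * m := by linarith
  exact mul_left_cancel₀ (by omega) h2

theorem Encodes.of_modEq {n : ℕ} {y : Fin n → ℕ} {f : ℤ → ℤ} (hy : Encodes y f)
    (hper : ∀ p, f (p + n) = f p + n) {a : ℕ} (ha : 1 ≤ a) (ha' : a ≤ n) {j : Fin n}
    (hj : y j ≡ a [MOD n]) :
    ∃ h : ℤ, 0 ≤ h ∧ (y j : ℤ) = a + n * h ∧ f (j.val + 1 + h * n) = a := by
  obtain ⟨r, h, hr, hr', hh, e1, e2⟩ := hy j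
  obtain ⟨k, hk⟩ := (Int.natCast_modEq_iff.2 hj).dvd
  obtain ⟨rfl, -⟩ := residue_unique (n := n) (a := a) (h := -h) (m := k) hr hr'
    (by omega) (by omega) (by linarith)
  exact ⟨h, hh, e2, by rw [add_mul_n hper, e1]; ring⟩

theorem Encodes.of_eq {n : ℕ} (hn : 3 ≤ n) {y : Fin n → ℕ} {f : ℤ → ℤ} (hy : Encodes y f)
    (hper : ∀ p, f (p + n) = f p + n) {a : ℕ} (ha : 1 ≤ a) (ha' : a ≤ n) {b : ℤ} (hb : f b = a) :
    ∃ (j : Fin n) (h : ℤ), b = j.val + 1 + h * n ∧ 0 ≤ h ∧ (y j : ℤ) = a + n * h := by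
  obtain ⟨j, m, rfl⟩ := exists_at hn b
  rw [add_mul_n hper] at hb
  obtain ⟨r, h, hr, hr', hh, e1, e2⟩ := hy j
  obtain ⟨rfl, rfl⟩ := residue_unique (n := n) (a := a) (h := h) (m := m) hr hr'
    (by omega) (by omega) (by linarith)
  exact ⟨j, h, rfl, hh, e2⟩

theorem modEq_of_eq {n y a : ℕ} {h : ℤ} (e : (y : ℤ) = a + n * h) : y ≡ a [MOD n] := by
  rw [← Int.natCast_modEq_iff, Int.modEq_iff_dvd]
  exact ⟨-h, by rw [e]; ring⟩

theorem Encodes.exists_modEq_iff {n : ℕ} (hn : 3 ≤ n) {y : Fin n → ℕ} {f : ℤ → ℤ}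
    (hy : Encodes y f) (hper : ∀ p, f (p + n) = f p + n) {a : ℕ} (ha : 1 ≤ a) (ha' : a ≤ n) :
    (∃ j, y j ≡ a [MOD n]) ↔ ∃ b, f b = a := by
  constructor
  · rintro ⟨j, hj⟩
    obtain ⟨h, -, -, e⟩ := hy.of_modEq hper ha ha' hj
    exact ⟨_, e⟩
  · rintro ⟨b, hb⟩
    obtain ⟨j, h, -, -, e⟩ := hy.of_eq hn hper ha ha' hb
    exact ⟨j, modEq_of_eq e⟩

/-- The number `bValue y a` read off from a sequence is the largest position from which the
leftmost descending path ends at `a`. -/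
theorem Encodes.bValue_eq {n : ℕ} (hn : 3 ≤ n) {y : Fin n → ℕ} {f : ℤ → ℤ} (hy : Encodes y f)
    (hper : ∀ p, f (p + n) = f p + n) (hmono : Monotone f) {a : ℕ} (ha : 1 ≤ a) (ha' : a ≤ n)
    {b : ℤ} (hb : f b = a) (hb' : a < f (b + 1)) : bValue y a = b := by
  obtain ⟨s, h, rfl, hh, hs⟩ := hy.of_eq hn hper ha ha' hb
  have hsn := s.isLt
  -- the other places with an entry congruent to `a`
  have bound : ∀ j, y j ≡ a [MOD n] →
      ∃ k : ℤ, (y j : ℤ) = a + n * k ∧ (k < h ∨ k = h ∧ j.val ≤ s.val) := by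
    intro j hj
    obtain ⟨k, hk, e, e'⟩ := hy.of_modEq hper ha ha' hj
    refine ⟨k, e, ?_⟩
    have h1 : (j.val : ℤ) + 1 + k * n ≤ s.val + 1 + h * n := by
      by_contra hlt
      have := hmono (show s.val + 1 + h * n + 1 ≤ (j.val : ℤ) + 1 + k * n by omega)
      omega
    rcases lt_trichotomy k h with hk | rfl | hk
    · exact Or.inl hk
    · exact Or.inr ⟨rfl, by omega⟩
    · exfalso
      have : (h + 1) * (n : ℤ) ≤ k * n := by
        apply mul_le_mul_of_nonneg_right <;> omega
      linarith
  have hmax : maxEntry y a = y s := by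
    refine le_antisymm (Finset.sup_le fun j hj => ?_)
      (Finset.le_sup (f := y) (by simpa using modEq_of_eq hs))
    obtain ⟨k, e, hk⟩ := bound j (by simpa using hj)
    have : (n : ℤ) * k ≤ n * h := by
      apply mul_le_mul_of_nonneg_left <;> omega
    omega
  have hplace : maxPlace y a = s.val + 1 := by
    refine le_antisymm (Finset.sup_le fun j hj => ?_)
      (Finset.le_sup (f := fun j : Fin n => j.val + 1) (by simp [hmax]))
    have hj : y j = y s := by simpa [hmax] using hj
    obtain ⟨k, e, hk⟩ := bound j (by rw [hj]; exact modEq_of_eq hs)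
    have h1 : (n : ℤ) * k = n * h := by
      have : (y j : ℤ) = y s := by exact_mod_cast hj
      linarith
    have h2 := mul_left_cancel₀ (by omega) h1
    omega
  rw [bValue, hplace, hmax, hs]
  push_cast
  ring

/-- The couple read off from the action of a web word consists of the strands of the web that go to
the right. -/
theorem IsWebWord.normalForm_eq {n : ℕ} (hn : 3 ≤ n) {w : List (Fin n)} (hw : IsWebWord w) :
    normalForm w = rightPairs n (strand w) := by
  have hy := encodes_foldl w
  rw [normalForm]
  set y := w.foldl (fun y i => sigma i y) (start n)
  have key : ∀ i : Fin n, ((∃ j, y j ≡ i.val + 1 [MOD n]) ∧ bValue y (i.val + 1) ≠ (i.val + 1 : ℕ)) ↔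
      (i.val : ℤ) + 1 < strand w (i.val + 1) := by
    intro i
    have hi : i.val + 1 ≤ n := i.isLt
    rw [hy.exists_modEq_iff hn (reach_add_n w) (by omega) hi]
    constructor
    · rintro ⟨⟨b, hb⟩, hne⟩
      by_contra hlt
      rcases (not_lt.1 hlt).eq_or_lt with h | h
      · obtain ⟨h1, h2⟩ := hw.reach_strand hn h.ge
        refine hne ?_
        rw [hy.bValue_eq hn (reach_add_n w) (reach_mono w) (by omega) hi (b := i.val + 1)]
        · push_cast; rfl
        · rw [h] at h1
          rw [h1]; push_cast; rfl
        · rw [h] at h2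
          push_cast; exact h2
      · exact hw.reach_ne h b (by rw [hb]; push_cast; rfl)
    · intro h
      obtain ⟨h1, h2⟩ := hw.reach_strand hn h.le
      refine ⟨⟨_, by rw [h1]; push_cast; rfl⟩, ?_⟩
      rw [hy.bValue_eq hn (reach_add_n w) (reach_mono w) (by omega) hi (by rw [h1]; push_cast; rfl)
        (by push_cast; exact h2)]
      push_cast
      exact h.ne'
  have key' : ∀ i : Fin n, (i.val : ℤ) + 1 < strand w (i.val + 1) →
      bValue y (i.val + 1) = strand w (i.val + 1) := by
    intro i h
    have hi : i.val + 1 ≤ n := i.isLt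
    obtain ⟨h1, h2⟩ := hw.reach_strand hn h.le
    exact hy.bValue_eq hn (reach_add_n w) (reach_mono w) (by omega) hi (by rw [h1]; push_cast; rfl)
        (by push_cast; exact h2)
  have hrange : (List.range n).map (· + 1) = (List.finRange n).map fun i => i.val + 1 := by
    rw [← List.map_coe_finRange_eq_range, List.map_map]
    rfl
  simp only [coupleOf, rightPairs, hrange, List.filter_map, List.map_map]
  have hf : ((fun a => decide ((∃ j, y j ≡ a [MOD n]) ∧ bValue y a ≠ a)) ∘
      fun i : Fin n => i.val + 1) = fun i : Fin n =>
        decide ((i.val : ℤ) + 1 < strand w (i.val + 1)) := by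
    funext i
    simp only [Function.comp_apply, decide_eq_decide]
    exact key i
  rw [hf]
  refine Prod.ext (by simp [← List.map_eq_flatMap, Function.comp_def]) (List.map_congr_left fun i hi => ?_)
  simp only [List.mem_filter, List.mem_finRange, true_and, decide_eq_true_eq] at hi
  exact key' i hi

theorem sigma_comm {n : ℕ} {i j : Fin n} (h : Far i j) (y : Fin n → ℕ) :
    sigma j (sigma i y) = sigma i (sigma j y) := by
  have h1 : nxt j ≠ i := fun e => (h _ (at_self i)).2.2 (by
    rw [← at_nxt, sub_add_cancel, e]
    exact at_self i)
  have h2 : nxt i ≠ j := fun e => (h _ (at_self i)).2.1 (e ▸ at_nxt.2 (at_self i))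
  have h3 : nxt i ≠ nxt j := fun e => (h _ (at_self i)).1 (nxt_injective e ▸ at_self i)
  unfold sigma
  rw [Function.update_of_ne h2.symm, Function.update_of_ne h1.symm, Function.update_comm h3]

theorem far_of_lt {n : ℕ} {i j : Fin n} (h₁ : j.val + 1 < i.val) (h₂ : i.val + 1 < j.val + n) :
    Far i j := by
  have key : ∀ k : ℤ, (n : ℤ) ∣ k → 0 < k → n ≤ k := fun k hk h0 => Int.le_of_dvd h0 hk
  refine far_of_at (at_self i) (fun h => ?_) (fun h => ?_) fun h => ?_ <;>
    · have := key _ h (by omega)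
      omega

theorem sigma_kiselman {n : ℕ} (hn : 3 ≤ n) (i : Fin n) (y : Fin n → ℕ) :
    sigma (nxt i) (sigma i (sigma (nxt i) y)) = sigma (nxt i) (sigma i y) := by
  have h2 := nxt_ne hn (nxt i)
  have h3 := nxt_nxt_ne hn i
  funext q
  by_cases e : q = nxt (nxt i)
  · subst e
    simp [sigma, h3.symm]
  by_cases e' : q = nxt i
  · subst e'
    simp [sigma, h2.symm, h3.symm]
  · simp [sigma, e, e']

theorem sigma_braid {n : ℕ} (hn : 3 ≤ n) (i : Fin n) (y : Fin n → ℕ) :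
    sigma i (sigma (nxt i) (sigma i y)) = sigma (nxt i) (sigma i y) := by
  have h1 := nxt_ne hn i
  have h2 := nxt_ne hn (nxt i)
  have h3 := nxt_nxt_ne hn i
  funext q
  by_cases e : q = nxt i
  · subst e
    simp [sigma, h1.symm, h2.symm, h3.symm]
  · simp [sigma, e]

/-- The right action of the monoid on sequences. -/
def actionHom {n : ℕ} (hn : 3 ≤ n) : CMonoid n →* (Function.End (Fin n → ℕ))ᵐᵒᵖ :=
  PresentedMonoid.lift (M := (Function.End (Fin n → ℕ))ᵐᵒᵖ) (rels := Rel n)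
    (fun i => MulOpposite.op (sigma i)) (by
    intro a b h
    cases h with
    | idem i =>
      simp only [map_mul, FreeMonoid.lift_eval_of]
      exact congrArg MulOpposite.op (funext fun y => sigma_comp_self hn i y)
    | far i j h₁ h₂ =>
      simp only [map_mul, FreeMonoid.lift_eval_of]
      exact congrArg MulOpposite.op (funext fun y => sigma_comm (far_of_lt h₁ h₂) y)
    | braid i =>
      simp only [map_mul, FreeMonoid.lift_eval_of]
      exact congrArg MulOpposite.op (funext fun y =>
        (sigma_braid hn i y).trans (sigma_kiselman hn i y).symm)
    | kiselman i =>
      simp only [map_mul, FreeMonoid.lift_eval_of]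
      exact congrArg MulOpposite.op (funext fun y => sigma_kiselman hn i y))

theorem actionHom_gen {n : ℕ} (hn : 3 ≤ n) (i : Fin n) :
    actionHom hn (gen i) = MulOpposite.op (sigma i) := rfl

theorem actionHom_ofWord {n : ℕ} (hn : 3 ≤ n) (w : List (Fin n)) (y : Fin n → ℕ) :
    (actionHom hn (ofWord w)).unop y = w.foldl (fun y i => sigma i y) y := by
  induction w generalizing y with
  | nil => rfl
  | cons i w ih =>
    rw [ofWord_cons, map_mul, actionHom_gen, List.foldl_cons, ← ih]
    rfl

theorem coupleOf_actionHom {n : ℕ} (hn : 3 ≤ n) (w : List (Fin n)) :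
    coupleOf ((actionHom hn (ofWord w)).unop (start n)) = normalForm w := by
  rw [actionHom_ofWord, normalForm]

/-- The normal form is an invariant of the element, since it is read off from the action. -/
theorem normalForm_eq_of_ofWord_eq {n : ℕ} (hn : 3 ≤ n) {u v : List (Fin n)}
    (h : ofWord u = ofWord v) : normalForm u = normalForm v := by
  rw [← coupleOf_actionHom hn, h, coupleOf_actionHom]

/-- The normal form only depends on the leftmost descending paths. -/
theorem normalForm_eq_of_reach_eq {n : ℕ} {u v : List (Fin n)}
    (h : ∀ p, reach u p = reach v p) : normalForm u = normalForm v := by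
  have : ∀ q, u.foldl (fun y i => sigma i y) (start n) q =
      v.foldl (fun y i => sigma i y) (start n) q := by
    intro q
    have hq := q.isLt
    obtain ⟨r, k, hr, hr', -, e1, e2⟩ := encodes_foldl u q
    obtain ⟨s, l, hs, hs', -, e3, e4⟩ := encodes_foldl v q
    obtain ⟨rfl, rfl⟩ := residue_unique hr hr' hs hs' (by rw [← e1, ← e3, h])
    exact_mod_cast e2.trans e4.symm
  rw [normalForm, normalForm, funext this]

/-- Web words with the same normal form are equal up to commutations. -/
theorem IsWebWord.commEq_of_normalForm_eq {n : ℕ} (hn : 3 ≤ n) {u v : List (Fin n)}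
    (hu : IsWebWord u) (hv : IsWebWord v) (h : normalForm u = normalForm v) : CommEq u v := by
  rw [hu.normalForm_eq hn, hv.normalForm_eq hn] at h
  exact hu.commEq hn hv (max_eq_of_rightPairs_eq hn (strand_add_n u) (strand_add_n v) h)

/-- Words with the same normal form represent the same element, because they can be reduced to web
words with this normal form. -/
theorem ofWord_eq_of_normalForm_eq {n : ℕ} (hn : 3 ≤ n) {u v : List (Fin n)}
    (h : normalForm u = normalForm v) : ofWord u = ofWord v := by
  obtain ⟨u', hu, -, eu⟩ := exists_webWord hn u
  obtain ⟨v', hv, -, ev⟩ := exists_webWord hn v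
  rw [eu, ev]
  refine (hu.commEq_of_normalForm_eq hn hv ?_).ofWord_eq
  rw [← normalForm_eq_of_ofWord_eq hn eu, h, normalForm_eq_of_ofWord_eq hn ev]

/-! ### Lifts of strands and isotopies -/

theorem ExtDiagram.lift_zero {n : ℕ} (D : ExtDiagram n) (i : Fin n) : D.lift i 0 = i.val + 1 :=
  (AddCircle.isCoveringMap_coe (n : ℝ)).liftPath_zero _ _ _

theorem ExtDiagram.coe_lift {n : ℕ} (D : ExtDiagram n) (i : Fin n) (t : I) :
    (D.lift i t : AddCircle (n : ℝ)) = (D.toFun (i, t)).1 :=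
  congrFun ((AddCircle.isCoveringMap_coe (n : ℝ)).liftPath_lifts _ _ _) t

theorem ExtDiagram.lift_eq {n : ℕ} (D : ExtDiagram n) (i : Fin n) {f : I → ℝ} (hf : Continuous f)
    (h₀ : f 0 = i.val + 1) (h : ∀ t, (f t : AddCircle (n : ℝ)) = (D.toFun (i, t)).1) (t : I) :
    D.lift i t = f t := by
  have : f = D.lift i :=
    ((AddCircle.isCoveringMap_coe (n : ℝ)).eq_liftPath_iff _).2 ⟨hf, funext h, h₀⟩
  rw [this]

/-- The point with parameter `t` on a lifted strand. -/
noncomputable def ExtDiagram.pos {n : ℕ} (D : ExtDiagram n) (s : Fin n × ℤ) (t : I) : ℝ × I :=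
  (D.lift s.1 t + s.2 * n, (D.toFun (s.1, t)).2)

theorem ExtDiagram.continuous_pos {n : ℕ} (D : ExtDiagram n) (s : Fin n × ℤ) :
    Continuous (D.pos s) := by
  have := D.continuous_toFun
  unfold ExtDiagram.pos
  fun_prop

theorem coe_add_mul {n : ℕ} (x : ℝ) (m : ℤ) :
    ((x + m * n : ℝ) : AddCircle (n : ℝ)) = x := coe_eq_coe_of m (by ring)

theorem ExtDiagram.coe_pos {n : ℕ} (D : ExtDiagram n) (s : Fin n × ℤ) (t : I) :
    (((D.pos s t).1 : AddCircle (n : ℝ)), (D.pos s t).2) = D.toFun (s.1, t) := by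
  simp only [ExtDiagram.pos, coe_add_mul, D.coe_lift]

theorem ExtDiagram.pos_strictMono {n : ℕ} (D : ExtDiagram n) (s : Fin n × ℤ) :
    StrictMono fun t => (D.pos s t).2 := D.height_strictMono s.1

theorem ExtDiagram.height_zero {n : ℕ} (D : ExtDiagram n) (i : Fin n) : (D.toFun (i, 0)).2 = 0 := by
  rw [D.lower]

theorem ExtDiagram.height_one {n : ℕ} (D : ExtDiagram n) (i : Fin n) : (D.toFun (i, 1)).2 = 1 := by
  rw [D.upper]

theorem endpoint_injective {n : ℕ} :
    Function.Injective fun i : Fin n => (((i.val : ℝ) + 1 : ℝ) : AddCircle (n : ℝ)) := by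
  intro i j h
  obtain ⟨m, hm⟩ := coe_eq_coe h
  exact fin_eq_of_sub i j m (by linarith)

/-- A family of endpoints that depends continuously on a parameter is constant. -/
theorem fin_family_const {n : ℕ} {T : I → Fin n}
    (h : Continuous fun s => ((((T s).val : ℝ) + 1 : ℝ) : AddCircle (n : ℝ))) (s : I) :
    T s = T 0 := by
  rcases Nat.eq_zero_or_pos n with rfl | hn
  · exact (T 0).elim0
  have : Fact (0 < (n : ℝ)) := ⟨by exact_mod_cast hn⟩
  have emb : Topology.IsClosedEmbedding
      fun i : Fin n => (((i.val : ℝ) + 1 : ℝ) : AddCircle (n : ℝ)) :=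
    continuous_of_discreteTopology.isClosedEmbedding endpoint_injective
  have hT : Continuous T := emb.isInducing.continuous_iff.2 h
  exact PreconnectedSpace.constant inferInstance hT

theorem iso_zero (φ : I ≃o I) : φ 0 = 0 := φ.map_bot

theorem iso_one (φ : I ≃o I) : φ 1 = 1 := φ.map_top

/-- An isotopy preserves, up to reparametrizations of the strands, the intersections of the lifted
strands, and it preserves the endpoints of the lifted strands. -/
theorem Isotopic.exists_pos_eq_iff {n : ℕ} {D D' : ExtDiagram n} (h : Isotopic D D') :
    ∃ r : Fin n → (I ≃o I), (∀ s t s' t', D'.pos s (r s.1 t) = D'.pos s' (r s'.1 t') ↔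
      D.pos s t = D.pos s' t') ∧ ∀ i, D'.lift i 1 = D.lift i 1 := by
  obtain ⟨H, r, hH, h0, h1, hd⟩ := h
  have cov := AddCircle.isCoveringMap_coe (n : ℝ)
  -- the lifts depend continuously on both parameters
  have hcont : ∀ i : Fin n, Continuous fun p : I × I => (H p.2).lift i p.1 := by
    intro i
    have c1 : Continuous fun p : I × I => ((H p.2).toFun (i, p.1)).1 :=
      (hH.comp (continuous_snd.prodMk (continuous_const.prodMk continuous_fst))).fst
    have c2 := (cov.liftHomotopy (A := I) ⟨_, c1⟩ (ContinuousMap.const _ ((i.val : ℝ) + 1))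
      (fun a => by simp [ExtDiagram.lower])).continuous
    exact c2
  -- During the isotopy, the difference of the lifts of a double point is a multiple of `n` that
  -- depends continuously on the time, hence is constant.
  have key : ∀ s t s' t' (θ : I), (H θ).pos s t = (H θ).pos s' t' → ∀ τ : I,
      (H τ).pos s t = (H τ).pos s' t' := by
    intro s t s' t' θ e τ
    have e1 : ∀ τ, (H τ).toFun (s.1, t) = (H τ).toFun (s'.1, t') := by
      intro τ
      rw [hd, ← hd θ, ← ExtDiagram.coe_pos, ← ExtDiagram.coe_pos, e]
    have c : Continuous fun τ : I => (H τ).lift s.1 t + s.2 * n - ((H τ).lift s'.1 t' + s'.2 * n) :=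
      ((((hcont s.1).comp (continuous_const.prodMk continuous_id)).add continuous_const)).sub
        (((hcont s'.1).comp (continuous_const.prodMk continuous_id)).add continuous_const)
    have e2 := cov.const_of_comp c (fun a b => by
      simp only [AddCircle.coe_sub, coe_add_mul, ExtDiagram.coe_lift, e1, sub_self]) τ θ
    have e3 := congrArg Prod.fst e
    simp only [ExtDiagram.pos] at e3
    rw [e3, sub_self, sub_eq_zero] at e2
    exact Prod.ext e2 (congrArg Prod.snd (e1 τ) :)
  have hr : ∀ s t, D'.pos s (r s.1 t) = (H 1).pos s t := by
    intro s t
    have e : D'.lift s.1 (r s.1 t) = (H 1).lift s.1 t :=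
      (D'.lift_eq s.1 (f := fun t => (H 1).lift s.1 ((r s.1).symm t))
      (((H 1).lift s.1).continuous.comp (r s.1).symm.continuous)
      (by rw [iso_zero]; exact (H 1).lift_zero s.1) (fun t => by
        rw [ExtDiagram.coe_lift, h1, OrderIso.apply_symm_apply]) (r s.1 t)).trans
      (congrArg _ (OrderIso.symm_apply_apply _ _))
    simp only [ExtDiagram.pos, e, h1]
  refine ⟨r, fun s t s' t' => ?_, fun i => ?_⟩
  · rw [hr, hr, ← h0]
    exact ⟨fun e => key _ _ _ _ _ e 0, fun e => key _ _ _ _ _ e 1⟩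
  · have htop : ∀ θ, (H θ).top i = (H 0).top i := fin_family_const (by
      have c1 : Continuous fun θ : I => ((H θ).toFun (i, 1)).1 :=
        (hH.comp (continuous_id.prodMk continuous_const)).fst
      simpa only [ExtDiagram.upper] using c1)
    have e := cov.const_of_comp ((hcont i).comp (continuous_const.prodMk continuous_id))
      (fun a b => by
        simp only [ExtDiagram.coe_lift, ExtDiagram.upper, htop])
      1 0 (g := fun θ => (H θ).lift i 1)
    have e1 := congrArg Prod.fst (hr (i, 0) 1)
    simp only [ExtDiagram.pos, Int.cast_zero, zero_mul, add_zero, iso_one] at e1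
    rw [e1, e, h0]

theorem Isotopic.upperEnd_eq {n : ℕ} {D D' : ExtDiagram n} (h : Isotopic D D') (i : Fin n) :
    D'.upperEnd i = D.upperEnd i := by
  obtain ⟨-, -, h⟩ := h.exists_pos_eq_iff
  rw [ExtDiagram.upperEnd, h, ExtDiagram.upperEnd]

theorem Isotopic.rightCouple_eq {n : ℕ} {D D' : ExtDiagram n} (h : Isotopic D D') :
    D'.rightCouple = D.rightCouple := by
  simp only [ExtDiagram.rightCouple, h.upperEnd_eq, funext h.upperEnd_eq]

theorem hasContractibleBigon_iff {n : ℕ} {D : ExtDiagram n} : D.HasContractibleBigon ↔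
    ∃ s s' : Fin n × ℤ, s ≠ s' ∧ ∃ t u t' u', t ≠ t' ∧ D.pos s t = D.pos s' u ∧
      D.pos s t' = D.pos s' u' := by
  constructor
  · rintro ⟨s, s', hne, x, ⟨⟨t, ht⟩, ⟨u, hu⟩⟩, y, ⟨⟨t', ht'⟩, ⟨u', hu'⟩⟩, hxy⟩
    refine ⟨s, s', hne, t, u, t', u', ?_, ht.trans hu.symm, ht'.trans hu'.symm⟩
    rintro rfl
    exact hxy (ht.symm.trans ht')
  · rintro ⟨s, s', hne, t, u, t', u', htt, e, e'⟩
    refine ⟨s, s', hne, D.pos s t, ⟨⟨t, rfl⟩, ⟨u, e.symm⟩⟩, D.pos s t', ⟨⟨t', rfl⟩, ⟨u', e'.symm⟩⟩, ?_⟩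
    exact fun e => htt ((D.pos_strictMono s).injective (congrArg Prod.snd e))

theorem liftedStrand_inter_nonempty_iff {n : ℕ} {D : ExtDiagram n} {s s' : Fin n × ℤ} :
    (D.liftedStrand s ∩ D.liftedStrand s').Nonempty ↔ ∃ t u, D.pos s t = D.pos s' u := by
  constructor
  · rintro ⟨x, ⟨t, ht⟩, ⟨u, hu⟩⟩
    exact ⟨t, u, ht.trans hu.symm⟩
  · rintro ⟨t, u, e⟩
    exact ⟨D.pos s t, ⟨t, rfl⟩, ⟨u, e.symm⟩⟩

/-- Diagrams without contractible bigons and triangles. -/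
def IsWeb {n : ℕ} (D : ExtDiagram n) : Prop :=
  ¬ D.HasContractibleBigon ∧ ¬ D.HasContractibleTriangle

theorem Isotopic.isWeb_iff {n : ℕ} {D D' : ExtDiagram n} (h : Isotopic D D') :
    IsWeb D' ↔ IsWeb D := by
  obtain ⟨r, h, -⟩ := h.exists_pos_eq_iff
  have hmeet : ∀ s s', (∃ t u, D'.pos s t = D'.pos s' u) ↔ ∃ t u, D.pos s t = D.pos s' u := by
    intro s s'
    constructor
    · rintro ⟨t, u, e⟩
      exact ⟨(r s.1).symm t, (r s'.1).symm u, by rw [← h]; simpa using e⟩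
    · rintro ⟨t, u, e⟩
      exact ⟨r s.1 t, r s'.1 u, by rwa [h]⟩
  refine and_congr (not_congr ?_) (not_congr ?_)
  · rw [hasContractibleBigon_iff, hasContractibleBigon_iff]
    refine exists_congr fun s => exists_congr fun s' => and_congr_right fun _ => ?_
    constructor
    · rintro ⟨t, u, t', u', htt, e, e'⟩
      exact ⟨(r s.1).symm t, (r s'.1).symm u, (r s.1).symm t', (r s'.1).symm u',
        fun e => htt ((r s.1).symm.injective e), by rw [← h]; simpa using e,
        by rw [← h]; simpa using e'⟩
    · rintro ⟨t, u, t', u', htt, e, e'⟩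
      exact ⟨r s.1 t, r s'.1 u, r s.1 t', r s'.1 u', fun e => htt ((r s.1).injective e),
        by rwa [h], by rwa [h]⟩
  · simp only [ExtDiagram.HasContractibleTriangle, liftedStrand_inter_nonempty_iff, hmeet]

/-! ### Construction of isotopies -/

/-- A family of maps with the same endpoints and the same double points as a diagram is an
isotopy. -/
theorem Isotopic.of_family {n : ℕ} {D D' : ExtDiagram n}
    (G : I → Fin n × I → AddCircle (n : ℝ) × I) (r : Fin n → (I ≃o I))
    (hG : Continuous fun p : I × (Fin n × I) => G p.1 p.2) (h₀ : ∀ x, G 0 x = D.toFun x)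
    (h₁ : ∀ i t, G 1 (i, t) = D'.toFun (i, r i t))
    (hmono : ∀ s i, StrictMono fun t => (G s (i, t)).2)
    (hlow : ∀ s i, G s (i, 0) = D.toFun (i, 0)) (hup : ∀ s i, G s (i, 1) = D.toFun (i, 1))
    (hd : ∀ s x y, G s x = G s y ↔ D.toFun x = D.toFun y) : Isotopic D D' := by
  refine ⟨fun s =>
    { toFun := G s
      continuous_toFun := hG.comp (continuous_const.prodMk continuous_id)
      height_strictMono := hmono s
      lower := fun i => (hlow s i).trans (D.lower i)
      top := D.top
      upper := fun i => (hup s i).trans (D.upper i)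
      finite_double := by simpa only [hd] using D.finite_double
      at_most_double := by simpa only [hd] using D.at_most_double
      double_interior := by simpa only [hd] using D.double_interior }, r, hG, ?_, h₁, hd⟩
  cases D
  simp only [ExtDiagram.mk.injEq, and_true]
  exact funext h₀

theorem Isotopic.refl {n : ℕ} (D : ExtDiagram n) : Isotopic D D :=
  ⟨fun _ => D, fun _ => OrderIso.refl I, D.continuous_toFun.comp continuous_snd, rfl,
    fun _ _ => rfl, fun _ _ _ => Iff.rfl⟩

/-- Convex combinations in the unit interval. -/
def mix (s a b : I) : I := ⟨(1 - s) * a + s * b, by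
  have := s.2.1; have := s.2.2; have := a.2.1; have := a.2.2; have := b.2.1; have := b.2.2
  constructor
  · have : 0 ≤ 1 - (s : ℝ) := by linarith
    positivity
  · nlinarith⟩

theorem continuous_mix : Continuous fun p : I × I × I => mix p.1 p.2.1 p.2.2 := by
  unfold mix
  fun_prop

@[simp] theorem mix_zero (a b : I) : mix 0 a b = a := Subtype.ext (by simp [mix])

@[simp] theorem mix_one (a b : I) : mix 1 a b = b := Subtype.ext (by simp [mix])

@[simp] theorem mix_self (s a : I) : mix s a a = a := Subtype.ext (by simp [mix]; ring)

theorem mix_lt_mix {s a b a' b' : I} (h : a < a') (h' : b < b') : mix s a b < mix s a' b' := by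
  rw [← Subtype.coe_lt_coe] at *
  simp only [mix]
  have := s.2.1
  rcases s.2.2.eq_or_lt with h1 | h1
  · rw [h1]; linarith
  · nlinarith

/-- Isotopies that only change the heights, in the same way for all the strands. -/
theorem Isotopic.of_vertical {n : ℕ} {D D' : ExtDiagram n} (φ : I ≃o I) (r : Fin n → (I ≃o I))
    (h : ∀ i t, D'.toFun (i, r i t) = ((D.toFun (i, t)).1, φ (D.toFun (i, t)).2)) :
    Isotopic D D' := by
  have hD := D.continuous_toFun
  have hφ := φ.continuous
  have hm : ∀ s, StrictMono fun a => mix s a (φ a) := fun s a b hab =>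
    mix_lt_mix hab (φ.strictMono hab)
  refine .of_family (fun s x => ((D.toFun x).1, mix s (D.toFun x).2 (φ (D.toFun x).2))) r ?_ ?_ ?_
    ?_ ?_ ?_ ?_
  · have c : Continuous fun p : I × (Fin n × I) =>
        (p.1, (D.toFun p.2).2, φ (D.toFun p.2).2) := by fun_prop
    exact Continuous.prodMk (by fun_prop) (continuous_mix.comp c)
  · intro x; simp
  · intro i t; rw [h]; simp
  · exact fun s i t u htu => hm s (D.height_strictMono i htu)
  · intro s i
    simp only [D.lower, iso_zero, mix_self]
  · intro s i
    simp only [D.upper, iso_one, mix_self]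
  · intro s x y
    rw [Prod.ext_iff, Prod.ext_iff]
    simp only [(hm s).injective.eq_iff]

/-- Order isomorphisms of the unit interval given by increasing functions. -/
noncomputable def intervalIso (f : ℝ → ℝ) (hf : StrictMono f) (hc : Continuous f) (h₀ : f 0 = 0) (h₁ : f 1 = 1) :
    I ≃o I :=
  StrictMono.orderIsoOfSurjective
    (fun t : I => (⟨f t, h₀ ▸ hf.monotone t.2.1, h₁ ▸ hf.monotone t.2.2⟩ : I))
    (fun _ _ h => hf h) (fun y => by
      obtain ⟨x, hx, e⟩ := intermediate_value_Icc zero_le_one hc.continuousOn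
        (show (y : ℝ) ∈ Set.Icc (f 0) (f 1) by rw [h₀, h₁]; exact y.2)
      exact ⟨⟨x, hx⟩, Subtype.ext e⟩)

theorem lowHalf_le (t : I) : (lowHalf t : ℝ) ≤ 1 / 2 := by
  have := t.2.2
  simp only [lowHalf]
  linarith

theorem le_highHalf (t : I) : 1 / 2 ≤ (highHalf t : ℝ) := by
  have := t.2.1
  simp only [highHalf]
  linarith

theorem dbl_lowHalf (t : I) : dbl (lowHalf t) = t :=
  Subtype.ext (by rw [dbl_coe (lowHalf_le t)]; simp only [lowHalf]; ring)

theorem dbl'_highHalf (t : I) : dbl' (highHalf t) = t :=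
  Subtype.ext (by rw [dbl'_coe (le_highHalf t)]; simp only [highHalf]; ring)

theorem lowHalf_dbl {t : I} (h : (t : ℝ) ≤ 1 / 2) : lowHalf (dbl t) = t :=
  Subtype.ext (by simp only [lowHalf]; rw [dbl_coe h]; ring)

theorem highHalf_dbl' {t : I} (h : 1 / 2 ≤ (t : ℝ)) : highHalf (dbl' t) = t :=
  Subtype.ext (by simp only [highHalf]; rw [dbl'_coe h]; ring)

theorem compFun_lowHalf {n : ℕ} (D E : ExtDiagram n) (i : Fin n) (t : I) :
    (D.comp E).toFun (i, lowHalf t) = ((D.toFun (i, t)).1, lowHalf (D.toFun (i, t)).2) := by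
  simp only [ExtDiagram.comp, compFun]
  rw [if_pos (lowHalf_le t), dbl_lowHalf]

theorem compFun_highHalf {n : ℕ} (D E : ExtDiagram n) (i : Fin n) (t : I) :
    (D.comp E).toFun (i, highHalf t) =
      ((E.toFun (D.top i, t)).1, highHalf (E.toFun (D.top i, t)).2) := by
  simp only [ExtDiagram.comp, compFun]
  split_ifs with h
  · have ht : t = 0 := by
      refine Subtype.ext ?_
      have := t.2.1
      simp only [highHalf] at h
      simp only [Set.Icc.coe_zero]
      linarith
    subst ht
    have e : dbl (highHalf 0) = 1 := Subtype.ext (by rw [dbl_coe h]; simp [highHalf])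
    rw [e, D.upper, E.lower]
    exact Prod.ext rfl (Subtype.ext (by simp [lowHalf, highHalf]))
  · rw [dbl'_highHalf]

/-- Every point of the unit interval lies in the lower or the upper half. -/
theorem eq_lowHalf_or_highHalf (t : I) : (∃ u, t = lowHalf u) ∨ ∃ u, t = highHalf u := by
  rcases le_total (t : ℝ) (1 / 2) with h | h
  · exact Or.inl ⟨_, (lowHalf_dbl h).symm⟩
  · exact Or.inr ⟨_, (highHalf_dbl' h).symm⟩

theorem lowHalf_lt_lowHalf {a b : I} : lowHalf a < lowHalf b ↔ a < b := by
  rw [← Subtype.coe_lt_coe, ← Subtype.coe_lt_coe]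
  simp only [lowHalf]
  constructor <;> intro h <;> linarith

theorem highHalf_lt_highHalf {a b : I} : highHalf a < highHalf b ↔ a < b := by
  rw [← Subtype.coe_lt_coe, ← Subtype.coe_lt_coe]
  simp only [highHalf]
  constructor <;> intro h <;> linarith

/-- The map that acts by `r` on the lower half of the unit interval and by `r'` on the upper
half. -/
noncomputable def halves (r r' : I → I) (t : I) : I :=
  if (t : ℝ) ≤ 1 / 2 then lowHalf (r (dbl t)) else highHalf (r' (dbl' t))

theorem halves_lowHalf (r r' : I → I) (t : I) : halves r r' (lowHalf t) = lowHalf (r t) := by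
  rw [halves, if_pos (lowHalf_le t), dbl_lowHalf]

theorem halves_highHalf (r r' : I ≃o I) (t : I) : halves r r' (highHalf t) = highHalf (r' t) := by
  rw [halves]
  split_ifs with h
  · have ht : t = 0 := by
      refine Subtype.ext ?_
      have := t.2.1
      simp only [highHalf] at h
      simp only [Set.Icc.coe_zero]
      linarith
    subst ht
    have e : dbl (highHalf 0) = 1 := Subtype.ext (by rw [dbl_coe h]; simp [highHalf])
    rw [e, iso_one, iso_zero]
    exact Subtype.ext (by simp [lowHalf, highHalf])
  · rw [dbl'_highHalf]

theorem halves_strictMono (r r' : I ≃o I) : StrictMono (halves r r') := by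
  intro t u h
  have h' : (t : ℝ) < u := h
  unfold halves
  split_ifs with h1 h2 h2
  · rw [lowHalf_lt_lowHalf, r.lt_iff_lt, ← lowHalf_lt_lowHalf, lowHalf_dbl h1, lowHalf_dbl h2]
    exact h
  · have h3 : (0 : I) < r' (dbl' u) := by
      rw [← iso_zero r', r'.lt_iff_lt, ← Subtype.coe_lt_coe, dbl'_coe (not_le.1 h2).le]
      simp only [Set.Icc.coe_zero]
      linarith
    rw [← Subtype.coe_lt_coe] at h3 ⊢
    have := lowHalf_le (r (dbl t))
    simp only [highHalf, Set.Icc.coe_zero] at h3 ⊢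
    linarith
  · linarith
  · rw [highHalf_lt_highHalf, r'.lt_iff_lt, ← highHalf_lt_highHalf,
      highHalf_dbl' (not_le.1 h1).le, highHalf_dbl' (not_le.1 h2).le]
    exact h

/-- `halves` as an order isomorphism. -/
noncomputable def halvesIso (r r' : I ≃o I) : I ≃o I :=
  StrictMono.orderIsoOfRightInverse (halves r r') (halves_strictMono r r')
    (halves r.symm r'.symm) fun t => by
      rcases eq_lowHalf_or_highHalf t with ⟨u, rfl⟩ | ⟨u, rfl⟩
      · simp [halves_lowHalf]
      · rw [halves_highHalf, halves_highHalf, OrderIso.apply_symm_apply]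

theorem compFun_eq_iff {n : ℕ} (D E : ExtDiagram n) {x y : Fin n × I} :
    compFun D E x = compFun D E y ↔
    ((x.2 : ℝ) ≤ 1 / 2 ∧ (y.2 : ℝ) ≤ 1 / 2 ∧
      D.toFun (x.1, dbl x.2) = D.toFun (y.1, dbl y.2)) ∨
    (1 / 2 < (x.2 : ℝ) ∧ 1 / 2 < (y.2 : ℝ) ∧
      E.toFun (D.top x.1, dbl' x.2) = E.toFun (D.top y.1, dbl' y.2)) := by
  refine ⟨compFun_eq D E, ?_⟩
  rintro (⟨hx, hy, e⟩ | ⟨hx, hy, e⟩)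
  · unfold compFun
    rw [if_pos hx, if_pos hy, e]
  · unfold compFun
    rw [if_neg (not_le.2 hx), if_neg (not_le.2 hy), e]

/-- Isotopies can be stacked. -/
theorem Isotopic.comp {n : ℕ} {D D' E E' : ExtDiagram n} (h : Isotopic D D') (h' : Isotopic E E') :
    Isotopic (D.comp E) (D'.comp E') := by
  obtain ⟨H, r, hH, h0, h1, hd⟩ := h
  obtain ⟨H', r', hH', h0', h1', hd'⟩ := h'
  -- the upper endpoints do not move during the isotopy
  have htop : ∀ s i, (H s).top i = D.top i := by
    intro s i
    rw [← h0]
    exact fin_family_const (T := fun s => (H s).top i) (by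
      have c1 : Continuous fun θ : I => ((H θ).toFun (i, 1)).1 :=
        (hH.comp (continuous_id.prodMk continuous_const)).fst
      simpa only [ExtDiagram.upper] using c1) s
  have htop' : ∀ i, D'.top i = D.top i := by
    intro i
    rw [← htop 1]
    apply endpoint_injective
    have e1 := h1 i 1
    rw [iso_one, D'.upper, (H 1).upper] at e1
    exact (congrArg Prod.fst e1).symm
  refine .of_family (fun s => compFun (H s) (H' s))
    (fun i => halvesIso (r i) (r' (D.top i))) ?_ ?_ ?_ ?_ ?_ ?_ ?_
  · have c1 : Continuous dbl := continuous_projIcc.comp (by fun_prop)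
    have c2 : Continuous dbl' := continuous_projIcc.comp (by fun_prop)
    have c3 : Continuous lowHalf := Continuous.subtype_mk (by fun_prop) _
    have c4 : Continuous highHalf := Continuous.subtype_mk (by fun_prop) _
    have c5 : Continuous D.top := continuous_of_discreteTopology
    have a1 : Continuous fun p : I × (Fin n × I) => (H p.1).toFun (p.2.1, dbl p.2.2) :=
      hH.comp (continuous_fst.prodMk (continuous_snd.fst.prodMk (c1.comp continuous_snd.snd)))
    have a2 : Continuous fun p : I × (Fin n × I) => (H' p.1).toFun (D.top p.2.1, dbl' p.2.2) :=
      hH'.comp (continuous_fst.prodMk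
        ((c5.comp continuous_snd.fst).prodMk (c2.comp continuous_snd.snd)))
    simp only [compFun, htop]
    refine Continuous.if_le ?_ ?_ (by fun_prop) continuous_const ?_
    · exact (continuous_fst.comp a1).prodMk (c3.comp (continuous_snd.comp a1))
    · exact (continuous_fst.comp a2).prodMk (c4.comp (continuous_snd.comp a2))
    · intro x hx
      have e1 : dbl x.2.2 = 1 := Subtype.ext (by rw [dbl_coe hx.le, hx]; norm_num)
      have e2 : dbl' x.2.2 = 0 := Subtype.ext (by rw [dbl'_coe hx.ge, hx]; norm_num)
      rw [e1, e2, ExtDiagram.upper, ExtDiagram.lower, htop]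
      refine Prod.ext rfl (Subtype.ext ?_)
      simp [lowHalf, highHalf]
  · intro x
    simp only [h0, h0']
    rfl
  · intro i t
    change ((H 1).comp (H' 1)).toFun (i, t) = (D'.comp E').toFun (i, halves _ _ t)
    rcases eq_lowHalf_or_highHalf t with ⟨u, rfl⟩ | ⟨u, rfl⟩
    · rw [halves_lowHalf, compFun_lowHalf, compFun_lowHalf, h1]
    · rw [halves_highHalf, compFun_highHalf, compFun_highHalf, htop, htop', h1']
  · exact fun s i => ((H s).comp (H' s)).height_strictMono i
  · exact fun s i => (((H s).comp (H' s)).lower i).trans ((D.comp E).lower i).symm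
  · intro s i
    refine (((H s).comp (H' s)).upper i).trans ?_
    rw [(D.comp E).upper]
    have e : (H' s).top (D.top i) = E.top (D.top i) := by
      rw [← h0']
      exact fin_family_const (T := fun s => (H' s).top (D.top i)) (by
        have c1 : Continuous fun θ : I => ((H' θ).toFun (D.top i, 1)).1 :=
          (hH'.comp (continuous_id.prodMk continuous_const)).fst
        simpa only [ExtDiagram.upper] using c1) s
    simp only [ExtDiagram.comp, htop, e]
  · intro s x y
    change _ ↔ compFun D E x = compFun D E y
    rw [compFun_eq_iff, compFun_eq_iff, hd, htop, htop, hd']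

/-- Stacking is associative up to isotopy. -/
theorem Isotopic.comp_assoc {n : ℕ} (D E F : ExtDiagram n) :
    Isotopic ((D.comp E).comp F) (D.comp (E.comp F)) := by
  -- the piecewise linear map with `1 / 4 ↦ 1 / 2` and `1 / 2 ↦ 3 / 4`
  obtain ⟨φ, hφ⟩ : ∃ φ : I ≃o I,
      ∀ t, (φ t : ℝ) = min (min (2 * (t : ℝ)) (t + 1 / 4)) ((t + 1) / 2) :=
    ⟨intervalIso (fun t => min (min (2 * t) (t + 1 / 4)) ((t + 1) / 2)) (by
      intro a b h
      simp only [min_def]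
      split_ifs <;> linarith) (by fun_prop) (by norm_num) (by norm_num), fun _ => rfl⟩
  have φ1 : ∀ t : I, φ (lowHalf (lowHalf t)) = lowHalf t := by
    intro t
    have := t.2.1
    have := t.2.2
    refine Subtype.ext ?_
    rw [hφ]
    simp only [lowHalf, min_def]
    split_ifs <;> linarith
  have φ2 : ∀ t : I, φ (lowHalf (highHalf t)) = highHalf (lowHalf t) := by
    intro t
    have := t.2.1
    have := t.2.2
    refine Subtype.ext ?_
    rw [hφ]
    simp only [lowHalf, highHalf, min_def]
    split_ifs <;> linarith
  have φ3 : ∀ t : I, φ (highHalf t) = highHalf (highHalf t) := by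
    intro t
    have := t.2.1
    have := t.2.2
    refine Subtype.ext ?_
    rw [hφ]
    simp only [highHalf, min_def]
    split_ifs <;> linarith
  refine .of_vertical φ (fun _ => φ) fun i t => ?_
  rcases eq_lowHalf_or_highHalf t with ⟨u, rfl⟩ | ⟨u, rfl⟩
  · rcases eq_lowHalf_or_highHalf u with ⟨u, rfl⟩ | ⟨u, rfl⟩
    · rw [φ1, compFun_lowHalf, compFun_lowHalf, compFun_lowHalf]
      simp only [φ1]
    · rw [φ2, compFun_highHalf, compFun_lowHalf, compFun_lowHalf, compFun_highHalf]
      simp only [φ2]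
  · rw [φ3, compFun_highHalf, compFun_highHalf, compFun_highHalf]
    simp only [φ3]
    rfl

/-! ### Diagrams in coordinates -/

/-- The functions `X p` are the `x`-coordinates, as functions of the height, of the lifted strands
of `D`, numbered by their lower endpoints `p`; the number `g p` is the upper endpoint. -/
structure Coords {n : ℕ} (D : ExtDiagram n) (X : ℤ → ℝ → ℝ) (g : ℤ → ℤ) : Prop where
  toFun_eq : ∀ (i : Fin n) (t : I), D.toFun (i, t) = ((X (i.val + 1) t : AddCircle (n : ℝ)), t)
  cont : ∀ p, Continuous (X p)
  zero : ∀ p, X p 0 = p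
  one : ∀ p, X p 1 = g p
  add_n : ∀ p t, X (p + n) t = X p t + n

theorem Coords.add_mul_n {n : ℕ} {D : ExtDiagram n} {X : ℤ → ℝ → ℝ} {g : ℤ → ℤ}
    (h : Coords D X g) (p m : ℤ) (t : ℝ) : X (p + m * n) t = X p t + m * n := by
  induction m with
  | zero => simp
  | succ k ih =>
    rw [show p + ((k : ℤ) + 1) * n = p + k * n + n by ring, h.add_n, ih]
    push_cast
    ring
  | pred k ih =>
    have := h.add_n (p + (-(k : ℤ) - 1) * n) t
    rw [show p + (-(k : ℤ) - 1) * n + n = p + -(k : ℤ) * n by ring, ih] at this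
    push_cast at this ⊢
    linarith

theorem Coords.lift_eq {n : ℕ} {D : ExtDiagram n} {X : ℤ → ℝ → ℝ} {g : ℤ → ℤ}
    (h : Coords D X g) (i : Fin n) (t : I) : D.lift i t = X (i.val + 1) t :=
  D.lift_eq i (f := fun t : I => X (i.val + 1) t) ((h.cont _).comp continuous_subtype_val)
    (by simp [h.zero]) (fun t => by rw [h.toFun_eq]) t

theorem Coords.pos_eq {n : ℕ} {D : ExtDiagram n} {X : ℤ → ℝ → ℝ} {g : ℤ → ℤ}
    (h : Coords D X g) (i : Fin n) (m : ℤ) (t : I) :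
    D.pos (i, m) t = (X (i.val + 1 + m * n) t, t) := by
  rw [ExtDiagram.pos, h.lift_eq, h.add_mul_n, h.toFun_eq]

theorem Coords.upperEnd_eq {n : ℕ} {D : ExtDiagram n} {X : ℤ → ℝ → ℝ} {g : ℤ → ℤ}
    (h : Coords D X g) (i : Fin n) : D.upperEnd i = g (i.val + 1) := by
  rw [ExtDiagram.upperEnd, h.lift_eq, Set.Icc.coe_one, h.one, Int.floor_intCast]

theorem Coords.exists_top {n : ℕ} {D : ExtDiagram n} {X : ℤ → ℝ → ℝ} {g : ℤ → ℤ}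
    (h : Coords D X g) (i : Fin n) : ∃ m : ℤ, g (i.val + 1) = (D.top i).val + 1 + m * n := by
  have h1 := h.toFun_eq i 1
  rw [D.upper, Set.Icc.coe_one, h.one] at h1
  obtain ⟨m, hm⟩ := coe_eq_coe (congrArg Prod.fst h1).symm
  refine ⟨m, ?_⟩
  have : (g (i.val + 1) : ℝ) = (((D.top i).val + 1 + m * n : ℤ) : ℝ) := by
    push_cast
    linarith
  exact_mod_cast this

theorem Coords.trivial (n : ℕ) : Coords (ExtDiagram.trivial n) (fun p _ => p) id where
  toFun_eq i t := by simp [ExtDiagram.trivial]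
  cont p := continuous_const
  zero p := rfl
  one p := rfl
  add_n p t := by push_cast; ring

/-- The lifted strands of an elementary diagram. -/
def layer {n : ℕ} (i : Fin n) (p : ℤ) (t : ℝ) : ℝ :=
  if At i p then p + t else if At i (p - 1) then p - t else p

theorem layer_add_n {n : ℕ} (i : Fin n) (p : ℤ) (t : ℝ) :
    layer i (p + n) t = layer i p t + n := by
  unfold layer
  rw [show p + n - 1 = p - 1 + n by ring]
  simp only [at_add_n]
  push_cast
  split_ifs <;> ring

theorem layer_one {n : ℕ} (i : Fin n) (p : ℤ) : layer i p 1 = swp i p := by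
  unfold layer swp
  split_ifs <;> push_cast <;> rfl

theorem continuous_layer {n : ℕ} (i : Fin n) (p : ℤ) : Continuous (layer i p) := by
  unfold layer
  split_ifs <;> fun_prop

theorem Coords.elem {n : ℕ} (hn : 3 ≤ n) (i : Fin n) :
    Coords (ExtDiagram.elem hn i) (layer i) (swp i) where
  toFun_eq j t := by
    have h1 : At i (j.val + 1) ↔ j = i := ⟨fun h => (at_self j).eq h, fun h => h ▸ at_self j⟩
    have h2 : At i (j.val + 1 - 1) ↔ j = nxt i := by
      rw [← at_nxt, sub_add_cancel]
      exact ⟨fun h => (at_self j).eq h, fun h => h ▸ at_self j⟩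
    have e : elemCoord i j t = layer i (j.val + 1) t := by
      simp only [elemCoord, layer, h1, h2]
      push_cast
      rfl
    simp only [ExtDiagram.elem, e]
  cont := continuous_layer i
  zero p := by simp [layer]
  one := layer_one i
  add_n := layer_add_n i

/-- The coordinates of a composite. -/
noncomputable def stackCoord (X : ℤ → ℝ → ℝ) (g : ℤ → ℤ) (Y : ℤ → ℝ → ℝ) (p : ℤ) (t : ℝ) : ℝ :=
  if t ≤ 1 / 2 then X p (2 * t) else Y (g p) (2 * t - 1)

theorem Coords.g_add_n {n : ℕ} {D : ExtDiagram n} {X : ℤ → ℝ → ℝ} {g : ℤ → ℤ}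
    (h : Coords D X g) (p : ℤ) : g (p + n) = g p + n := by
  have := h.add_n p 1
  rw [h.one, h.one] at this
  exact_mod_cast this

theorem Coords.comp {n : ℕ} {D E : ExtDiagram n} {X Y : ℤ → ℝ → ℝ} {g h : ℤ → ℤ}
    (hD : Coords D X g) (hE : Coords E Y h) :
    Coords (D.comp E) (stackCoord X g Y) (h ∘ g) where
  toFun_eq i t := by
    rcases eq_lowHalf_or_highHalf t with ⟨u, rfl⟩ | ⟨u, rfl⟩
    · rw [compFun_lowHalf, hD.toFun_eq, stackCoord, if_pos (lowHalf_le u)]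
      simp only [lowHalf]
      rw [mul_div_cancel₀ _ (two_ne_zero' ℝ)]
    · rw [compFun_highHalf, hE.toFun_eq]
      refine Prod.ext ?_ rfl
      obtain ⟨m, hm⟩ := hD.exists_top i
      simp only [stackCoord]
      split_ifs with hu
      · have h0 : (u : ℝ) = 0 := by
          have := u.2.1
          simp only [highHalf] at hu
          linarith
        have e : 2 * (highHalf u : ℝ) = 1 := by simp only [highHalf]; rw [h0]; norm_num
        rw [e, hD.one, h0, hE.zero, hm]
        push_cast
        rw [coe_add_mul]
      · have e : 2 * (highHalf u : ℝ) - 1 = u := by simp only [highHalf]; ring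
        rw [e, hm, hE.add_mul_n, coe_add_mul]
  cont p := by
    have c1 := hD.cont p
    have c2 := hE.cont (g p)
    unfold stackCoord
    refine Continuous.if_le (by fun_prop) (by fun_prop) continuous_id continuous_const ?_
    intro t ht
    change t = 1 / 2 at ht
    subst ht
    norm_num [hD.one, hE.zero]
  zero p := by simp [stackCoord, hD.zero]
  one p := by
    rw [stackCoord, if_neg (by norm_num)]
    norm_num [hE.one]
  add_n p t := by
    unfold stackCoord
    rw [hD.add_n, hD.g_add_n, hE.add_n]
    split_ifs <;> rfl

/-- Isotopies obtained by interpolating the lifts of the strands, which may be reparametrized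
beforehand. The hypothesis `h` says that the interpolations have the same double points as `D`. -/
theorem Isotopic.of_coords {n : ℕ} {D D' : ExtDiagram n} {X X' : ℤ → ℝ → ℝ} {g : ℤ → ℤ}
    (hD : Coords D X g) (hD' : Coords D' X' g) (ψ : ℤ → (I ≃o I)) (hψ : ∀ p, ψ (p + n) = ψ p)
    (h : ∀ (s : I) (p q : ℤ) (t u : I), ((1 - s) * X p t + s * X' p (ψ p t) =
        (1 - s) * X q u + s * X' q (ψ q u) ∧ mix s t (ψ p t) = mix s u (ψ q u)) ↔
      (X p t = X q u ∧ t = u)) : Isotopic D D' := by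
  have hψ' : ∀ p m : ℤ, ψ (p + m * n) = ψ p := by
    intro p m
    induction m with
    | zero => simp
    | succ k ih => rw [show p + ((k : ℤ) + 1) * n = p + k * n + n by ring, hψ, ih]
    | pred k ih => rw [← hψ, ← ih]; congr 1; ring
  set Z : I → ℤ → I → ℝ := fun s p t => (1 - s) * X p t + s * X' p (ψ p t) with hZ
  have hZn : ∀ s p m t, Z s (p + m * n) t = Z s p t + m * n := by
    intro s p m t
    simp only [hZ]
    rw [hD.add_mul_n, hD'.add_mul_n, hψ']
    ring
  refine .of_family (fun s x => ((Z s (x.1.val + 1) x.2 : ℝ), mix s x.2 (ψ (x.1.val + 1) x.2)))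
    (fun i => ψ (i.val + 1)) ?_ ?_ ?_ ?_ ?_ ?_ ?_
  · have key : ∀ i : Fin n, Continuous fun p : I × I =>
        (((Z p.1 (i.val + 1) p.2 : ℝ) : AddCircle (n : ℝ)), mix p.1 p.2 (ψ (i.val + 1) p.2)) := by
      intro i
      have c1 := hD.cont (i.val + 1)
      have c2 := hD'.cont (i.val + 1)
      have c3 := (ψ (i.val + 1)).continuous
      have c : Continuous fun p : I × I => (p.1, p.2, ψ (i.val + 1) p.2) := by fun_prop
      refine Continuous.prodMk ((AddCircle.continuous_mk' (n : ℝ)).comp ?_) (continuous_mix.comp c)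
      fun_prop
    have key' : Continuous fun p : Fin n × (I × I) =>
        (((Z p.2.1 (p.1.val + 1) p.2.2 : ℝ) : AddCircle (n : ℝ)),
          mix p.2.1 p.2.2 (ψ (p.1.val + 1) p.2.2)) := by
      rw [continuous_prod_of_discrete_left]
      exact key
    exact key'.comp (continuous_snd.fst.prodMk (continuous_fst.prodMk continuous_snd.snd))
  · rintro ⟨i, t⟩
    simp [hZ, hD.toFun_eq]
  · intro i t
    simp [hZ, hD'.toFun_eq]
  · exact fun s i t u htu => mix_lt_mix htu ((ψ _).strictMono htu)
  · intro s i
    simp only [hZ, hD.toFun_eq, iso_zero, mix_self, Set.Icc.coe_zero, hD.zero, hD'.zero]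
    rw [← add_mul, sub_add_cancel, one_mul]
  · intro s i
    simp only [hZ, hD.toFun_eq, iso_one, mix_self, Set.Icc.coe_one, hD.one, hD'.one]
    rw [← add_mul, sub_add_cancel, one_mul]
  · rintro s ⟨i, t⟩ ⟨j, u⟩
    simp only [hD.toFun_eq, Prod.mk.injEq]
    constructor
    · rintro ⟨e, e'⟩
      obtain ⟨m, hm⟩ := coe_eq_coe e
      obtain ⟨h1, h2⟩ := (h s (i.val + 1) (j.val + 1 + m * n) t u).1
        ⟨by have := hZn s (j.val + 1) m u; simp only [hZ] at this hm ⊢; linarith, by rw [hψ', e']⟩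
      rw [hD.add_mul_n] at h1
      exact ⟨by rw [h1, coe_add_mul], h2⟩
    · rintro ⟨e, e'⟩
      obtain ⟨m, hm⟩ := coe_eq_coe e
      obtain ⟨h1, h2⟩ := (h s (i.val + 1) (j.val + 1 + m * n) t u).2
        ⟨by rw [hD.add_mul_n]; linarith, e'⟩
      rw [hψ'] at h2
      refine ⟨?_, h2⟩
      have h3 := hZn s (j.val + 1) m u
      have h4 : Z s (i.val + 1) t = Z s (j.val + 1 + m * n) u := h1
      rw [h4, h3, coe_add_mul]

/-- Crossings of pairs of neighbouring strands that do not interfere with each other can be moved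
along the strands: the diagrams have only such crossings, at the positions `p` with `A p`, where
`k p` describes how the strands exchange their places and `a p` is the parameter of the
crossing. -/
theorem Isotopic.of_profiles {n : ℕ} {D D' : ExtDiagram n} {X X' : ℤ → ℝ → ℝ} {g : ℤ → ℤ}
    (hD : Coords D X g) (hD' : Coords D' X' g) (A : ℤ → Prop) (hA : ∀ p, A p → ¬ A (p + 1))
    (k k' : ℤ → I → ℝ) (hX : ∀ (p : ℤ) (t : I), X p t = p + k p t - k (p - 1) t)
    (hX' : ∀ (p : ℤ) (t : I), X' p t = p + k' p t - k' (p - 1) t)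
    (hk : ∀ p t, 0 ≤ k p t ∧ k p t ≤ 1) (hk' : ∀ p t, 0 ≤ k' p t ∧ k' p t ≤ 1)
    (hkA : ∀ p, ¬ A p → ∀ t, k p t = 0 ∧ k' p t = 0) (a b : ℤ → I)
    (ha : ∀ p, A p → ∀ t, (k p t < 1 / 2 ↔ t < a p) ∧ (1 / 2 < k p t ↔ a p < t))
    (hb : ∀ p, A p → ∀ t, (k' p t < 1 / 2 ↔ t < b p) ∧ (1 / 2 < k' p t ↔ b p < t))
    (ψ : ℤ → (I ≃o I)) (hψ : ∀ p, ψ (p + n) = ψ p)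
    (hψA : ∀ p, A p → ψ (p + 1) = ψ p ∧ ψ p (a p) = b p) : Isotopic D D' := by
  -- strands that do not cross are separated from each other
  have sep : ∀ (k : ℤ → I → ℝ) (X : ℤ → ℝ → ℝ),
      (∀ (p : ℤ) (t : I), X p t = p + k p t - k (p - 1) t) → (∀ p t, 0 ≤ k p t ∧ k p t ≤ 1) →
      (∀ p, ¬ A p → ∀ t, k p t = 0) → ∀ p q, p < q → ¬ (q = p + 1 ∧ A p) →
      ∀ t u : I, X p t < X q u := by
    intro k X hX hk hkA p q hpq hc t u
    rw [hX, hX]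
    have h1 := (hk (p - 1) t).1
    have h2 := (hk q u).1
    have h3 := (hk p t).2
    have h4 := (hk (q - 1) u).2
    rcases (show p + 1 ≤ q from hpq).eq_or_lt with rfl | hlt
    · have hnA : ¬ A p := fun h => hc ⟨rfl, h⟩
      rw [add_sub_cancel_right, hkA p hnA t, hkA p hnA u]
      push_cast
      linarith
    rcases (show p + 2 ≤ q by omega).eq_or_lt with rfl | hlt
    · have e : p + 2 - 1 = p + 1 := by ring
      rw [e] at h4 ⊢
      push_cast
      by_cases h : A p
      · rw [hkA (p + 1) (hA p h) u]
        linarith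
      · rw [hkA p h t]
        linarith
    · have : (p : ℝ) + 3 ≤ q := by exact_mod_cast (show p + 3 ≤ q by omega)
      linarith
  have main : ∀ (s : I) (p q : ℤ), p < q → ∀ t u : I, ((1 - s) * X p t + s * X' p (ψ p t) =
        (1 - s) * X q u + s * X' q (ψ q u) ∧ mix s t (ψ p t) = mix s u (ψ q u)) ↔
      (X p t = X q u ∧ t = u) := by
    intro s p q hpq t u
    have hs0 := s.2.1
    have hs1 := s.2.2
    -- interpolation does not create zeros between numbers of the same sign
    have sign : ∀ x y : ℝ, (0 < x ∧ 0 < y ∨ x < 0 ∧ y < 0) → (1 - s) * x + s * y ≠ 0 := by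
      rintro x y (⟨hx, hy⟩ | ⟨hx, hy⟩) h0
      · have h1 := mul_nonneg (sub_nonneg.2 hs1) hx.le
        have h2 := mul_nonneg hs0 hy.le
        have h3 : (1 - (s : ℝ)) * x = 0 := by linarith
        have h4 : (s : ℝ) * y = 0 := by linarith
        rw [mul_eq_zero_iff_right hx.ne'] at h3
        rw [mul_eq_zero_iff_right hy.ne'] at h4
        linarith
      · have h1 := mul_nonpos_of_nonneg_of_nonpos (sub_nonneg.2 hs1) hx.le
        have h2 := mul_nonpos_of_nonneg_of_nonpos hs0 hy.le
        have h3 : (1 - (s : ℝ)) * x = 0 := by linarith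
        have h4 : (s : ℝ) * y = 0 := by linarith
        rw [mul_eq_zero_iff_right hx.ne] at h3
        rw [mul_eq_zero_iff_right hy.ne] at h4
        linarith
    -- For crossing strands, half of the difference is `k p - 1 / 2`, which has the same sign as
    -- its counterpart `k' p - 1 / 2` at the corresponding parameter.
    by_cases hc : q = p + 1 ∧ A p
    · obtain ⟨rfl, hp⟩ := hc
      obtain ⟨e1, e2⟩ := hψA p hp
      have hp' := hA p hp
      have hp'' : ¬ A (p - 1) := fun h => hA _ h (by rwa [sub_add_cancel])
      have htu : mix s t (ψ p t) = mix s u (ψ p u) ↔ t = u :=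
        (show StrictMono fun t => mix s t (ψ p t) from
          fun a b hab => mix_lt_mix hab ((ψ p).strictMono hab)).injective.eq_iff
      rw [e1, htu]
      refine and_congr_left ?_
      rintro rfl
      rw [hX, hX, hX', hX', add_sub_cancel_right, (hkA _ hp' t).1, (hkA _ hp'' t).1,
        (hkA _ hp' _).2, (hkA _ hp'' _).2]
      push_cast
      have a1 := ha p hp t
      have b1 := hb p hp (ψ p t)
      rw [← e2, (ψ p).lt_iff_lt, (ψ p).lt_iff_lt] at b1
      rcases lt_trichotomy t (a p) with hlt | heq | hgt
      · have := sign (k p t - 1 / 2) (k' p (ψ p t) - 1 / 2)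
          (Or.inr ⟨sub_neg.2 (a1.1.2 hlt), sub_neg.2 (b1.1.2 hlt)⟩)
        exact ⟨fun h => absurd (by linarith) this, fun h => absurd (a1.1.2 hlt) (by linarith)⟩
      · have h1 : k p t = 1 / 2 := le_antisymm (not_lt.1 fun h => (a1.2.1 h).ne heq.symm)
          (not_lt.1 fun h => (a1.1.1 h).ne heq)
        have h2 : k' p (ψ p t) = 1 / 2 := le_antisymm (not_lt.1 fun h => (b1.2.1 h).ne heq.symm)
          (not_lt.1 fun h => (b1.1.1 h).ne heq)
        rw [h1, h2]
        exact ⟨fun _ => by ring, fun _ => by ring⟩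
      · have := sign (k p t - 1 / 2) (k' p (ψ p t) - 1 / 2)
          (Or.inl ⟨sub_pos.2 (a1.2.2 hgt), sub_pos.2 (b1.2.2 hgt)⟩)
        exact ⟨fun h => absurd (by linarith) this, fun h => absurd (a1.2.2 hgt) (by linarith)⟩
    · have h1 := sep k X hX hk (fun p hp t => (hkA p hp t).1) p q hpq hc t u
      have h2 := sep k' X' hX' hk' (fun p hp t => (hkA p hp t).2) p q hpq hc (ψ p t) (ψ q u)
      have := sign (X p t - X q u) (X' p (ψ p t) - X' q (ψ q u))
        (Or.inr ⟨sub_neg.2 h1, sub_neg.2 h2⟩)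
      exact ⟨fun h => absurd (by linarith [h.1]) this, fun h => absurd h.1 h1.ne⟩
  refine .of_coords hD hD' ψ hψ fun s p q t u => ?_
  rcases lt_trichotomy p q with h | rfl | h
  · exact main s p q h t u
  · have htu : mix s t (ψ p t) = mix s u (ψ p u) ↔ t = u :=
        (show StrictMono fun t => mix s t (ψ p t) from
          fun a b hab => mix_lt_mix hab ((ψ p).strictMono hab)).injective.eq_iff
    rw [htu]
    refine and_congr_left ?_
    rintro rfl
    simp
  · have := main s q p h u t
    rw [eq_comm, @eq_comm _ (mix s u _), @eq_comm _ (X q u), @eq_comm _ u] at this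
    exact this

theorem exists_iso_apply_eq (a b : I) (ha : 0 < (a : ℝ)) (ha' : (a : ℝ) < 1) (hb : 0 < (b : ℝ))
    (hb' : (b : ℝ) < 1) : ∃ φ : I ≃o I, φ a = b := by
  have h1 : 0 < 1 - (a : ℝ) := by linarith
  have h2 : 0 < 1 - (b : ℝ) := by linarith
  refine ⟨intervalIso (fun t => if t ≤ a then t * (b / a)
    else b + (t - a) * ((1 - b) / (1 - a))) ?_ ?_ ?_ ?_, Subtype.ext ?_⟩
  · intro t u h
    have p1 : 0 < (b : ℝ) / a := by positivity
    have p2 : 0 < (1 - (b : ℝ)) / (1 - a) := by positivity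
    simp only
    split_ifs with h3 h4 h4
    · exact mul_lt_mul_of_pos_right h p1
    · have h5 : t * ((b : ℝ) / a) ≤ a * (b / a) := mul_le_mul_of_nonneg_right h3 p1.le
      rw [mul_div_cancel₀ _ ha.ne'] at h5
      have h6 : 0 < (u - a) * ((1 - (b : ℝ)) / (1 - a)) := mul_pos (by linarith) p2
      linarith
    · linarith
    · have := mul_lt_mul_of_pos_right (show t - a < u - a by linarith) p2
      linarith
  · refine Continuous.if_le (by fun_prop) (by fun_prop) continuous_id continuous_const ?_
    intro t ht
    change t = a at ht
    rw [ht, mul_div_cancel₀ _ ha.ne']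
    ring
  · rw [if_pos ha.le, zero_mul]
  · rw [if_neg (by linarith), mul_div_cancel₀ _ h1.ne']
    ring
  · change (if (a : ℝ) ≤ a then (a : ℝ) * (b / a) else _) = (b : ℝ)
    rw [if_pos le_rfl, mul_div_cancel₀ _ ha.ne']

/-! ### Word diagrams -/

/-- Diagrams in which only the strands at the letter `j` cross, and these only once, are isotopic.
-/
theorem isotopic_of_single {n : ℕ} (hn : 3 ≤ n) {j : Fin n} {D D' : ExtDiagram n}
    {X X' : ℤ → ℝ → ℝ} (hD : Coords D X (swp j)) (hD' : Coords D' X' (swp j)) (c c' : I → ℝ)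
    (hX : ∀ (p : ℤ) (t : I), X p t = if At j p then p + c t else if At j (p - 1) then p - c t else p)
    (hX' : ∀ (p : ℤ) (t : I),
      X' p t = if At j p then p + c' t else if At j (p - 1) then p - c' t else p)
    (hc : ∀ t, 0 ≤ c t ∧ c t ≤ 1) (hc' : ∀ t, 0 ≤ c' t ∧ c' t ≤ 1) (a b : I)
    (ha₀ : 0 < (a : ℝ)) (ha₁ : (a : ℝ) < 1) (hb₀ : 0 < (b : ℝ)) (hb₁ : (b : ℝ) < 1)
    (ha : ∀ t, (c t < 1 / 2 ↔ t < a) ∧ (1 / 2 < c t ↔ a < t))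
    (hb : ∀ t, (c' t < 1 / 2 ↔ t < b) ∧ (1 / 2 < c' t ↔ b < t)) : Isotopic D D' := by
  obtain ⟨φ, hφ⟩ := exists_iso_apply_eq a b ha₀ ha₁ hb₀ hb₁
  have hform : ∀ (c : I → ℝ) (p : ℤ) (t : I),
      (if At j p then (p : ℝ) + c t else if At j (p - 1) then p - c t else p) =
        p + (if At j p then c t else 0) - (if At j (p - 1) then c t else 0) := by
    intro c p t
    by_cases h : At j p
    · rw [if_pos h, if_pos h, if_neg (h.not_sub_one hn), sub_zero]
    · rw [if_neg h, if_neg h]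
      split_ifs <;> ring
  refine .of_profiles hD hD' (At j) (fun p h => h.not_add_one hn)
    (fun p t => if At j p then c t else 0) (fun p t => if At j p then c' t else 0)
    (fun p t => by rw [hX, hform]) (fun p t => by rw [hX', hform]) ?_ ?_ ?_ (fun _ => a)
    (fun _ => b) ?_ ?_ (fun _ => φ) (fun _ => rfl) (fun p _ => ⟨rfl, hφ⟩)
  · intro p t
    split_ifs
    exacts [hc t, ⟨le_rfl, zero_le_one⟩]
  · intro p t
    split_ifs
    exacts [hc' t, ⟨le_rfl, zero_le_one⟩]
  · exact fun p hp t => ⟨if_neg hp, if_neg hp⟩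
  · intro p hp t
    simp only [if_pos hp]
    exact ha t
  · intro p hp t
    simp only [if_pos hp]
    exact hb t

/-- A crossing in the lower half of a composite takes place at the height `1 / 4`. -/
theorem threshold_low (t : I) :
    (min (2 * (t : ℝ)) 1 < 1 / 2 ↔ t < ⟨1 / 4, by norm_num, by norm_num⟩) ∧
    (1 / 2 < min (2 * (t : ℝ)) 1 ↔ (⟨1 / 4, by norm_num, by norm_num⟩ : I) < t) := by
  rw [← Subtype.coe_lt_coe, ← Subtype.coe_lt_coe]
  rw [min_lt_iff, lt_min_iff]
  norm_num
  constructor <;> constructor <;> intro h <;> linarith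

/-- A crossing in the upper half of a composite takes place at the height `3 / 4`. -/
theorem threshold_high (t : I) :
    (max (2 * (t : ℝ) - 1) 0 < 1 / 2 ↔ t < ⟨3 / 4, by norm_num, by norm_num⟩) ∧
    (1 / 2 < max (2 * (t : ℝ) - 1) 0 ↔ (⟨3 / 4, by norm_num, by norm_num⟩ : I) < t) := by
  rw [← Subtype.coe_lt_coe, ← Subtype.coe_lt_coe]
  rw [max_lt_iff, lt_max_iff]
  norm_num
  constructor <;> constructor <;> intro h <;> linarith

theorem min_mem (t : I) : 0 ≤ min (2 * (t : ℝ)) 1 ∧ min (2 * (t : ℝ)) 1 ≤ 1 :=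
  ⟨le_min (by linarith [t.2.1]) zero_le_one, min_le_right _ _⟩

theorem max_mem (t : I) : 0 ≤ max (2 * (t : ℝ) - 1) 0 ∧ max (2 * (t : ℝ) - 1) 0 ≤ 1 :=
  ⟨le_max_right _ _, max_le (by linarith [t.2.2]) zero_le_one⟩

theorem isotopic_elem_comp_trivial {n : ℕ} (hn : 3 ≤ n) (j : Fin n) :
    Isotopic (ExtDiagram.elem hn j) ((ExtDiagram.elem hn j).comp (ExtDiagram.trivial n)) := by
  refine isotopic_of_single hn (Coords.elem hn j) ((Coords.elem hn j).comp (Coords.trivial n))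
    (fun t => (t : ℝ)) (fun t => min (2 * (t : ℝ)) 1) (fun p t => rfl) ?_ (fun t => t.2) min_mem
    ⟨1 / 2, by norm_num, by norm_num⟩ ⟨1 / 4, by norm_num, by norm_num⟩ (by norm_num)
    (by norm_num) (by norm_num) (by norm_num) (fun t => ⟨Iff.rfl, Iff.rfl⟩) threshold_low
  intro p t
  unfold stackCoord layer swp
  split_ifs with h1 h2 h3 h2 h3
  · rw [min_eq_left (by linarith)]
  · rw [min_eq_left (by linarith)]
  · rfl
  · rw [min_eq_right (by linarith)]; push_cast; rfl
  · rw [min_eq_right (by linarith)]; push_cast; rfl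
  · rfl

theorem isotopic_trivial_comp_elem {n : ℕ} (hn : 3 ≤ n) (j : Fin n) :
    Isotopic (ExtDiagram.elem hn j) ((ExtDiagram.trivial n).comp (ExtDiagram.elem hn j)) := by
  refine isotopic_of_single hn (Coords.elem hn j) ((Coords.trivial n).comp (Coords.elem hn j))
    (fun t => (t : ℝ)) (fun t => max (2 * (t : ℝ) - 1) 0) (fun p t => rfl) ?_ (fun t => t.2) max_mem
    ⟨1 / 2, by norm_num, by norm_num⟩ ⟨3 / 4, by norm_num, by norm_num⟩ (by norm_num)
    (by norm_num) (by norm_num) (by norm_num) (fun t => ⟨Iff.rfl, Iff.rfl⟩) threshold_high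
  intro p t
  unfold stackCoord layer id
  split_ifs with h1 h2 h3 h2 h3
  · rw [max_eq_right (by linarith), add_zero]
  · rw [max_eq_right (by linarith), sub_zero]
  · rfl
  · rw [max_eq_left (by linarith)]
  · rw [max_eq_left (by linarith)]
  · rfl

theorem isotopic_trivial_comp_trivial (n : ℕ) :
    Isotopic (ExtDiagram.trivial n) ((ExtDiagram.trivial n).comp (ExtDiagram.trivial n)) := by
  refine .of_coords (Coords.trivial n) ((Coords.trivial n).comp (Coords.trivial n))
    (fun _ => OrderIso.refl I) (fun _ => rfl) fun s p q t u => ?_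
  have h : ∀ p t, stackCoord (fun p _ => (p : ℝ)) id (fun p _ => (p : ℝ)) p t = p := by
    intro p t
    unfold stackCoord
    split_ifs <;> rfl
  simp only [h, OrderIso.refl_apply, mix_self, ← add_mul, sub_add_cancel, one_mul]

/-- How the strands exchange their places in a product of two far elementary diagrams: at the
height `t`, the strand `p` has moved by `farProfile i j p t` towards the position `p + 1`. -/
noncomputable def farProfile {n : ℕ} (i j : Fin n) (p : ℤ) (t : I) : ℝ :=
  if At i p then min (2 * (t : ℝ)) 1 else if At j p then max (2 * (t : ℝ) - 1) 0 else 0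

theorem stackCoord_eq_farProfile {n : ℕ} (hn : 3 ≤ n) {i j : Fin n} (h : Far i j) (p : ℤ) (t : I) :
    stackCoord (layer i) (swp i) (layer j) p t =
      p + farProfile i j p t - farProfile i j (p - 1) t := by
  have key : ∀ q r : Fin n, Far q r → At q (p - 1) → ¬ At q p ∧ ¬ At r p ∧ ¬ At r (p - 1) ∧
      ¬ At r (p - 1 - 1) := by
    intro q r h hq
    have h1 := hq.not_add_one hn
    have h2 := h _ hq
    rw [sub_add_cancel] at h1 h2
    exact ⟨h1, h2.2.1, h2.1, h2.2.2⟩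
  unfold stackCoord farProfile layer
  by_cases hi : At i p
  · obtain ⟨h1, h2, h3⟩ := h p hi
    simp only [hi, swp_of_at hi, hi.not_sub_one hn, h1, h2, h3, if_true, if_false,
      add_sub_cancel_right]
    split_ifs
    · rw [min_eq_left (by linarith)]; ring
    · rw [min_eq_right (by linarith)]; push_cast; ring
  by_cases hi' : At i (p - 1)
  · obtain ⟨h1, h2, h3, h4⟩ := key i j h hi'
    have h5 := swp_of_at' hn hi'
    rw [sub_add_cancel] at h5
    simp only [hi, hi', h5, h2, h3, h4, if_true, if_false]
    split_ifs
    · rw [min_eq_left (by linarith)]; ring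
    · rw [min_eq_right (by linarith)]; push_cast; ring
  simp only [hi, hi', swp_of_not hi hi', if_false]
  by_cases hj : At j p
  · simp only [hj, hj.not_sub_one hn, if_true, if_false]
    split_ifs
    · rw [max_eq_right (by linarith)]; ring
    · rw [max_eq_left (by linarith)]; ring
  by_cases hj' : At j (p - 1)
  · simp only [hj, hj', if_true, if_false]
    split_ifs
    · rw [max_eq_right (by linarith)]; ring
    · rw [max_eq_left (by linarith)]; ring
  · simp only [hj, hj', if_false, ite_self]; ring

/-- Far elementary diagrams commute up to isotopy: the crossings are moved along the strands from
the height `1 / 4` to `3 / 4`, and conversely. -/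
theorem Far.isotopic {n : ℕ} (hn : 3 ≤ n) {i j : Fin n} (h : Far i j) :
    Isotopic ((ExtDiagram.elem hn i).comp (ExtDiagram.elem hn j))
      ((ExtDiagram.elem hn j).comp (ExtDiagram.elem hn i)) := by
  have hg : (swp i ∘ swp j : ℤ → ℤ) = swp j ∘ swp i := funext fun p => h.swp_comm hn p
  have c := (Coords.elem hn j).comp (Coords.elem hn i)
  rw [hg] at c
  obtain ⟨φ, hφ⟩ := exists_iso_apply_eq ⟨1 / 4, by norm_num, by norm_num⟩
    ⟨3 / 4, by norm_num, by norm_num⟩ (by norm_num) (by norm_num) (by norm_num) (by norm_num)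
  have hprof : ∀ (i j : Fin n) p t, 0 ≤ farProfile i j p t ∧ farProfile i j p t ≤ 1 := by
    intro i j p t
    unfold farProfile
    split_ifs
    exacts [min_mem t, max_mem t, ⟨le_rfl, zero_le_one⟩]
  refine .of_profiles ((Coords.elem hn i).comp (Coords.elem hn j)) c
    (fun p => At i p ∨ At j p) ?_ (farProfile i j) (farProfile j i)
    (stackCoord_eq_farProfile hn h) (stackCoord_eq_farProfile hn h.symm) (hprof i j) (hprof j i) ?_
    (fun p => if At i p then ⟨1 / 4, by norm_num, by norm_num⟩
      else ⟨3 / 4, by norm_num, by norm_num⟩)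
    (fun p => if At i p then ⟨3 / 4, by norm_num, by norm_num⟩
      else ⟨1 / 4, by norm_num, by norm_num⟩) ?_ ?_
    (fun p => if At i p ∨ At i (p - 1) then φ else φ.symm) ?_ ?_
  · rintro p (hp | hp) (hp' | hp')
    · exact hp.not_add_one hn hp'
    · exact (h p hp).2.1 hp'
    · exact (h.symm p hp).2.1 hp'
    · exact hp.not_add_one hn hp'
  · intro p hp t
    push Not at hp
    simp only [farProfile, hp.1, hp.2, if_false, and_self]
  · rintro p (hp | hp) t
    · simp only [farProfile, hp, if_true]
      exact threshold_low t
    · have hp' : ¬ At i p := (h.symm p hp).1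
      simp only [farProfile, hp, hp', if_true, if_false]
      exact threshold_high t
  · rintro p (hp | hp) t
    · have hp' : ¬ At j p := (h p hp).1
      simp only [farProfile, hp, hp', if_true, if_false]
      exact threshold_high t
    · have hp' : ¬ At i p := (h.symm p hp).1
      simp only [farProfile, hp, hp', if_true, if_false]
      exact threshold_low t
  · intro p
    simp only [show p + (n : ℤ) - 1 = p - 1 + n by ring, at_add_n]
  · rintro p (hp | hp)
    · simp only [hp, add_sub_cancel_right, true_or, or_true, if_true, hφ, and_self]
    · obtain ⟨h1, h2, h3⟩ := h.symm p hp
      simp only [h1, h2, h3, add_sub_cancel_right, or_self, if_false, true_and]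
      rw [OrderIso.symm_apply_eq, hφ]

/-- The product of elementary diagrams described by a word. -/
noncomputable def wordDiagram {n : ℕ} (hn : 3 ≤ n) : List (Fin n) → Diagram hn
  | [] => .trivial hn
  | i :: u => (Diagram.elem hn i).comp (wordDiagram hn u)

/-- The coordinates of the diagram of a word. -/
noncomputable def wordCoord {n : ℕ} : List (Fin n) → ℤ → ℝ → ℝ
  | [] => fun p _ => p
  | i :: u => stackCoord (layer i) (swp i) (wordCoord u)

theorem coords_wordDiagram {n : ℕ} (hn : 3 ≤ n) (w : List (Fin n)) :
    Coords (wordDiagram hn w).1 (wordCoord w) (strand w) := by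
  induction w with
  | nil => exact Coords.trivial n
  | cons i u ih => exact (Coords.elem hn i).comp ih

/-- Isotopy classes of diagrams. -/
def IsotopyClass {n : ℕ} (hn : 3 ≤ n) : Type := Quot fun D D' : Diagram hn => Isotopic D.1 D'.1

/-- The isotopy class of a diagram. -/
def IsotopyClass.mk {n : ℕ} {hn : 3 ≤ n} (D : Diagram hn) : IsotopyClass hn := Quot.mk _ D

theorem Isotopic.mk_eq {n : ℕ} {hn : 3 ≤ n} {D D' : Diagram hn} (h : Isotopic D.1 D'.1) :
    IsotopyClass.mk D = IsotopyClass.mk D' := Quot.sound h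

/-- Stacking of isotopy classes. -/
noncomputable def IsotopyClass.comp {n : ℕ} {hn : 3 ≤ n} : IsotopyClass hn → IsotopyClass hn → IsotopyClass hn :=
  Quot.map₂ Diagram.comp (fun _ _ _ h => (Isotopic.refl _).comp h)
    fun _ _ _ h => h.comp (Isotopic.refl _)

theorem IsotopyClass.mk_comp {n : ℕ} {hn : 3 ≤ n} (D E : Diagram hn) :
    mk (D.comp E) = (mk D).comp (mk E) := rfl

theorem IsotopyClass.mk_comp_assoc {n : ℕ} {hn : 3 ≤ n} (D E F : Diagram hn) :
    mk ((D.comp E).comp F) = mk (D.comp (E.comp F)) :=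
  Isotopic.mk_eq (Isotopic.comp_assoc D.1 E.1 F.1)

theorem mk_trivial_comp_wordDiagram {n : ℕ} (hn : 3 ≤ n) (w : List (Fin n)) :
    IsotopyClass.mk ((Diagram.trivial hn).comp (wordDiagram hn w)) =
      IsotopyClass.mk (wordDiagram hn w) := by
  cases w with
  | nil => exact (Isotopic.mk_eq (isotopic_trivial_comp_trivial n)).symm
  | cons i u =>
    have h : IsotopyClass.mk ((Diagram.trivial hn).comp (Diagram.elem hn i)) =
        IsotopyClass.mk (Diagram.elem hn i) :=
      (Isotopic.mk_eq (isotopic_trivial_comp_elem hn i)).symm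
    rw [wordDiagram, ← IsotopyClass.mk_comp_assoc, IsotopyClass.mk_comp, h, IsotopyClass.mk_comp]

theorem mk_wordDiagram_append {n : ℕ} (hn : 3 ≤ n) (u v : List (Fin n)) :
    IsotopyClass.mk (wordDiagram hn (u ++ v)) =
      IsotopyClass.mk ((wordDiagram hn u).comp (wordDiagram hn v)) := by
  induction u with
  | nil => exact (mk_trivial_comp_wordDiagram hn v).symm
  | cons i u ih =>
    rw [wordDiagram, IsotopyClass.mk_comp_assoc, List.cons_append, wordDiagram,
      IsotopyClass.mk_comp, ih, IsotopyClass.mk_comp (Diagram.elem hn i)]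

theorem mk_elem_eq {n : ℕ} (hn : 3 ≤ n) (i : Fin n) :
    IsotopyClass.mk (Diagram.elem hn i) = IsotopyClass.mk (wordDiagram hn [i]) :=
  Isotopic.mk_eq (isotopic_elem_comp_trivial hn i)

/-- Every diagram is isotopic to the diagram of a word. -/
theorem exists_mk_eq_wordDiagram {n : ℕ} {hn : 3 ≤ n} (D : Diagram hn) :
    ∃ w, IsotopyClass.mk D = IsotopyClass.mk (wordDiagram hn w) := by
  obtain ⟨D, h⟩ := D
  induction h with
  | trivial => exact ⟨[], rfl⟩
  | elem i => exact ⟨[i], mk_elem_eq hn i⟩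
  | comp h h' ih ih' =>
    obtain ⟨w, e⟩ := ih
    obtain ⟨w', e'⟩ := ih'
    refine ⟨w ++ w', ?_⟩
    rw [mk_wordDiagram_append, IsotopyClass.mk_comp, ← e, ← e']
    rfl
  | @isotopic D D' h h' ih =>
    obtain ⟨w, e⟩ := ih
    refine ⟨w, ?_⟩
    rw [← e]
    exact (Isotopic.mk_eq (D := ⟨D, h⟩) (D' := ⟨D', _⟩) h').symm

theorem CommEq.mk_wordDiagram_eq {n : ℕ} (hn : 3 ≤ n) {u v : List (Fin n)} (h : CommEq u v) :
    IsotopyClass.mk (wordDiagram hn u) = IsotopyClass.mk (wordDiagram hn v) := by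
  induction h with
  | refl w => rfl
  | cons i _ ih => rw [wordDiagram, wordDiagram, IsotopyClass.mk_comp, ih, IsotopyClass.mk_comp]
  | @swap i j u h =>
    have e : IsotopyClass.mk ((Diagram.elem hn i).comp (Diagram.elem hn j)) =
        IsotopyClass.mk ((Diagram.elem hn j).comp (Diagram.elem hn i)) :=
      Isotopic.mk_eq (h.isotopic hn)
    simp only [wordDiagram]
    rw [← IsotopyClass.mk_comp_assoc, IsotopyClass.mk_comp, e, ← IsotopyClass.mk_comp,
      IsotopyClass.mk_comp_assoc]
  | trans _ _ ih ih' => exact ih.trans ih'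

/-- The projection from the isotopy classes to the diagrams modulo isotopies and local moves. -/
def IsotopyClass.toDC {n : ℕ} {hn : 3 ≤ n} : IsotopyClass hn → DC hn :=
  Quot.map id fun _ _ h => Or.inl h

theorem IsotopyClass.dc_mk_eq {n : ℕ} {hn : 3 ≤ n} {D D' : Diagram hn}
    (h : IsotopyClass.mk D = IsotopyClass.mk D') : DC.mk D = DC.mk D' :=
  congrArg IsotopyClass.toDC h

/-- Being a web, the right sequence couple and the class of a web only depend on the isotopy class.
-/
theorem IsotopyClass.web_of_eq {n : ℕ} {hn : 3 ≤ n} {D D' : Diagram hn}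
    (h : IsotopyClass.mk D = IsotopyClass.mk D') :
    (IsWeb D.1 ↔ IsWeb D'.1) ∧ D.1.rightCouple = D'.1.rightCouple ∧
      ∀ (hD : IsWeb D.1) (hD' : IsWeb D'.1), WC.mk ⟨D, hD⟩ = WC.mk ⟨D', hD'⟩ := by
  have e := Quot.eqvGen_exact h
  clear h
  induction e with
  | rel D D' h =>
    exact ⟨h.isWeb_iff.symm, h.rightCouple_eq.symm, fun _ _ => Quot.sound h⟩
  | refl D => exact ⟨Iff.rfl, rfl, fun _ _ => rfl⟩
  | symm D D' h ih =>
    obtain ⟨h1, h2, h3⟩ := ih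
    exact ⟨h1.symm, h2.symm, fun a b => (h3 b a).symm⟩
  | trans D D' D'' h h' ih ih' =>
    obtain ⟨h1, h2, h3⟩ := ih
    obtain ⟨h1', h2', h3'⟩ := ih'
    exact ⟨h1.trans h1', h2.trans h2', fun a b => (h3 a (h1.1 a)).trans (h3' (h1.1 a) b)⟩

/-! ### Webs among the diagrams of words -/

theorem add_mul_injective {n : ℕ} {s s' : Fin n × ℤ}
    (h : (s.1.val : ℤ) + 1 + s.2 * n = s'.1.val + 1 + s'.2 * n) : s = s' := by
  have h1 : At s.1 ((s'.1.val : ℤ) + 1 + s'.2 * n) := h ▸ at_add_mul.2 (at_self _)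
  have h2 := h1.eq (at_add_mul.2 (at_self _))
  have hn : (n : ℤ) ≠ 0 := by have := s.1.isLt; omega
  refine Prod.ext h2 ?_
  rw [h2] at h
  exact mul_right_cancel₀ hn (by linarith)

theorem Coords.pos_eq_pos_iff {n : ℕ} {D : ExtDiagram n} {X : ℤ → ℝ → ℝ} {g : ℤ → ℤ}
    (h : Coords D X g) (s s' : Fin n × ℤ) (t u : I) : D.pos s t = D.pos s' u ↔
      t = u ∧ X (s.1.val + 1 + s.2 * n) t = X (s'.1.val + 1 + s'.2 * n) t := by
  rw [h.pos_eq, h.pos_eq, Prod.mk.injEq]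
  constructor
  · rintro ⟨e, rfl⟩
    exact ⟨rfl, e⟩
  · rintro ⟨rfl, e⟩
    exact ⟨e, rfl⟩

/-- Two curves meet over the unit interval. -/
def Meet (X : ℤ → ℝ → ℝ) (p q : ℤ) : Prop := ∃ t : I, X p t = X q t

theorem Meet.symm {X : ℤ → ℝ → ℝ} {p q : ℤ} : Meet X p q → Meet X q p := fun ⟨t, h⟩ => ⟨t, h.symm⟩

/-- The web condition in coordinates, for strands parametrized by the height. -/
theorem Coords.isWeb_iff {n : ℕ} (hn : 3 ≤ n) {D : ExtDiagram n} {X : ℤ → ℝ → ℝ} {g : ℤ → ℤ}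
    (h : Coords D X g) : IsWeb D ↔
      (∀ p q, p ≠ q → ∀ t t' : I, X p t = X q t → X p t' = X q t' → t = t') ∧
      ∀ p q r, p ≠ q → q ≠ r → p ≠ r → Meet X p q → Meet X q r → Meet X p r → False := by
  have hmeet : ∀ s s' : Fin n × ℤ, (∃ t u, D.pos s t = D.pos s' u) ↔
      Meet X (s.1.val + 1 + s.2 * n) (s'.1.val + 1 + s'.2 * n) := by
    intro s s'
    simp only [h.pos_eq_pos_iff]
    exact ⟨fun ⟨t, _, _, e⟩ => ⟨t, e⟩, fun ⟨t, e⟩ => ⟨t, t, rfl, e⟩⟩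
  have hsurj : ∀ p : ℤ, ∃ s : Fin n × ℤ, p = s.1.val + 1 + s.2 * n := fun p => by
    obtain ⟨i, m, h⟩ := exists_at hn p
    exact ⟨(i, m), h⟩
  refine and_congr ?_ ?_
  · rw [hasContractibleBigon_iff]
    constructor
    · intro hb p q hpq t t' e e'
      obtain ⟨s, rfl⟩ := hsurj p
      obtain ⟨s', rfl⟩ := hsurj q
      by_contra ht
      refine hb ⟨s, s', fun e => hpq (by rw [e]), t, t, t', t', ht, ?_, ?_⟩
      · exact (h.pos_eq_pos_iff _ _ _ _).2 ⟨rfl, e⟩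
      · exact (h.pos_eq_pos_iff _ _ _ _).2 ⟨rfl, e'⟩
    · rintro hb ⟨s, s', hne, t, u, t', u', ht, e, e'⟩
      rw [h.pos_eq_pos_iff] at e e'
      exact ht (hb _ _ (fun e => hne (add_mul_injective e)) t t' e.2 e'.2)
  · simp only [ExtDiagram.HasContractibleTriangle, liftedStrand_inter_nonempty_iff, hmeet]
    constructor
    · intro ht p q r h1 h2 h3 m1 m2 m3
      obtain ⟨s, rfl⟩ := hsurj p
      obtain ⟨s', rfl⟩ := hsurj q
      obtain ⟨s'', rfl⟩ := hsurj r
      exact ht ⟨s, s', s'', fun e => h1 (by rw [e]), fun e => h2 (by rw [e]),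
        fun e => h3 (by rw [e]), m1, m2, m3⟩
    · rintro ht ⟨s, s', s'', h1, h2, h3, m1, m2, m3⟩
      exact ht _ _ _ (fun e => h1 (add_mul_injective e)) (fun e => h2 (add_mul_injective e))
        (fun e => h3 (add_mul_injective e)) m1 m2 m3

theorem layer_eq_iff {n : ℕ} (hn : 3 ≤ n) {i : Fin n} {p q : ℤ} (hpq : p < q) {t : ℝ} (h₀ : 0 ≤ t)
    (h₁ : t ≤ 1) : layer i p t = layer i q t ↔ At i p ∧ q = p + 1 ∧ t = 1 / 2 := by
  have hpq' : (p : ℝ) + 1 ≤ q := by exact_mod_cast hpq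
  constructor
  · intro h
    by_cases hq : q = p + 1
    · subst hq
      unfold layer at h
      rw [add_sub_cancel_right] at h
      by_cases hp : At i p
      · rw [if_pos hp, if_neg (hp.not_add_one hn), if_pos hp] at h
        push_cast at h
        exact ⟨hp, rfl, by linarith⟩
      · exfalso
        rw [if_neg hp, if_neg hp] at h
        push_cast at h
        split_ifs at h <;> linarith
    · exfalso
      have hq2 : (p : ℝ) + 2 ≤ q := by exact_mod_cast (by omega : p + 2 ≤ q)
      unfold layer at h
      split_ifs at h with h1 h2 h3 h4 h5 h6 h7 <;> try linarith
      have e : (q : ℝ) = p + 2 := by linarith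
      have e' : q = p + 2 := by exact_mod_cast e
      subst e'
      exact h1.not_add_one hn (by rwa [show p + 2 - 1 = p + 1 by ring] at h3)
  · rintro ⟨hp, rfl, rfl⟩
    unfold layer
    rw [if_pos hp, if_neg (hp.not_add_one hn), add_sub_cancel_right, if_pos hp]
    push_cast
    ring

theorem swp_injective {n : ℕ} (hn : 3 ≤ n) (i : Fin n) : Function.Injective (swp i) :=
  Function.LeftInverse.injective (swp_swp hn i)

theorem at_of_swp_lt {n : ℕ} {i : Fin n} {p q : ℤ} (hpq : p < q) (h : swp i q < swp i p) :
    At i p ∧ q = p + 1 := by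
  have hq : q - 1 ≤ swp i q := by unfold swp; split_ifs <;> omega
  by_cases hp : At i p
  · rw [swp_of_at hp] at h
    exact ⟨hp, by omega⟩
  · have : swp i p ≤ p := by unfold swp; split_ifs <;> omega
    omega

/-- The double points of the diagram of `i :: u` are the crossings of `i`, at the height `1 / 4`,
and those of the diagram of `u` in the upper half. -/
theorem wordCoord_cons_eq_iff {n : ℕ} (hn : 3 ≤ n) (i : Fin n) (u : List (Fin n)) {p q : ℤ}
    (hpq : p < q) (t : I) : wordCoord (i :: u) p t = wordCoord (i :: u) q t ↔
      (At i p ∧ q = p + 1 ∧ (t : ℝ) = 1 / 4) ∨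
      (1 / 2 < (t : ℝ) ∧ wordCoord u (swp i p) (2 * t - 1) = wordCoord u (swp i q) (2 * t - 1)) := by
  have h0 := t.2.1
  simp only [wordCoord, stackCoord]
  split_ifs with h
  · rw [layer_eq_iff hn hpq (by linarith) (by linarith)]
    constructor
    · rintro ⟨h1, h2, h3⟩
      exact Or.inl ⟨h1, h2, by linarith⟩
    · rintro (⟨h1, h2, h3⟩ | ⟨h1, -⟩)
      · exact ⟨h1, h2, by linarith⟩
      · linarith
  · constructor
    · exact fun e => Or.inr ⟨by linarith, e⟩
    · rintro (⟨-, -, h3⟩ | ⟨-, h2⟩)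
      · linarith
      · exact h2

theorem double_mem {t : I} (h : 1 / 2 < (t : ℝ)) : 2 * (t : ℝ) - 1 ∈ I :=
  ⟨by linarith, by linarith [t.2.2]⟩

/-- Crossing strands of the diagram of a web word move in opposite directions. -/
theorem IsWebWord.lt_of_meet {n : ℕ} (hn : 3 ≤ n) {w : List (Fin n)} (hw : IsWebWord w) {p q : ℤ}
    (hpq : p < q) (h : Meet (wordCoord w) p q) : p < strand w p ∧ strand w q < q := by
  induction w generalizing p q with
  | nil =>
    obtain ⟨t, e⟩ := h
    simp only [wordCoord, Int.cast_inj] at e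
    omega
  | cons i u ih =>
    obtain ⟨hu, hi⟩ := hw
    obtain ⟨t, e⟩ := h
    simp only [strand]
    rcases (wordCoord_cons_eq_iff hn i u hpq t).1 e with ⟨hp, rfl, -⟩ | ⟨ht, e⟩
    · rw [swp_of_at hp, swp_of_at' hn hp]
      have := hi p hp
      omega
    · have hm : Meet (wordCoord u) (swp i p) (swp i q) := ⟨⟨_, double_mem ht⟩, e⟩
      by_cases hlt : swp i p < swp i q
      · obtain ⟨h1, h2⟩ := ih hu hlt hm
        constructor
        · refine lt_of_le_of_lt ?_ h1
          by_contra hlt'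
          by_cases hp : At i p
          · rw [swp_of_at hp] at hlt'; omega
          by_cases hp' : At i (p - 1)
          · have e1 := swp_of_at' hn hp'
            rw [sub_add_cancel] at e1
            rw [e1] at h1
            have := hi _ hp'
            omega
          · rw [swp_of_not hp hp'] at hlt'; omega
        · refine lt_of_lt_of_le h2 ?_
          by_contra hlt'
          by_cases hp : At i q
          · rw [swp_of_at hp] at h2
            have := hi _ hp
            omega
          by_cases hp' : At i (q - 1)
          · have e1 := swp_of_at' hn hp'
            rw [sub_add_cancel] at e1
            rw [e1] at hlt'
            omega
          · rw [swp_of_not hp hp'] at hlt'; omega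
      · exfalso
        have hne : swp i q < swp i p :=
          lt_of_le_of_ne (not_lt.1 hlt) fun e => hpq.ne' (swp_injective hn i e)
        obtain ⟨h1, h2⟩ := ih hu hne hm.symm
        have hp := at_of_swp_lt hpq hne
        obtain ⟨hp, rfl⟩ := hp
        rw [swp_of_at' hn hp] at h1
        have := hi p hp
        omega

/-- Two lifted strands of the diagram of a web word meet at most once. -/
theorem IsWebWord.eq_of_meet {n : ℕ} (hn : 3 ≤ n) {w : List (Fin n)} (hw : IsWebWord w) {p q : ℤ}
    (hpq : p < q) {t t' : I} (h : wordCoord w p t = wordCoord w q t)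
    (h' : wordCoord w p t' = wordCoord w q t') : t = t' := by
  induction w generalizing p q t t' with
  | nil =>
    simp only [wordCoord, Int.cast_inj] at h
    omega
  | cons i u ih =>
    obtain ⟨hu, hi⟩ := hw
    have key : At i p → q = p + 1 → ∀ t : I, 1 / 2 < (t : ℝ) →
        wordCoord u (swp i p) (2 * t - 1) ≠ wordCoord u (swp i q) (2 * t - 1) := by
      rintro hp rfl t ht e
      rw [swp_of_at hp, swp_of_at' hn hp] at e
      have h1 := hu.lt_of_meet hn (lt_add_one p) ⟨⟨_, double_mem ht⟩, e.symm⟩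
      have h2 := hi p hp
      omega
    rcases (wordCoord_cons_eq_iff hn i u hpq t).1 h with ⟨hp, hq, e⟩ | ⟨ht, e⟩ <;>
    rcases (wordCoord_cons_eq_iff hn i u hpq t').1 h' with ⟨hp', hq', e'⟩ | ⟨ht', e'⟩
    · exact Subtype.ext (e.trans e'.symm)
    · exact absurd e' (key hp hq _ ht')
    · exact absurd e (key hp' hq' _ ht)
    · have e1 : (⟨_, double_mem ht⟩ : I) = ⟨_, double_mem ht'⟩ := by
        rcases lt_or_ge (swp i p) (swp i q) with hlt | hge
        · exact ih hu hlt e e'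
        · have hne : swp i q < swp i p :=
            lt_of_le_of_ne hge fun e => hpq.ne' (swp_injective hn i e)
          exact ih hu hne e.symm e'.symm
      have e2 := congrArg Subtype.val e1
      simp only at e2
      exact Subtype.ext (by linarith)

theorem IsWebWord.isWeb {n : ℕ} (hn : 3 ≤ n) {w : List (Fin n)} (hw : IsWebWord w) :
    IsWeb (wordDiagram hn w).1 := by
  rw [(coords_wordDiagram hn w).isWeb_iff hn]
  constructor
  · intro p q hpq t t' h h'
    rcases lt_or_gt_of_ne hpq with hlt | hlt
    · exact hw.eq_of_meet hn hlt h h'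
    · exact hw.eq_of_meet hn hlt h.symm h'.symm
  · -- the middle one of three pairwise crossing strands would move in both directions
    have key : ∀ p q r, p < q → q < r → Meet (wordCoord w) p q → Meet (wordCoord w) q r → False := by
      intro p q r h1 h2 m1 m2
      have := hw.lt_of_meet hn h1 m1
      have := hw.lt_of_meet hn h2 m2
      omega
    intro p q r h1 h2 h3 m1 m2 m3
    rcases lt_or_gt_of_ne h1 with l1 | l1 <;> rcases lt_or_gt_of_ne h2 with l2 | l2 <;>
      rcases lt_or_gt_of_ne h3 with l3 | l3
    · exact key _ _ _ l1 l2 m1 m2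
    · exact key _ _ _ l1 l2 m1 m2
    · exact key _ _ _ l3 l2 m3 m2.symm
    · exact key _ _ _ l3 l1 m3.symm m1
    · exact key _ _ _ l1 l3 m1.symm m3
    · exact key _ _ _ l2 l3 m2 m3.symm
    · exact key _ _ _ l2 l1 m2.symm m1.symm
    · exact key _ _ _ l2 l1 m2.symm m1.symm

/-- A strand of a web that ends to the right of its lower endpoint crosses another strand that
starts to the right of it. -/
theorem IsWebWord.exists_meet_right {n : ℕ} (hn : 3 ≤ n) {w : List (Fin n)} (hw : IsWebWord w)
    {p : ℤ} (h : p < strand w p) : ∃ q > p, Meet (wordCoord w) p q := by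
  induction w generalizing p with
  | nil => simp [strand] at h
  | cons i u ih =>
    obtain ⟨hu, hi⟩ := hw
    by_cases hp : At i p
    · exact ⟨p + 1, by omega, ⟨1 / 4, by norm_num, by norm_num⟩,
        (wordCoord_cons_eq_iff hn i u (lt_add_one p) _).2 (Or.inl ⟨hp, rfl, rfl⟩)⟩
    by_cases hp' : At i (p - 1)
    · exfalso
      have e := swp_of_at' hn hp'
      rw [sub_add_cancel] at e
      rw [strand, e] at h
      have := hi _ hp'
      omega
    rw [strand, swp_of_not hp hp'] at h
    obtain ⟨q, hq, t, e⟩ := ih hu h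
    have hlt : p < swp i q := by
      by_cases hq' : At i (q - 1)
      · have e := swp_of_at' hn hq'
        rw [sub_add_cancel] at e
        rw [e]
        refine lt_of_le_of_ne (by omega) fun e => hp (e ▸ hq')
      · have : q ≤ swp i q := by unfold swp; split_ifs <;> omega
        omega
    refine ⟨swp i q, hlt, highHalf t, (wordCoord_cons_eq_iff hn i u hlt _).2 (Or.inr ⟨?_, ?_⟩)⟩
    · have h0 : (t : ℝ) ≠ 0 := by
        intro h0
        rw [h0, (coords_wordDiagram hn u).zero, (coords_wordDiagram hn u).zero] at e
        have : p = q := by exact_mod_cast e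
        omega
      have : 0 < (t : ℝ) := lt_of_le_of_ne t.2.1 h0.symm
      simp only [highHalf]
      linarith
    · rw [swp_swp hn, swp_of_not hp hp', show 2 * (highHalf t : ℝ) - 1 = t by
        simp only [highHalf]; ring]
      exact e

theorem IsWebWord.exists_meet_left {n : ℕ} (hn : 3 ≤ n) {w : List (Fin n)} (hw : IsWebWord w)
    {p : ℤ} (h : strand w p < p) : ∃ q < p, Meet (wordCoord w) q p := by
  induction w generalizing p with
  | nil => simp [strand] at h
  | cons i u ih =>
    obtain ⟨hu, hi⟩ := hw
    by_cases hp' : At i (p - 1)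
    · exact ⟨p - 1, by omega, ⟨1 / 4, by norm_num, by norm_num⟩,
        (wordCoord_cons_eq_iff hn i u (sub_one_lt p) _).2 (Or.inl ⟨hp', by ring, rfl⟩)⟩
    by_cases hp : At i p
    · exfalso
      rw [strand, swp_of_at hp] at h
      have := hi _ hp
      omega
    rw [strand, swp_of_not hp hp'] at h
    obtain ⟨q, hq, t, e⟩ := ih hu h
    have hlt : swp i q < p := by
      by_cases hq' : At i q
      · rw [swp_of_at hq']
        refine lt_of_le_of_ne (by omega) fun e => hp' ?_
        rwa [← e, add_sub_cancel_right]
      · have : swp i q ≤ q := by unfold swp; split_ifs <;> omega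
        omega
    refine ⟨swp i q, hlt, highHalf t, (wordCoord_cons_eq_iff hn i u hlt _).2 (Or.inr ⟨?_, ?_⟩)⟩
    · have h0 : (t : ℝ) ≠ 0 := by
        intro h0
        rw [h0, (coords_wordDiagram hn u).zero, (coords_wordDiagram hn u).zero] at e
        have : q = p := by exact_mod_cast e
        omega
      have : 0 < (t : ℝ) := lt_of_le_of_ne t.2.1 h0.symm
      simp only [highHalf]
      linarith
    · rw [swp_swp hn, swp_of_not hp hp', show 2 * (highHalf t : ℝ) - 1 = t by
        simp only [highHalf]; ring]
      exact e

/-- Two continuous curves in different order at two heights meet in between. -/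
theorem Coords.meet_of_le {n : ℕ} {D : ExtDiagram n} {X : ℤ → ℝ → ℝ} {g : ℤ → ℤ}
    (h : Coords D X g) {p q : ℤ} {t t' : I} (h₁ : X p t ≤ X q t) (h₂ : X q t' ≤ X p t') :
    Meet X p q := by
  have c : ∀ p, Continuous fun t : I => X p t := fun p => (h.cont p).comp continuous_subtype_val
  obtain ⟨u, hu⟩ := mem_range_of_exists_le_of_exists_ge ((c p).sub (c q))
    ⟨t, sub_nonpos.2 h₁⟩ ⟨t', sub_nonneg.2 h₂⟩
  exact ⟨u, sub_eq_zero.1 hu⟩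

/-- If the diagram of a word is a web, then the word is a web word. Otherwise one of the strands
that cross at a letter turns back above it and crosses a further strand, which leads to a
contractible bigon or triangle. -/
theorem isWebWord_of_isWeb {n : ℕ} (hn : 3 ≤ n) {w : List (Fin n)}
    (hw : IsWeb (wordDiagram hn w).1) : IsWebWord w := by
  induction w with
  | nil => exact True.intro
  | cons i u ih =>
    rw [(coords_wordDiagram hn _).isWeb_iff hn] at hw
    obtain ⟨hb, htr⟩ := hw
    have cu := coords_wordDiagram hn u
    have hpos : ∀ p q (t : I), p ≠ q → wordCoord u p t = wordCoord u q t →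
        1 / 2 < (highHalf t : ℝ) := by
      intro p q t hpq e
      have h0 : (t : ℝ) ≠ 0 := by
        intro h0
        rw [h0, cu.zero, cu.zero] at e
        exact hpq (by exact_mod_cast e)
      have : 0 < (t : ℝ) := lt_of_le_of_ne t.2.1 h0.symm
      simp only [highHalf]
      linarith
    -- double points of the diagram of `u` are double points of the diagram of `i :: u`
    have hup : ∀ p q (t : I), p ≠ q → wordCoord u p t = wordCoord u q t →
        wordCoord (i :: u) (swp i p) (highHalf t) = wordCoord (i :: u) (swp i q) (highHalf t) := by
      intro p q t hpq e
      have e1 := hpos p q t hpq e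
      simp only [wordCoord, stackCoord]
      rw [if_neg (by linarith), if_neg (by linarith), swp_swp hn, swp_swp hn,
        show 2 * (highHalf t : ℝ) - 1 = t by simp only [highHalf]; ring]
      exact e
    have hm : ∀ p q, p ≠ q → Meet (wordCoord u) p q →
        Meet (wordCoord (i :: u)) (swp i p) (swp i q) :=
      fun p q hpq ⟨t, e⟩ => ⟨_, hup p q t hpq e⟩
    have inj := swp_injective hn i
    have hu : IsWebWord u := by
      refine ih ?_
      rw [cu.isWeb_iff hn]
      constructor
      · intro p q hpq t t' e e'
        have e1 := congrArg Subtype.val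
          (hb _ _ (inj.ne hpq) _ _ (hup _ _ _ hpq e) (hup _ _ _ hpq e'))
        simp only [highHalf] at e1
        exact Subtype.ext (by linarith)
      · intro p q r h1 h2 h3 m1 m2 m3
        exact htr _ _ _ (inj.ne h1) (inj.ne h2) (inj.ne h3) (hm _ _ h1 m1) (hm _ _ h2 m2)
          (hm _ _ h3 m3)
    -- the two strands that cross at the letter `i` do not meet again
    have hnot : ∀ p, At i p → ¬ Meet (wordCoord u) p (p + 1) := by
      rintro p hp ⟨t, e⟩
      have e1 := hup p (p + 1) t (by omega) e
      have e2 := hpos p (p + 1) t (by omega) e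
      have e3 := (wordCoord_cons_eq_iff hn i u (lt_add_one p) ⟨1 / 4, by norm_num, by norm_num⟩).2
        (Or.inl ⟨hp, rfl, rfl⟩)
      rw [swp_of_at hp, swp_of_at' hn hp] at e1
      have e4 := congrArg Subtype.val (hb p (p + 1) (by omega) _ _ e3 e1.symm)
      simp only at e4
      linarith
    have hcross : ∀ p, At i p → Meet (wordCoord (i :: u)) (swp i p) (swp i (p + 1)) := by
      intro p hp
      rw [swp_of_at hp, swp_of_at' hn hp]
      exact .symm ⟨⟨1 / 4, by norm_num, by norm_num⟩,
        (wordCoord_cons_eq_iff hn i u (lt_add_one p) _).2 (Or.inl ⟨hp, rfl, rfl⟩)⟩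
    refine ⟨hu, fun p hp => ⟨?_, ?_⟩⟩ <;> by_contra hlt <;> rw [not_le] at hlt
    -- The strand `p + 1` is between `p` and `q` at the beginning, and `p` and `q` meet. So it
    -- meets one of them, and meeting `p` would be a bigon.
    · obtain ⟨q, hq, t, e⟩ := hu.exists_meet_right hn hlt
      have hq' : q ≠ p + 1 := fun e' => hnot p hp ⟨t, e' ▸ e⟩
      rcases le_total (wordCoord u (p + 1) t) (wordCoord u p t) with hle | hle
      · refine hnot p hp (cu.meet_of_le (t := 0) (t' := t) ?_ hle)
        simp [cu.zero]
      · have m : Meet (wordCoord u) (p + 1) q := by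
          refine cu.meet_of_le (t := 0) (t' := t) ?_ (e ▸ hle)
          simp only [Set.Icc.coe_zero, cu.zero]
          exact_mod_cast hq
        exact htr _ _ _ (inj.ne (by omega)) (inj.ne hq'.symm) (inj.ne hq.lt.ne)
          (hcross p hp) (hm _ _ hq'.symm m) (hm _ _ hq.lt.ne ⟨t, e⟩)
    · obtain ⟨q, hq, t, e⟩ := hu.exists_meet_left hn hlt
      have hq' : q ≠ p := fun e' => hnot p hp ⟨t, e' ▸ e⟩
      rcases le_total (wordCoord u (p + 1) t) (wordCoord u p t) with hle | hle
      · refine hnot p hp (cu.meet_of_le (t := 0) (t' := t) ?_ hle)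
        simp [cu.zero]
      · have m : Meet (wordCoord u) q p := by
          refine cu.meet_of_le (t := 0) (t' := t) ?_ (e ▸ hle)
          simp only [Set.Icc.coe_zero, cu.zero]
          exact_mod_cast (by omega : q ≤ p)
        exact htr _ _ _ (inj.ne hq') (inj.ne (by omega)) (inj.ne hq.ne)
          (hm _ _ hq' m) (hcross p hp) (hm _ _ hq.ne ⟨t, e⟩)

theorem rightCouple_wordDiagram {n : ℕ} (hn : 3 ≤ n) (w : List (Fin n)) :
    (wordDiagram hn w).1.rightCouple = rightPairs n (strand w) := by
  simp only [ExtDiagram.rightCouple, rightPairs, (coords_wordDiagram hn w).upperEnd_eq]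
  congr 2
  exact funext fun i => (coords_wordDiagram hn w).upperEnd_eq i

/-! ### Supports and local moves -/

theorem mem_support_iff {n : ℕ} {D : ExtDiagram n} {z : AddCircle (n : ℝ)} {y : ℝ} :
    (z, y) ∈ D.support ↔ ∃ i t, (D.toFun (i, t)).1 = z ∧ ((D.toFun (i, t)).2 : ℝ) = y := by
  simp only [ExtDiagram.support, Set.mem_range, Prod.exists, Prod.mk.injEq]

theorem mem_support_comp {n : ℕ} (D E : ExtDiagram n) (z : AddCircle (n : ℝ)) (y : ℝ) :
    (z, y) ∈ (D.comp E).support ↔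
      (y ≤ 1 / 2 ∧ (z, 2 * y) ∈ D.support) ∨ (1 / 2 ≤ y ∧ (z, 2 * y - 1) ∈ E.support) := by
  simp only [mem_support_iff]
  constructor
  · rintro ⟨i, t, rfl, rfl⟩
    rcases eq_lowHalf_or_highHalf t with ⟨u, rfl⟩ | ⟨u, rfl⟩
    · rw [compFun_lowHalf]
      refine Or.inl ⟨lowHalf_le _, i, u, rfl, ?_⟩
      simp only [lowHalf]
      rw [mul_div_cancel₀ _ (two_ne_zero' ℝ)]
    · rw [compFun_highHalf]
      refine Or.inr ⟨le_highHalf _, D.top i, u, rfl, ?_⟩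
      simp only [highHalf]
      rw [mul_div_cancel₀ _ (two_ne_zero' ℝ), add_sub_cancel_left]
  · rintro (⟨-, i, u, rfl, h⟩ | ⟨-, j, u, rfl, h⟩)
    · refine ⟨i, lowHalf u, ?_⟩
      rw [compFun_lowHalf]
      refine ⟨rfl, ?_⟩
      simp only [lowHalf]
      linarith
    · obtain ⟨i, rfl⟩ := (Finite.injective_iff_surjective.1 (top_injective D)) j
      refine ⟨i, highHalf u, ?_⟩
      rw [compFun_highHalf]
      refine ⟨rfl, ?_⟩
      simp only [highHalf]
      linarith

theorem mem_support_zero {n : ℕ} (D : ExtDiagram n) (z : AddCircle (n : ℝ)) :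
    (z, (0 : ℝ)) ∈ D.support ↔ ∃ i : Fin n, z = ((i.val + 1 : ℝ) : AddCircle (n : ℝ)) := by
  constructor
  · rintro ⟨⟨i, t⟩, h⟩
    rw [Prod.mk.injEq] at h
    have ht : t = 0 := (D.height_strictMono i).injective
      ((Subtype.ext h.2 : (D.toFun (i, t)).2 = 0).trans (D.height_zero i).symm)
    rw [ht, D.lower] at h
    exact ⟨i, h.1.symm⟩
  · rintro ⟨i, rfl⟩
    exact ⟨(i, 0), by simp [D.lower]⟩

theorem mem_support_one {n : ℕ} (D : ExtDiagram n) (z : AddCircle (n : ℝ)) :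
    (z, (1 : ℝ)) ∈ D.support ↔ ∃ i : Fin n, z = ((i.val + 1 : ℝ) : AddCircle (n : ℝ)) := by
  constructor
  · rintro ⟨⟨i, t⟩, h⟩
    rw [Prod.mk.injEq] at h
    have ht : t = 1 := (D.height_strictMono i).injective
      ((Subtype.ext h.2 : (D.toFun (i, t)).2 = 1).trans (D.height_one i).symm)
    rw [ht, D.upper] at h
    exact ⟨D.top i, h.1.symm⟩
  · rintro ⟨j, rfl⟩
    obtain ⟨i, rfl⟩ := (Finite.injective_iff_surjective.1 (top_injective D)) j
    exact ⟨(i, 1), by simp [D.upper]⟩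

theorem LocalMove.comp_right {n k : ℕ} {u v : List ℕ} {D D' : ExtDiagram n}
    (h : LocalMove k u v D D') (E : ExtDiagram n) : LocalMove k u v (D.comp E) (D'.comp E) := by
  obtain ⟨x₀, c, y₀, h, hc, hcn, hy, hh, hyh, hout, hin⟩ := h
  refine ⟨x₀, c, y₀ / 2, h / 2, hc, hcn, by linarith, by linarith, by linarith, ?_, ?_⟩
  · rintro ⟨z, y⟩ hz
    rw [mem_support_comp, mem_support_comp, hout (z, 2 * y)]
    rintro ⟨p, hp, e⟩
    rw [Prod.mk.injEq] at e
    exact hz ⟨p, hp, Prod.ext e.1 (by simp only; linarith [e.2])⟩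
  · rintro p hp
    -- at the common boundary of the two halves all diagrams are the same
    have key : ∀ D : ExtDiagram n,
        ((((x₀ + c * p.1 : ℝ) : AddCircle (n : ℝ)), y₀ / 2 + h / 2 * p.2) ∈ (D.comp E).support ↔
          (((x₀ + c * p.1 : ℝ) : AddCircle (n : ℝ)), y₀ + h * p.2) ∈ D.support) := by
      intro D
      have hp2 : h * p.2 ≤ h := by nlinarith [hp.2.2]
      rw [mem_support_comp, show 2 * (y₀ / 2 + h / 2 * p.2) = y₀ + h * p.2 by ring]
      constructor
      · rintro (⟨-, e⟩ | ⟨e, e'⟩)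
        · exact e
        · have e1 : y₀ + h * p.2 = 1 := by linarith
          rw [e1] at e' ⊢
          rw [sub_self, mem_support_zero] at e'
          rwa [mem_support_one]
      · exact fun e => Or.inl ⟨by linarith, e⟩
    exact ⟨(key D).trans (hin p hp).1, (key D').trans (hin p hp).2⟩

theorem LocalMove.comp_left {n k : ℕ} {u v : List ℕ} {D D' : ExtDiagram n}
    (h : LocalMove k u v D D') (E : ExtDiagram n) : LocalMove k u v (E.comp D) (E.comp D') := by
  obtain ⟨x₀, c, y₀, h, hc, hcn, hy, hh, hyh, hout, hin⟩ := h
  refine ⟨x₀, c, (1 + y₀) / 2, h / 2, hc, hcn, by linarith, by linarith, by linarith, ?_, ?_⟩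
  · rintro ⟨z, y⟩ hz
    rw [mem_support_comp, mem_support_comp, hout (z, 2 * y - 1)]
    rintro ⟨p, hp, e⟩
    rw [Prod.mk.injEq] at e
    exact hz ⟨p, hp, Prod.ext e.1 (by simp only; linarith [e.2])⟩
  · rintro p hp
    have key : ∀ D : ExtDiagram n,
        ((((x₀ + c * p.1 : ℝ) : AddCircle (n : ℝ)), (1 + y₀) / 2 + h / 2 * p.2) ∈
          (E.comp D).support ↔
          (((x₀ + c * p.1 : ℝ) : AddCircle (n : ℝ)), y₀ + h * p.2) ∈ D.support) := by
      intro D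
      have hp2 : 0 ≤ h * p.2 := mul_nonneg hh.le hp.2.1
      rw [mem_support_comp, show 2 * ((1 + y₀) / 2 + h / 2 * p.2) = 1 + (y₀ + h * p.2) by ring,
        add_sub_cancel_left]
      constructor
      · rintro (⟨e, e'⟩ | ⟨-, e⟩)
        · have e1 : y₀ + h * p.2 = 0 := by linarith
          rw [e1] at e' ⊢
          rw [add_zero, mem_support_one] at e'
          rwa [mem_support_zero]
        · exact e
      · exact fun e => Or.inr ⟨by linarith, e⟩
    exact ⟨(key D).trans (hin p hp).1, (key D').trans (hin p hp).2⟩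

theorem Step.comp_right {n : ℕ} {hn : 3 ≤ n} {D D' : Diagram hn} (h : Step D D') (E : Diagram hn) :
    Step (D.comp E) (D'.comp E) := by
  rcases h with h | h | h | h
  · exact Or.inl (h.comp (.refl _))
  · exact Or.inr (Or.inl (h.comp_right _))
  · exact Or.inr (Or.inr (Or.inl (h.comp_right _)))
  · exact Or.inr (Or.inr (Or.inr (h.comp_right _)))

theorem Step.comp_left {n : ℕ} {hn : 3 ≤ n} {D D' : Diagram hn} (h : Step D D') (E : Diagram hn) :
    Step (E.comp D) (E.comp D') := by
  rcases h with h | h | h | h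
  · exact Or.inl ((Isotopic.refl _).comp h)
  · exact Or.inr (Or.inl (h.comp_left _))
  · exact Or.inr (Or.inr (Or.inl (h.comp_left _)))
  · exact Or.inr (Or.inr (Or.inr (h.comp_left _)))

theorem DC.exists_mk_eq_wordDiagram {n : ℕ} {hn : 3 ≤ n} (x : DC hn) :
    ∃ w, x = DC.mk (wordDiagram hn w) := by
  obtain ⟨D, rfl⟩ := Quot.exists_rep x
  obtain ⟨w, h⟩ := HeckeKiselman.exists_mk_eq_wordDiagram D
  exact ⟨w, IsotopyClass.dc_mk_eq h⟩

/-- Stacking is a multiplication on the set of diagrams modulo isotopies and local moves. -/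
noncomputable instance DC.instMul {n : ℕ} {hn : 3 ≤ n} : Mul (DC hn) where
  mul := Quot.map₂ Diagram.comp (fun E _ _ h => h.comp_left E) fun _ _ E h => h.comp_right E

theorem DC.mk_wordDiagram_append {n : ℕ} (hn : 3 ≤ n) (u v : List (Fin n)) :
    DC.mk (wordDiagram hn (u ++ v)) = DC.mk (wordDiagram hn u) * DC.mk (wordDiagram hn v) :=
  IsotopyClass.dc_mk_eq (HeckeKiselman.mk_wordDiagram_append hn u v)

noncomputable instance DC.instMonoid {n : ℕ} {hn : 3 ≤ n} : Monoid (DC hn) where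
  one := DC.mk (.trivial hn)
  mul_assoc x y z := by
    obtain ⟨D, rfl⟩ := Quot.exists_rep x
    obtain ⟨E, rfl⟩ := Quot.exists_rep y
    obtain ⟨F, rfl⟩ := Quot.exists_rep z
    exact IsotopyClass.dc_mk_eq (IsotopyClass.mk_comp_assoc D E F)
  one_mul x := by
    obtain ⟨w, rfl⟩ := x.exists_mk_eq_wordDiagram
    exact (DC.mk_wordDiagram_append hn [] w).symm
  mul_one x := by
    obtain ⟨w, rfl⟩ := x.exists_mk_eq_wordDiagram
    refine (DC.mk_wordDiagram_append hn w []).symm.trans ?_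
    rw [List.append_nil]

theorem Coords.mem_support {n : ℕ} (hn : 3 ≤ n) {D : ExtDiagram n} {X : ℤ → ℝ → ℝ} {g : ℤ → ℤ}
    (h : Coords D X g) (z : AddCircle (n : ℝ)) (y : ℝ) :
    (z, y) ∈ D.support ↔ (0 ≤ y ∧ y ≤ 1) ∧ ∃ p, z = (X p y : AddCircle (n : ℝ)) := by
  simp only [mem_support_iff, h.toFun_eq]
  constructor
  · rintro ⟨i, t, rfl, rfl⟩
    exact ⟨t.2, _, rfl⟩
  · rintro ⟨hy, p, rfl⟩
    obtain ⟨i, m, rfl⟩ := exists_at hn p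
    exact ⟨i, ⟨y, hy⟩, by rw [h.add_mul_n, coe_add_mul], rfl⟩

/-- The letter that acts on the strands `l` and `l + 1` among the strands numbered from that of the
letter `i` on. -/
def shiftLetter {n : ℕ} (i : Fin n) (l : ℕ) : Fin n := nxt^[l - 1] i

theorem at_shiftLetter {n : ℕ} (i : Fin n) {l : ℕ} (hl : 1 ≤ l) (p : ℤ) :
    At (shiftLetter i l) p ↔ At i (p - l + 1) := by
  obtain ⟨l, rfl⟩ := Nat.exists_eq_add_of_le' hl
  unfold shiftLetter
  rw [Nat.add_sub_cancel]
  clear hl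
  induction l generalizing p with
  | zero => simp
  | succ l ih =>
    rw [Function.iterate_succ_apply', show p = p - 1 + 1 by ring, at_nxt, ih]
    push_cast
    ring_nf

theorem at_shiftLetter_iff {n : ℕ} {i : Fin n} {l : ℕ} (hl : 1 ≤ l) (hln : l < n) {j : ℕ}
    (hjn : j ≤ n) {m : ℤ} : At (shiftLetter i l) (i.val + j + m * n) ↔ j = l := by
  rw [at_shiftLetter i hl, show (i.val : ℤ) + j + m * n - l + 1 = i.val + j - l + 1 + m * n by ring,
    at_add_mul]
  unfold At
  rw [show (i.val : ℤ) + j - l + 1 - (i.val + 1) = j - l by ring]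
  constructor
  · intro h
    have := Int.eq_zero_of_abs_lt_dvd h (by rw [abs_lt]; omega)
    omega
  · rintro rfl
    simp

theorem layer_shiftLetter {n : ℕ} {i : Fin n} {l : ℕ} (hl : 1 ≤ l) (hln : l < n) {j : ℕ}
    (hj : 1 ≤ j) (hjn : j ≤ n) (m : ℤ) (t : ℝ) :
    layer (shiftLetter i l) (i.val + j + m * n) t =
      i.val + (if j = l then j + t else if j = l + 1 then j - t else (j : ℝ)) + m * n := by
  obtain ⟨j, rfl⟩ := Nat.exists_eq_add_of_le' hj
  have h1 : At (shiftLetter i l) ((i.val : ℤ) + (j + 1 : ℕ) + m * n - 1) ↔ j + 1 = l + 1 := by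
    rw [show (i.val : ℤ) + (j + 1 : ℕ) + m * n - 1 = i.val + j + m * n by push_cast; ring,
      at_shiftLetter_iff hl hln (by omega)]
    omega
  unfold layer
  simp only [at_shiftLetter_iff hl hln hjn, h1]
  push_cast
  split_ifs <;> ring

theorem exists_eq_val_add {n : ℕ} (hn : 3 ≤ n) (i : Fin n) (p : ℤ) :
    ∃ j : ℕ, 1 ≤ j ∧ j ≤ n ∧ ∃ m : ℤ, p = i.val + j + m * n := by
  obtain ⟨j, m, h⟩ := exists_at hn (p - i.val)
  refine ⟨j.val + 1, by omega, j.isLt, m, ?_⟩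
  push_cast
  linarith

theorem planarPicture_bounds {k : ℕ} {u : List ℕ} (hu : ∀ l ∈ u, 1 ≤ l ∧ l < k) {p : ℝ × ℝ}
    (hp : p ∈ planarPicture k u) : (0 ≤ p.2 ∧ p.2 ≤ 1) ∧ 1 ≤ p.1 ∧ p.1 ≤ k := by
  induction u generalizing p with
  | nil =>
    obtain ⟨h, j, ⟨h1, h2⟩, e⟩ := hp
    rw [e]
    exact ⟨h, by exact_mod_cast h1, by exact_mod_cast h2⟩
  | cons l u ih =>
    rcases hp with ⟨⟨h0, h1⟩, j, ⟨hj1, hj2⟩, e⟩ | ⟨h, hp⟩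
    · obtain ⟨hl, hlk⟩ := hu l (List.mem_cons_self ..)
      have hj1' : (1 : ℝ) ≤ j := by exact_mod_cast hj1
      have hj2' : (j : ℝ) ≤ k := by exact_mod_cast hj2
      have hl' : (1 : ℝ) ≤ l := by exact_mod_cast hl
      have hlk' : (l : ℝ) + 1 ≤ k := by exact_mod_cast hlk
      refine ⟨⟨h0, by linarith⟩, ?_⟩
      rw [e]
      split_ifs with c1 c2
      · subst c1; constructor <;> linarith
      · subst c2; push_cast; constructor <;> linarith
      · exact ⟨hj1', hj2'⟩
    · have h2 := (ih (fun l hl => hu l (List.mem_cons_of_mem _ hl)) hp).2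
      exact ⟨⟨by linarith [h.1], h.2⟩, h2⟩

/-- The support of the diagram of a word in neighbouring letters consists of a planar picture and
vertical strands. -/
theorem mem_support_wordDiagram {n k : ℕ} (hn : 3 ≤ n) (hk : k ≤ n) (i : Fin n) {u : List ℕ}
    (hu : ∀ l ∈ u, 1 ≤ l ∧ l < k) (z : AddCircle (n : ℝ)) (y : ℝ) :
    (z, y) ∈ (wordDiagram hn (u.map (shiftLetter i))).1.support ↔ (0 ≤ y ∧ y ≤ 1) ∧
      ((∃ j : ℕ, k < j ∧ j ≤ n ∧ z = ((i.val + j : ℝ) : AddCircle (n : ℝ))) ∨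
        ∃ x : ℝ, (x, y) ∈ planarPicture k u ∧ z = ((i.val + x : ℝ) : AddCircle (n : ℝ))) := by
  induction u generalizing y with
  | nil =>
    rw [(coords_wordDiagram hn _).mem_support hn]
    refine and_congr_right fun hy => ?_
    constructor
    · rintro ⟨p, rfl⟩
      obtain ⟨j, hj1, hjn, m, rfl⟩ := exists_eq_val_add hn i p
      have e : (wordCoord (n := n) (List.map (shiftLetter i) []) ((i.val : ℤ) + j + m * n) y) =
          ((i.val + j : ℝ)) + m * n := by simp [wordCoord]
      rw [e, coe_add_mul]
      rcases lt_or_ge k j with hkj | hkj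
      · exact Or.inl ⟨j, hkj, hjn, rfl⟩
      · exact Or.inr ⟨j, ⟨hy, j, ⟨hj1, hkj⟩, rfl⟩, rfl⟩
    · rintro (⟨j, -, -, rfl⟩ | ⟨x, ⟨-, j, -, e⟩, rfl⟩)
      · exact ⟨i.val + j, by simp [wordCoord]⟩
      · exact ⟨i.val + j, by rw [show x = j from e]; simp [wordCoord]⟩
  | cons l u ih =>
    obtain ⟨hl, hlk⟩ := hu l (List.mem_cons_self ..)
    have hln : l < n := by omega
    rw [List.map_cons, wordDiagram]
    refine (mem_support_comp (ExtDiagram.elem hn (shiftLetter i l)) _ z y).trans ?_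
    rw [ih (fun l hl => hu l (List.mem_cons_of_mem _ hl)),
      (Coords.elem hn (shiftLetter i l)).mem_support hn]
    constructor
    · rintro (⟨hy, ⟨hy0, hy1⟩, p, rfl⟩ | ⟨hy, ⟨hy0, hy1⟩, ⟨j, hkj, hjn, rfl⟩ | ⟨x, hx, rfl⟩⟩)
      · refine ⟨⟨by linarith, by linarith⟩, ?_⟩
        obtain ⟨j, hj1, hjn, m, rfl⟩ := exists_eq_val_add hn i p
        rw [layer_shiftLetter hl hln hj1 hjn, coe_add_mul]
        rcases lt_or_ge k j with hkj | hkj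
        · refine Or.inl ⟨j, hkj, hjn, ?_⟩
          rw [if_neg (by omega), if_neg (by omega)]
        · exact Or.inr ⟨_, Or.inl ⟨⟨by linarith, hy⟩, j, ⟨hj1, hkj⟩, rfl⟩, rfl⟩
      · exact ⟨⟨by linarith, by linarith⟩, Or.inl ⟨j, hkj, hjn, rfl⟩⟩
      · exact ⟨⟨by linarith, by linarith⟩, Or.inr ⟨x, Or.inr ⟨⟨hy, by linarith⟩, hx⟩, rfl⟩⟩
    · rintro ⟨⟨hy0, hy1⟩, ⟨j, hkj, hjn, rfl⟩ | ⟨x, ⟨⟨hy, hy'⟩, j, ⟨hj1, hjk⟩, e⟩ | ⟨⟨hy, hy'⟩, hx⟩, rfl⟩⟩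
      · rcases le_total y (1 / 2) with hy | hy
        · refine Or.inl ⟨hy, ⟨by linarith, by linarith⟩, i.val + j + (0 : ℤ) * n, ?_⟩
          rw [layer_shiftLetter hl hln (by omega) hjn, coe_add_mul, if_neg (by omega),
            if_neg (by omega)]
        · exact Or.inr ⟨hy, ⟨by linarith, by linarith⟩, Or.inl ⟨j, hkj, hjn, rfl⟩⟩
      · refine Or.inl ⟨hy', ⟨by linarith, by linarith⟩, i.val + j + (0 : ℤ) * n, ?_⟩
        rw [layer_shiftLetter hl hln (by omega) (by omega), coe_add_mul]
        simp only at e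
        rw [e]
      · exact Or.inr ⟨hy, ⟨by linarith, by linarith⟩, Or.inr ⟨x, hx, rfl⟩⟩

/-- Diagrams of words in the letters that act on `k` neighbouring strands are related by a local
move, whose rectangle has the height of the cylinder. -/
theorem localMove_wordDiagram {n k : ℕ} (hn : 3 ≤ n) (hk : k ≤ n) (i : Fin n) {u v : List ℕ}
    (hu : ∀ l ∈ u, 1 ≤ l ∧ l < k) (hv : ∀ l ∈ v, 1 ≤ l ∧ l < k) :
    LocalMove k u v (wordDiagram hn (u.map (shiftLetter i))).1
      (wordDiagram hn (v.map (shiftLetter i))).1 := by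
  have hk' : (k : ℝ) ≤ n := by exact_mod_cast hk
  refine ⟨i.val, 1, 0, 1, one_pos, by linarith, le_rfl, one_pos, by norm_num, ?_, ?_⟩
  · rintro ⟨z, y⟩ hz
    have key : ∀ u : List ℕ, (∀ l ∈ u, 1 ≤ l ∧ l < k) → ¬ ∃ x : ℝ, (x, y) ∈ planarPicture k u ∧
        z = ((i.val + x : ℝ) : AddCircle (n : ℝ)) := by
      rintro u hu ⟨x, hx, rfl⟩
      obtain ⟨h1, h2, h3⟩ := planarPicture_bounds hu hx
      exact hz ⟨(x, y), ⟨⟨by linarith, by linarith⟩, h1⟩, by simp⟩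
    rw [mem_support_wordDiagram hn hk i hu, mem_support_wordDiagram hn hk i hv]
    simp only [key u hu, key v hv]
  · rintro ⟨x, y⟩ ⟨⟨hx1, hx2⟩, hy⟩
    simp only at hx1 hx2
    have key : ∀ u : List ℕ, (∀ l ∈ u, 1 ≤ l ∧ l < k) →
        ((((i.val + 1 * x : ℝ) : AddCircle (n : ℝ)), 0 + 1 * y) ∈
          (wordDiagram hn (u.map (shiftLetter i))).1.support ↔ (x, y) ∈ planarPicture k u) := by
      intro u hu
      rw [one_mul, one_mul, zero_add, mem_support_wordDiagram hn hk i hu]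
      have small : ∀ m : ℤ, ∀ d : ℝ, d = m * n → -n < d → d < n → m = 0 := by
        intro m d e h1 h2
        have hn0 : (0 : ℝ) < n := by linarith [show (3 : ℝ) ≤ n by exact_mod_cast hn]
        by_contra hm
        rcases lt_or_gt_of_ne hm with h | h
        · have : (m : ℝ) ≤ -1 := by exact_mod_cast (by omega : m ≤ -1)
          nlinarith
        · have : (1 : ℝ) ≤ m := by exact_mod_cast (by omega : 1 ≤ m)
          nlinarith
      constructor
      · rintro ⟨-, ⟨j, hkj, hjn, e⟩ | ⟨x', hx', e⟩⟩ <;> obtain ⟨m, hm⟩ := coe_eq_coe e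
        · exfalso
          have h1 : (k : ℝ) + 1 ≤ j := by exact_mod_cast hkj
          have h2 : (j : ℝ) ≤ n := by exact_mod_cast hjn
          rw [small m _ hm (by linarith) (by linarith)] at hm
          push_cast at hm
          linarith
        · obtain ⟨-, h2, h3⟩ := planarPicture_bounds hu hx'
          simp only at h2 h3
          rw [small m _ hm (by linarith) (by linarith)] at hm
          have : x = x' := by push_cast at hm; linarith
          rwa [this]
      · exact fun h => ⟨hy, Or.inr ⟨x, h, rfl⟩⟩
    exact ⟨key u hu, key v hv⟩

/-- The monoid homomorphism from the presented monoid to the monoid of diagrams. -/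
noncomputable def toDC {n : ℕ} (hn : 3 ≤ n) : CMonoid n →* DC hn :=
  PresentedMonoid.lift (fun i => DC.mk (Diagram.elem hn i)) (by
    have word : ∀ u : List (Fin n), DC.mk (wordDiagram hn u) =
        (u.map fun i => DC.mk (Diagram.elem hn i)).prod := by
      intro u
      induction u with
      | nil => rfl
      | cons i u ih => rw [List.map_cons, List.prod_cons, ← ih]; rfl
    intro a b h
    cases h with
    | idem i =>
      have : DC.mk (wordDiagram hn [i, i]) = DC.mk (wordDiagram hn [i]) :=
        Quot.sound (Or.inr (Or.inl (localMove_wordDiagram hn (k := 2) (by omega) i (u := [1, 1])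
          (v := [1]) (by simp) (by simp))))
      rw [word, word] at this
      simpa using this
    | far i j h₁ h₂ =>
      have := IsotopyClass.dc_mk_eq ((CommEq.swap [] (far_of_lt h₁ h₂)).mk_wordDiagram_eq hn)
      rw [word, word] at this
      simpa using this
    | braid i =>
      have : DC.mk (wordDiagram hn [i, nxt i, i]) = DC.mk (wordDiagram hn [nxt i, i, nxt i]) :=
        Quot.sound (Or.inr (Or.inr (Or.inl
          (localMove_wordDiagram hn hn i (u := [1, 2, 1]) (v := [2, 1, 2]) (by simp) (by simp)))))
      rw [word, word] at this
      simpa [mul_assoc] using this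
    | kiselman i =>
      have : DC.mk (wordDiagram hn [nxt i, i, nxt i]) = DC.mk (wordDiagram hn [i, nxt i]) :=
        Quot.sound (Or.inr (Or.inr (Or.inr
          (localMove_wordDiagram hn hn i (u := [2, 1, 2]) (v := [1, 2]) (by simp) (by simp)))))
      rw [word, word] at this
      simpa [mul_assoc] using this)

theorem toDC_ofWord {n : ℕ} (hn : 3 ≤ n) (w : List (Fin n)) :
    toDC hn (ofWord w) = DC.mk (wordDiagram hn w) := by
  induction w with
  | nil => rfl
  | cons i u ih => rw [ofWord_cons, map_mul, ih]; rfl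

/-! ### Descending paths and local moves -/

/-- The point `(x, y)` of the universal cover of the cylinder lies on a strand. -/
def ExtDiagram.Covers {n : ℕ} (D : ExtDiagram n) (x y : ℝ) : Prop :=
  ((x : AddCircle (n : ℝ)), y) ∈ D.support

theorem covers_pos {n : ℕ} (D : ExtDiagram n) (s : Fin n × ℤ) (t : I) :
    D.Covers (D.pos s t).1 (D.pos s t).2 := by
  refine mem_support_iff.2 ⟨s.1, t, ?_⟩
  rw [← D.coe_pos s t]
  exact ⟨rfl, rfl⟩

theorem ExtDiagram.Covers.exists_pos {n : ℕ} {D : ExtDiagram n} {x y : ℝ} (h : D.Covers x y) :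
    ∃ s t, (D.pos s t).1 = x ∧ ((D.pos s t).2 : ℝ) = y := by
  obtain ⟨i, t, h1, h2⟩ := mem_support_iff.1 h
  rw [← D.coe_lift] at h1
  obtain ⟨m, hm⟩ := coe_eq_coe h1.symm
  exact ⟨(i, m), t, by simp only [ExtDiagram.pos]; linarith, h2⟩

theorem height_surjective {n : ℕ} (D : ExtDiagram n) (i : Fin n) :
    Function.Surjective fun t => (D.toFun (i, t)).2 := by
  intro y
  have c : Continuous fun t => (D.toFun (i, t)).2 :=
    (D.continuous_toFun.comp (Continuous.prodMk continuous_const continuous_id)).snd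
  exact mem_range_of_exists_le_of_exists_ge c ⟨0, by rw [D.height_zero]; exact y.2.1⟩
    ⟨1, by rw [D.height_one]; exact y.2.2⟩

/-- A lifted strand is the graph of a function of the height. -/
theorem ExtDiagram.exists_graph {n : ℕ} (D : ExtDiagram n) (s : Fin n × ℤ) :
    ∃ X : ℝ → ℝ, Continuous X ∧ (∀ y ∈ I, D.Covers (X y) y) ∧
      ∀ t, X (D.pos s t).2 = (D.pos s t).1 := by
  let e := (D.height_strictMono s.1).orderIsoOfSurjective _ (height_surjective D s.1)
  have key : ∀ t, e.symm (D.pos s t).2 = t := fun t => e.symm_apply_apply t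
  have hX : ∀ t, (D.pos s (e.symm (Set.projIcc 0 1 zero_le_one ((D.pos s t).2 : ℝ)))).1 =
      (D.pos s t).1 := fun t => by rw [Set.projIcc_val, key]
  refine ⟨fun y => (D.pos s (e.symm (Set.projIcc 0 1 zero_le_one y))).1, ?_, ?_, hX⟩
  · exact ((D.continuous_pos s).comp (e.symm.continuous.comp continuous_projIcc)).fst
  · intro y hy
    dsimp only
    rw [Set.projIcc_of_mem _ hy]
    have h := covers_pos D s (e.symm ⟨y, hy⟩)
    rwa [show (D.pos s (e.symm ⟨y, hy⟩)).2 = ⟨y, hy⟩ from e.apply_symm_apply _] at h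

/-- There is a descending path from the point `p` of the upper boundary of the universal cover to a
point `≤ x` of the lower boundary that runs along the strands. At a double point a path may pass
from one strand to the other. -/
def LeftReach {n : ℕ} (D : ExtDiagram n) (p x : ℤ) : Prop :=
  ∃ γ : ℝ → ℝ, Continuous γ ∧ (∀ y ∈ I, D.Covers (γ y) y) ∧ γ 1 = p ∧ γ 0 ≤ x

/-- There is a descending path from `(a, 1)` to `(b, 0)` in a planar picture. -/
def PicturePath (k : ℕ) (u : List ℕ) (a b : ℕ) : Prop :=
  ∃ δ : ℝ → ℝ, Continuous δ ∧ (∀ y ∈ I, (δ y, y) ∈ planarPicture k u) ∧ δ 1 = a ∧ δ 0 = b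

theorem picturePath_nil {k a : ℕ} (h₁ : 1 ≤ a) (hk : a ≤ k) : PicturePath k [] a a :=
  ⟨fun _ => a, continuous_const, fun _ hy => ⟨hy, a, ⟨h₁, hk⟩, rfl⟩, rfl, rfl⟩

/-- A path in a planar picture is prolonged through a new lowest layer. From the right one of the
crossing strands it goes to the lower left; from the left one it goes to the crossing and returns.
-/
theorem PicturePath.cons {k : ℕ} {u : List ℕ} {a b : ℕ} (h : PicturePath k u a b) {l : ℕ}
    (hl : 1 ≤ l) (hlk : l < k) (hb₁ : 1 ≤ b) (hbk : b ≤ k) {b' : ℕ}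
    (hb' : b' = if b = l + 1 then l else b) : PicturePath k (l :: u) a b' := by
  obtain ⟨δ, hδ, hc, h1, h0⟩ := h
  -- a path in the lowest layer
  obtain ⟨e, he, hce, he1, he0⟩ : ∃ e : ℝ → ℝ, Continuous e ∧ (∀ y ∈ I, ∃ j : ℕ, (1 ≤ j ∧ j ≤ k) ∧
      e y = if j = l then j + y else if j = l + 1 then j - y else (j : ℝ)) ∧ e 1 = b ∧ e 0 = b' := by
    by_cases c1 : b = l + 1
    · rw [if_pos c1] at hb'
      subst hb' c1
      exact ⟨fun y => b' + y, by fun_prop, fun y _ => ⟨b', ⟨hl, hlk.le⟩, (if_pos rfl).symm⟩,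
        by push_cast; ring, by simp⟩
    rw [if_neg c1] at hb'
    subst hb'
    by_cases c2 : b' = l
    · subst c2
      refine ⟨fun y => min (b' + y) (b' + 1 - y), by fun_prop, fun y _ => ?_, by simp, by simp⟩
      rcases le_total ((b' : ℝ) + y) (b' + 1 - y) with hle | hle
      · exact ⟨b', ⟨hl, hlk.le⟩, by rw [if_pos rfl]; exact min_eq_left hle⟩
      · refine ⟨b' + 1, ⟨by omega, hlk⟩, ?_⟩
        rw [if_neg (by omega), if_pos rfl]
        push_cast
        exact min_eq_right hle
    · exact ⟨fun _ => b', continuous_const, fun y _ => ⟨b', ⟨hb₁, hbk⟩, by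
        rw [if_neg c2, if_neg c1]⟩, rfl, rfl⟩
  refine ⟨fun y => if y ≤ 1 / 2 then e (2 * y) else δ (2 * y - 1), ?_, ?_, ?_, ?_⟩
  · refine Continuous.if_le (by fun_prop) (by fun_prop) continuous_id continuous_const ?_
    intro y hy
    change y = 1 / 2 at hy
    subst hy
    norm_num [he1, h0]
  · rintro y ⟨hy0, hy1⟩
    dsimp only
    split_ifs with hy
    · exact Or.inl ⟨⟨hy0, hy⟩, hce (2 * y) ⟨by linarith, by linarith⟩⟩
    · exact Or.inr ⟨⟨by linarith, hy1⟩, hc (2 * y - 1) ⟨by linarith, by linarith⟩⟩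
  · norm_num [h1]
  · norm_num [he0]

theorem exists_nat_of_mem_top {k : ℕ} {u : List ℕ} {x : ℝ} (h : (x, (1 : ℝ)) ∈ planarPicture k u) :
    ∃ j : ℕ, (1 ≤ j ∧ j ≤ k) ∧ x = j := by
  induction u with
  | nil => exact h.2
  | cons l u ih =>
    rcases h with ⟨⟨-, h⟩, -⟩ | ⟨-, h⟩
    · norm_num at h
    · norm_num at h
      exact ih h

/-- All points of the upper boundary of a planar picture are joined with the leftmost point of the
lower boundary. -/
structure LeftConnected (k : ℕ) (u : List ℕ) : Prop where
  letter_mem : ∀ l ∈ u, 1 ≤ l ∧ l < k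
  path : ∀ a, 1 ≤ a → a ≤ k → PicturePath k u a 1

theorem leftConnected_one : LeftConnected 2 [1] where
  letter_mem := by simp
  path a h1 h2 := by
    refine ((picturePath_nil h1 h2).cons le_rfl (by omega) h1 h2 (b' := 1) ?_)
    interval_cases a <;> rfl

theorem leftConnected_one_one : LeftConnected 2 [1, 1] where
  letter_mem := by simp
  path a h1 h2 := (leftConnected_one.path a h1 h2).cons le_rfl (by omega) le_rfl (by omega) rfl

theorem leftConnected_one_two : LeftConnected 3 [1, 2] where
  letter_mem := by simp
  path a h1 h2 := by
    refine ((picturePath_nil h1 h2).cons (l := 2) (by omega) (by omega) h1 h2 rfl).cons le_rfl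
      (by omega) ?_ ?_ ?_ <;> interval_cases a <;> norm_num

theorem leftConnected_two_one_two : LeftConnected 3 [2, 1, 2] where
  letter_mem := by simp
  path a h1 h2 :=
    (leftConnected_one_two.path a h1 h2).cons (by omega) (by omega) le_rfl (by omega) rfl

theorem leftConnected_one_two_one : LeftConnected 3 [1, 2, 1] where
  letter_mem := by simp
  path a h1 h2 := by
    refine (((picturePath_nil h1 h2).cons (l := 1) (by omega) (by omega) h1 h2 rfl).cons (l := 2)
      (by omega) (by omega) ?_ ?_ rfl).cons le_rfl (by omega) ?_ ?_ ?_ <;>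
      interval_cases a <;> norm_num

/-- A continuous function that does not take values near the boundary of an interval stays inside
or outside. -/
theorem mem_Icc_of_gap {f : ℝ → ℝ} (hf : Continuous f) {s : Set ℝ} (hs : s.OrdConnected)
    {a a' b' b : ℝ} (ha : a < a') (hb : b' < b)
    (hgap : ∀ y ∈ s, f y ∈ Set.Icc a b → f y ∈ Set.Icc a' b') {y z : ℝ} (hy : y ∈ s) (hz : z ∈ s)
    (h : f y ∈ Set.Icc a b) : f z ∈ Set.Icc a' b' := by
  have h' := hgap y hy h
  refine hgap z hz ?_
  have hsub := hs.uIcc_subset hy hz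
  by_contra hcon
  have ivt := intermediate_value_uIcc (a := y) (b := z) (f := f) hf.continuousOn
  rcases lt_or_ge (f z) a with hlt | hge
  · obtain ⟨w, hw, e⟩ := ivt (Set.mem_uIcc.2 (Or.inr ⟨hlt.le, h.1⟩))
    have := (hgap w (hsub hw) (by rw [e]; exact ⟨le_rfl, h.1.trans h.2⟩)).1
    rw [e] at this
    linarith
  · have hlt : b < f z := by
      by_contra hle
      exact hcon ⟨hge, not_lt.1 hle⟩
    obtain ⟨w, hw, e⟩ := ivt (Set.mem_uIcc.2 (Or.inl ⟨h.2, hlt.le⟩))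
    have := (hgap w (hsub hw) (by rw [e]; exact ⟨h.1.trans h.2, le_rfl⟩)).2
    rw [e] at this
    linarith

/-- A path that crosses the rectangle of a local move along the old picture is replaced by a path
along the new picture to the lower left corner, and below the rectangle by the leftmost of the
old path and of the strand that ends in this corner. -/
theorem LeftReach.of_localMove {n k : ℕ} {u v : List ℕ} {D D' : ExtDiagram n} {p x : ℤ}
    (hr : LeftReach D p x) (hk : 1 ≤ k) (h : LocalMove k u v D D') (hu : LeftConnected k u)
    (hv : LeftConnected k v) : LeftReach D' p x := by
  obtain ⟨x₀, c, y₀, h, hc, hcn, hy, hh, hyh, hout, hin⟩ := h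
  obtain ⟨γ, hγ, hcov, hγ1, hγ0⟩ := hr
  have hk' : (1 : ℝ) ≤ k := by exact_mod_cast hk
  -- the supports agree outside of the rectangle
  have hout' : ∀ a y, (∀ m : ℤ, ∀ q : ℝ, 3 / 4 ≤ q → q ≤ k + 1 / 4 → y₀ ≤ y → y ≤ y₀ + h →
      a ≠ x₀ + c * q + m * n) → (D.Covers a y ↔ D'.Covers a y) := by
    intro a y hay
    refine hout _ ?_
    rintro ⟨⟨q, w⟩, ⟨⟨hq1, hq2⟩, hw1, hw2⟩, e⟩
    simp only at hq1 hq2 hw1 hw2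
    rw [Prod.mk.injEq] at e
    obtain ⟨m, hm⟩ := coe_eq_coe e.1.symm
    refine hay m q hq1 hq2 ?_ ?_ (by linarith)
    · rw [← e.2]
      have := mul_nonneg hh.le hw1
      simp only
      linarith
    · rw [← e.2]
      have := mul_le_mul_of_nonneg_left hw2 hh.le
      simp only
      linarith
  have hin' : ∀ (m : ℤ) (q y : ℝ), 3 / 4 ≤ q → q ≤ k + 1 / 4 → y₀ ≤ y → y ≤ y₀ + h →
      (D.Covers (x₀ + c * q + m * n) y ↔ (q, (y - y₀) / h) ∈ planarPicture k u) ∧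
      (D'.Covers (x₀ + c * q + m * n) y ↔ (q, (y - y₀) / h) ∈ planarPicture k v) := by
    intro m q y h1 h2 h3 h4
    have := hin (q, (y - y₀) / h) ⟨⟨h1, h2⟩, div_nonneg (by linarith) hh.le,
      (div_le_one hh).2 (by linarith)⟩
    simp only [mul_div_cancel₀ _ hh.ne', add_sub_cancel] at this
    simp only [ExtDiagram.Covers, coe_add_mul]
    exact this
  -- the path either stays in a lift of the rectangle or does not meet it
  have hstay : ∀ m : ℤ, ∀ y ∈ Set.Icc y₀ (y₀ + h), ∀ z ∈ Set.Icc y₀ (y₀ + h), ∀ q : ℝ, 3 / 4 ≤ q →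
      q ≤ k + 1 / 4 → γ y = x₀ + c * q + m * n →
      γ z ∈ Set.Icc (x₀ + c * 1 + m * n) (x₀ + c * k + m * n) := by
    intro m y hy' z hz q hq1 hq2 hq
    refine mem_Icc_of_gap hγ Set.ordConnected_Icc (a := x₀ + c * (3 / 4) + m * n)
      (b := x₀ + c * (k + 1 / 4) + m * n) (by linarith) (by linarith) ?_ hy' hz
      ⟨by rw [hq]; gcongr, by rw [hq]; gcongr⟩
    rintro w hw ⟨hw1, hw2⟩
    obtain ⟨q, hq⟩ : ∃ q, γ w = x₀ + c * q + m * n :=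
      ⟨(γ w - x₀ - m * n) / c, by rw [mul_div_cancel₀ _ hc.ne']; ring⟩
    rw [hq] at hw1 hw2 ⊢
    have hq1 : 3 / 4 ≤ q := le_of_mul_le_mul_left (by linarith) hc
    have hq2 : q ≤ k + 1 / 4 := le_of_mul_le_mul_left (by linarith) hc
    have hm := (hin' m q w hq1 hq2 hw.1 hw.2).1.1
      (hq ▸ hcov w ⟨hy.trans hw.1, hw.2.trans hyh⟩)
    obtain ⟨-, b1, b2⟩ := planarPicture_bounds hu.letter_mem hm
    simp only at b1 b2
    constructor <;> gcongr
  -- Paths that do not enter the rectangle are not affected by the move.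
  by_cases hbox : ∃ m : ℤ, ∃ q : ℝ, 3 / 4 ≤ q ∧ q ≤ k + 1 / 4 ∧ γ (y₀ + h) = x₀ + c * q + m * n
  swap
  · refine ⟨γ, hγ, fun y hyI => (hout' _ _ ?_).1 (hcov y hyI), hγ1, hγ0⟩
    intro m q hq1 hq2 hy1 hy2 e
    obtain ⟨b1, b2⟩ := hstay m y ⟨hy1, hy2⟩ (y₀ + h) ⟨by linarith, le_rfl⟩ q hq1 hq2 e
    obtain ⟨q', hq'⟩ : ∃ q, γ (y₀ + h) = x₀ + c * q + m * n :=
      ⟨(γ (y₀ + h) - x₀ - m * n) / c, by rw [mul_div_cancel₀ _ hc.ne']; ring⟩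
    rw [hq'] at b1 b2
    have h1 : 1 ≤ q' := le_of_mul_le_mul_left (by linarith) hc
    have h2 : q' ≤ k := le_of_mul_le_mul_left (by linarith) hc
    exact hbox ⟨m, q', by linarith, by linarith, hq'⟩
  obtain ⟨m, q, hq1, hq2, hq⟩ := hbox
  have htop := ((hin' m q (y₀ + h) hq1 hq2 (by linarith) le_rfl).1.1 (hq ▸ hcov _ ⟨by linarith, hyh⟩))
  rw [add_sub_cancel_left, div_self hh.ne'] at htop
  obtain ⟨j, ⟨hj1, hjk⟩, rfl⟩ := exists_nat_of_mem_top htop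
  obtain ⟨δ, hδ, hδm, hδ1, hδ0⟩ := hv.path j hj1 hjk
  obtain ⟨ε, -, hεm, -, hε0⟩ := hu.path j hj1 hjk
  have hcorner : D.Covers (x₀ + c * 1 + m * n) y₀ := by
    rw [(hin' m 1 y₀ (by norm_num) (by linarith) le_rfl (by linarith)).1, sub_self, zero_div]
    have := hεm 0 ⟨le_rfl, zero_le_one⟩
    rw [hε0] at this
    exact_mod_cast this
  -- `X` is the strand through the lower left corner of the rectangle, where the new path leaves
  -- it.
  obtain ⟨s, t, h1, h2⟩ := hcorner.exists_pos
  obtain ⟨X, hX, hXc, hXs⟩ := D.exists_graph s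
  have hXy : X y₀ = x₀ + c * 1 + m * n := by rw [← h2, hXs, h1]
  have hγy : x₀ + c * 1 + m * n ≤ γ y₀ :=
    (hstay m (y₀ + h) ⟨by linarith, le_rfl⟩ y₀ ⟨le_rfl, by linarith⟩ _ hq1 hq2 hq).1
  have hmin : min (X y₀) (γ y₀) = x₀ + c * 1 + m * n := by rw [hXy, min_eq_left hγy]
  refine ⟨fun y => if y ≤ y₀ then min (X y) (γ y) else
    if y ≤ y₀ + h then x₀ + c * δ ((y - y₀) / h) + m * n else γ y, ?_, ?_, ?_, ?_⟩
  · refine Continuous.if_le (by fun_prop) (Continuous.if_le (by fun_prop) hγ continuous_id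
      continuous_const ?_) continuous_id continuous_const ?_
    · intro y hy
      change y = y₀ + h at hy
      rw [hy, add_sub_cancel_left, div_self hh.ne', hδ1, hq]
    · intro y hy
      change y = y₀ at hy
      rw [hy, hmin, if_pos (by linarith), sub_self, zero_div, hδ0]
      push_cast
      rfl
  · rintro y hyI
    dsimp only
    split_ifs with c1 c2
    · rcases c1.eq_or_lt with rfl | c1
      · rw [hmin, (hin' m 1 y (by norm_num) (by linarith) le_rfl (by linarith)).2, sub_self,
          zero_div]
        have := hδm 0 ⟨le_rfl, zero_le_one⟩
        rw [hδ0] at this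
        exact_mod_cast this
      · rw [← hout' _ _ fun m q _ _ hle => absurd c1 (not_lt.2 hle)]
        rcases min_choice (X y) (γ y) with e | e <;> rw [e]
        exacts [hXc y hyI, hcov y hyI]
    · rw [not_le] at c1
      have hm := hδm ((y - y₀) / h) ⟨div_nonneg (by linarith) hh.le,
        (div_le_one hh).2 (by linarith)⟩
      obtain ⟨-, b1, b2⟩ := planarPicture_bounds hv.letter_mem hm
      simp only at b1 b2
      rwa [(hin' m _ y (by linarith) (by linarith) c1.le c2).2]
    · rw [← hout' _ _ fun m q _ _ _ hle => absurd hle c2]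
      exact hcov y hyI
  · dsimp only
    rw [if_neg (by linarith)]
    split_ifs with c2
    · have e : y₀ + h = 1 := le_antisymm hyh c2
      rw [← e, add_sub_cancel_left, div_self hh.ne', hδ1, ← hq, e, hγ1]
    · exact hγ1
  · dsimp only
    rw [if_pos hy]
    exact (min_le_right _ _).trans hγ0

theorem LocalMove.symm {n k : ℕ} {u v : List ℕ} {D D' : ExtDiagram n} (h : LocalMove k u v D D') :
    LocalMove k v u D' D := by
  obtain ⟨x₀, c, y₀, h, hc, hcn, hy, hh, hyh, hout, hin⟩ := h
  exact ⟨x₀, c, y₀, h, hc, hcn, hy, hh, hyh, fun z hz => (hout z hz).symm,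
    fun p hp => (hin p hp).symm⟩

theorem LocalMove.leftReach_iff {n k : ℕ} {u v : List ℕ} {D D' : ExtDiagram n}
    (h : LocalMove k u v D D') (hk : 1 ≤ k) (hu : LeftConnected k u) (hv : LeftConnected k v)
    (p x : ℤ) : LeftReach D p x ↔ LeftReach D' p x :=
  ⟨fun hr => hr.of_localMove hk h hu hv, fun hr => hr.of_localMove hk h.symm hv hu⟩

/-! ### Climbing along strands and isotopies -/

section

open Filter Topology

/-- From a point of a lifted strand one may climb along the strand, or pass to another strand at a
double point. -/
def ClimbStep {n : ℕ} (D : ExtDiagram n) (a b : (Fin n × ℤ) × I) : Prop :=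
  (a.1 = b.1 ∧ a.2 ≤ b.2) ∨ D.pos a.1 a.2 = D.pos b.1 b.2

/-- Points of lifted strands that can be reached by climbing. -/
abbrev Climb {n : ℕ} (D : ExtDiagram n) : (Fin n × ℤ) × I → (Fin n × ℤ) × I → Prop :=
  Relation.ReflTransGen (ClimbStep D)

/-- A climb gives a path that runs along the strands. -/
theorem Climb.exists_path {n : ℕ} {D : ExtDiagram n} {s : Fin n × ℤ} {b : (Fin n × ℤ) × I}
    (h : Climb D (s, 0) b) : ∃ γ : ℝ → ℝ, Continuous γ ∧
      (∀ y ∈ I, y ≤ (D.pos b.1 b.2).2 → D.Covers (γ y) y) ∧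
      γ (D.pos b.1 b.2).2 = (D.pos b.1 b.2).1 ∧ γ 0 = (D.pos s 0).1 := by
  induction h with
  | refl =>
    obtain ⟨X, hX, hc, hs⟩ := D.exists_graph s
    refine ⟨X, hX, fun y hy _ => hc y hy, hs 0, ?_⟩
    have := hs 0
    rwa [show (D.pos s 0).2 = 0 from D.height_zero s.1] at this
  | @tail b c _ hbc ih =>
    obtain ⟨γ, hγ, hcov, h1, h0⟩ := ih
    rcases hbc with ⟨e, hle⟩ | e
    · obtain ⟨s', t⟩ := b
      obtain ⟨s'', t'⟩ := c
      obtain rfl : s' = s'' := e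
      simp only at hle h1 hcov ⊢
      obtain ⟨X, hX, hc, hs⟩ := D.exists_graph s'
      refine ⟨fun y => if y ≤ (D.pos s' t).2 then γ y else X y, ?_, ?_, ?_, ?_⟩
      · refine Continuous.if_le hγ hX continuous_id continuous_const ?_
        intro y hy
        change y = _ at hy
        rw [hy, h1, hs]
      · intro y hy hy'
        dsimp only
        split_ifs with h
        exacts [hcov y hy h, hc y hy]
      · dsimp only
        split_ifs with h
        · have : t = t' := le_antisymm hle ((D.pos_strictMono s').le_iff_le.1 h)
          rw [← this, h1]
        · exact hs t'
      · dsimp only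
        rw [if_pos (D.pos s' t).2.2.1, h0]
    · exact ⟨γ, hγ, by rwa [e] at hcov, by rwa [e] at h1, h0⟩

theorem isClosed_liftedStrand {n : ℕ} (D : ExtDiagram n) (s : Fin n × ℤ) :
    IsClosed (D.liftedStrand s) :=
  (isCompact_range (D.continuous_pos s)).isClosed

/-- Near a point of the universal cover there are only finitely many lifted strands, since the
lifts of the `n` strands are bounded. -/
theorem locallyFinite_liftedStrand {n : ℕ} (D : ExtDiagram n) : LocallyFinite D.liftedStrand := by
  have hc : Continuous fun x : Fin n × I => D.lift x.1 x.2 := by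
    rw [continuous_prod_of_discrete_left]
    exact fun i => (D.lift i).continuous
  obtain ⟨B, hB⟩ := (isCompact_univ (X := Fin n × I)).exists_bound_of_continuousOn hc.continuousOn
  rintro ⟨x, y⟩
  refine ⟨Metric.ball x 1 ×ˢ Set.univ, prod_mem_nhds (Metric.ball_mem_nhds x one_pos) univ_mem, ?_⟩
  obtain ⟨N, hN⟩ := exists_nat_gt (|x| + 1 + B)
  refine ((Set.finite_univ (α := Fin n)).prod (Set.finite_Icc (-(N : ℤ)) N)).subset ?_
  rintro ⟨i, m⟩ ⟨_, ⟨t, rfl⟩, ht, -⟩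
  refine ⟨Set.mem_univ _, ?_⟩
  have h1 := hB (i, t) (Set.mem_univ _)
  have h2 : |D.lift i t + m * n - x| < 1 := ht
  have hn : (1 : ℝ) ≤ n := by exact_mod_cast (i.pos : 0 < n)
  rw [Real.norm_eq_abs] at h1
  have h3 : |(m : ℝ) * n| < N := by
    rw [abs_lt] at h2
    rw [abs_le] at h1
    have := neg_abs_le x
    have := le_abs_self x
    rw [abs_lt]
    constructor <;> linarith
  have h4 : |(m : ℝ)| < N := by
    rw [abs_mul, Nat.abs_cast] at h3
    exact lt_of_le_of_lt (le_mul_of_one_le_right (abs_nonneg _) hn) h3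
  have h5 := abs_lt.1 h4
  exact ⟨by exact_mod_cast h5.1.le, by exact_mod_cast h5.2.le⟩

/-- A path that runs along the strands can be replaced by a climb. The heights up to which this is
possible form a closed set, and a climb to a height can be continued beyond it because the strands
near a point pass through this point, by local finiteness. -/
theorem climb_of_path {n : ℕ} {D : ExtDiagram n} {γ : ℝ → ℝ} (hγ : Continuous γ)
    (hcov : ∀ y ∈ I, D.Covers (γ y) y) :
    ∃ s s', Climb D (s, 0) (s', 1) ∧ (D.pos s 0).1 = γ 0 ∧ (D.pos s' 1).1 = γ 1 := by
  let f : I → ℝ × I := fun y => (γ y, y)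
  have hf : Continuous f := (hγ.comp continuous_subtype_val).prodMk continuous_id
  have hex : ∀ y, ∃ s t, D.pos s t = f y := fun y => by
    obtain ⟨s, t, h1, h2⟩ := (hcov y y.2).exists_pos
    exact ⟨s, t, Prod.ext h1 (Subtype.ext h2)⟩
  -- strands through nearby points of the path pass through the given point
  have hloc : ∀ y, ∀ᶠ w in 𝓝 y, ∀ s t, D.pos s t = f w → ∃ t', D.pos s t' = f y := by
    intro y
    filter_upwards [hf.continuousAt.eventually ((locallyFinite_liftedStrand D).eventually_subset
      (isClosed_liftedStrand D) (f y))] with w hw s t h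
    exact hw (show f w ∈ D.liftedStrand s from ⟨t, h⟩)
  have hle : ∀ {s t t' y w}, D.pos s t = f y → D.pos s t' = f w → y ≤ w → t ≤ t' := by
    intro s t t' y w h h' hyw
    rw [← (D.pos_strictMono s).le_iff_le]
    simp only [h, h']
    exact hyw
  obtain ⟨s₀, t₀, h₀⟩ := hex 0
  obtain rfl : t₀ = 0 := (D.pos_strictMono s₀).injective (by
    simp only [h₀, show (D.pos s₀ 0).2 = 0 from D.height_zero s₀.1]
    rfl)
  let S : Set I := {y | ∀ z ≤ y, ∃ s t, D.pos s t = f z ∧ Climb D (s₀, 0) (s, t)}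
  have h0S : (0 : I) ∈ S := by
    intro z hz
    obtain rfl : z = 0 := le_antisymm hz z.2.1
    exact ⟨s₀, 0, h₀, .refl⟩
  have hS : Set.Icc (0 : I) 1 ⊆ S := by
    refine IsClosed.Icc_subset_of_forall_mem_nhdsWithin ?_ h0S ?_
    · rw [show Set.Icc (0 : I) 1 = Set.univ from Set.Icc_bot_top, Set.inter_univ]
      refine isClosed_of_closure_subset fun y hy z hz => ?_
      rw [mem_closure_iff_frequently] at hy
      rcases hz.lt_or_eq with hzy | rfl
      · obtain ⟨w, hw, hzw⟩ := (hy.and_eventually (lt_mem_nhds hzy)).exists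
        exact hw z hzw.le
      · obtain ⟨w, hw, hzw⟩ := (hy.and_eventually (hloc z)).exists
        rcases le_total z w with hle' | hle'
        · exact hw z hle'
        · obtain ⟨s, t, h, hc⟩ := hw w le_rfl
          obtain ⟨t', h'⟩ := hzw s t h
          exact ⟨s, t', h', hc.tail (Or.inl ⟨rfl, hle h h' hle'⟩)⟩
    · rintro y ⟨hy, -, hy1⟩
      obtain ⟨s, t, h, hc⟩ := hy y le_rfl
      -- climb from the height `y` to the height `w` on a strand through the point of height `w`
      have hnear : ∀ᶠ w in 𝓝[>] y, ∀ z, y ≤ z → z ≤ w →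
          ∃ s t, D.pos s t = f z ∧ Climb D (s₀, 0) (s, t) := by
        obtain ⟨u, hu, hsub⟩ := exists_Ico_subset_of_mem_nhds (hloc y) ⟨1, hy1⟩
        filter_upwards [Ioo_mem_nhdsGT hu] with w hw z hz hzw
        obtain ⟨s', t', h'⟩ := hex z
        obtain ⟨t'', h''⟩ := hsub ⟨hz, hzw.trans_lt hw.2⟩ s' t' h'
        have hle' := hle h'' h' hz
        have c1 : ClimbStep D (s, t) (s', t'') := Or.inr (h.trans h''.symm)
        have c2 : ClimbStep D (s', t'') (s', t') := Or.inl ⟨rfl, hle'⟩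
        exact ⟨s', t', h', (hc.tail c1).tail c2⟩
      filter_upwards [hnear] with w hw z hz
      rcases le_total z y with hzy | hzy
      · exact hy z hzy
      · exact hw z hzy hz
  obtain ⟨s, t, h, hc⟩ := hS (Set.right_mem_Icc.2 zero_le_one) 1 le_rfl
  obtain rfl : t = 1 := (D.pos_strictMono s).injective (by
    simp only [h, show (D.pos s 1).2 = 1 from D.height_one s.1]
    rfl)
  exact ⟨s₀, s, hc, congrArg Prod.fst h₀, congrArg Prod.fst h⟩

end

/-- The combinatorial description of the descending paths. -/
theorem leftReach_iff_climb {n : ℕ} {D : ExtDiagram n} {p x : ℤ} : LeftReach D p x ↔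
    ∃ s s', Climb D (s, 0) (s', 1) ∧ (D.pos s 0).1 ≤ x ∧ (D.pos s' 1).1 = p := by
  constructor
  · rintro ⟨γ, hγ, hcov, h1, h0⟩
    obtain ⟨s, s', h, e, e'⟩ := climb_of_path hγ hcov
    exact ⟨s, s', h, e ▸ h0, e'.trans h1⟩
  · rintro ⟨s, s', h, h0, h1⟩
    obtain ⟨γ, hγ, hcov, e1, e0⟩ := h.exists_path
    have e : (D.pos s' 1).2 = 1 := D.height_one s'.1
    simp only [e] at hcov e1
    exact ⟨γ, hγ, fun y hy => hcov y hy hy.2, e1.trans h1, e0 ▸ h0⟩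

/-- Isotopies do not change which points of the boundaries are joined by descending paths: they
carry climbs to climbs, as they preserve the double points. -/
theorem Isotopic.leftReach_iff {n : ℕ} {D D' : ExtDiagram n} (h : Isotopic D D') (p x : ℤ) :
    LeftReach D p x ↔ LeftReach D' p x := by
  obtain ⟨r, hr, h1⟩ := h.exists_pos_eq_iff
  have hend : ∀ s, (D'.pos s 1).1 = (D.pos s 1).1 := fun s => by simp only [ExtDiagram.pos, h1]
  have hstart : ∀ s, (D'.pos s 0).1 = (D.pos s 0).1 := fun s => by
    simp only [ExtDiagram.pos, ExtDiagram.lift_zero]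
  rw [leftReach_iff_climb, leftReach_iff_climb]
  refine exists_congr fun s => exists_congr fun s' => ?_
  rw [hend, hstart]
  refine and_congr_left fun _ => ?_
  constructor
  · intro hc
    have := Relation.ReflTransGen.lift (p := ClimbStep D')
      (fun a : (Fin n × ℤ) × I => (a.1, r a.1.1 a.2)) ?_ _ _ hc
    · simpa only [Function.onFun, iso_zero, iso_one] using this
    · rintro ⟨a, t⟩ ⟨b, u⟩ (⟨e, hle⟩ | e)
      · obtain rfl : a = b := e
        exact Or.inl ⟨rfl, (r a.1).monotone hle⟩
      · exact Or.inr ((hr _ _ _ _).2 e)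
  · intro hc
    have := Relation.ReflTransGen.lift (p := ClimbStep D)
      (fun a : (Fin n × ℤ) × I => (a.1, (r a.1.1).symm a.2)) ?_ _ _ hc
    · simpa only [Function.onFun, iso_zero, iso_one] using this
    · rintro ⟨a, t⟩ ⟨b, u⟩ (⟨e, hle⟩ | e)
      · obtain rfl : a = b := e
        exact Or.inl ⟨rfl, (r a.1).symm.monotone hle⟩
      · refine Or.inr ((hr _ _ _ _).1 ?_)
        simpa only [OrderIso.apply_symm_apply] using e

/-! ### Descending paths in the diagrams of words -/

/-- The lower endpoint of the leftmost descending path from the point of height `t` of the strand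
`p` in the diagram of a word. -/
noncomputable def leftmost {n : ℕ} : List (Fin n) → ℤ → ℝ → ℤ
  | [], p, _ => p
  | i :: u, p, t =>
    if t ≤ 1 / 2 then if t < 1 / 4 then p else prj i p else prj i (leftmost u (swp i p) (2 * t - 1))

theorem prj_swp {n : ℕ} (hn : 3 ≤ n) (i : Fin n) (p : ℤ) : prj i (swp i p) = prj i p := by
  by_cases h : At i p
  · rw [swp_of_at h, prj, add_sub_cancel_right, if_pos h, prj, if_neg (h.not_sub_one hn)]
  by_cases h' : At i (p - 1)
  · have e := swp_of_at' hn h'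
    rw [sub_add_cancel] at e
    rw [e, prj, if_neg (h'.not_sub_one hn), prj, if_pos h']
  · rw [swp_of_not h h']

theorem leftmost_zero {n : ℕ} (w : List (Fin n)) (p : ℤ) : leftmost w p 0 = p := by
  cases w <;> simp [leftmost]

theorem leftmost_one {n : ℕ} (w : List (Fin n)) (p : ℤ) :
    leftmost w p 1 = reach w (strand w p) := by
  induction w generalizing p with
  | nil => rfl
  | cons i u ih =>
    rw [leftmost, if_neg (by norm_num), show (2 : ℝ) * 1 - 1 = 1 by norm_num, ih]
    rfl

/-- Climbing along a strand, one does not meet points from which the leftmost descending path ends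
further to the right. -/
theorem leftmost_anti {n : ℕ} (hn : 3 ≤ n) (w : List (Fin n)) (p : ℤ) {t t' : ℝ} (h₀ : 0 ≤ t)
    (h : t ≤ t') : leftmost w p t' ≤ leftmost w p t := by
  induction w generalizing p t t' with
  | nil => exact le_rfl
  | cons i u ih =>
    simp only [leftmost]
    have key : 1 / 2 < t' → prj i (leftmost u (swp i p) (2 * t' - 1)) ≤ prj i p := by
      intro ht
      have := ih (swp i p) (t := 0) (t' := 2 * t' - 1) le_rfl (by linarith)
      rw [leftmost_zero] at this
      exact (prj_mono i this).trans_eq (prj_swp hn i p)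
    have hle := prj_le i p
    by_cases h1 : t' ≤ 1 / 2
    · rw [if_pos h1, if_pos (h.trans h1)]
      by_cases h2 : t' < 1 / 4
      · rw [if_pos h2, if_pos (h.trans_lt h2)]
      · rw [if_neg h2]
        split_ifs
        exacts [hle, le_rfl]
    · rw [if_neg h1]
      rw [not_le] at h1
      split_ifs with h2 h3
      · exact (key h1).trans hle
      · exact key h1
      · exact prj_mono i (ih _ (by linarith) (by linarith))

theorem leftmost_eq_of_meet {n : ℕ} (hn : 3 ≤ n) (w : List (Fin n)) {p q : ℤ} {t : I}
    (h : wordCoord w p t = wordCoord w q t) : leftmost w p t = leftmost w q t := by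
  induction w generalizing p q t with
  | nil =>
    simp only [wordCoord, Int.cast_inj] at h
    rw [h]
  | cons i u ih =>
    have key : ∀ p q, p < q → wordCoord (i :: u) p t = wordCoord (i :: u) q t →
        leftmost (i :: u) p t = leftmost (i :: u) q t := by
      intro p q hpq h
      rcases (wordCoord_cons_eq_iff hn i u hpq t).1 h with ⟨hp, rfl, e⟩ | ⟨ht, e⟩
      · rw [leftmost, leftmost, e]
        norm_num
        rw [prj, if_neg (hp.not_sub_one hn), prj, add_sub_cancel_right, if_pos hp]
      · rw [leftmost, leftmost, if_neg (by linarith), if_neg (by linarith),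
          ih (t := ⟨_, double_mem ht⟩) e]
    rcases lt_trichotomy p q with hlt | rfl | hlt
    · exact key _ _ hlt h
    · rfl
    · exact (key _ _ hlt h.symm).symm

/-- The leftmost descending path from `p` in the diagram of a word. -/
theorem exists_path_wordCoord {n : ℕ} (hn : 3 ≤ n) (w : List (Fin n)) (p : ℤ) :
    ∃ γ : ℝ → ℝ, Continuous γ ∧ (∀ y ∈ I, ∃ q, γ y = wordCoord w q y) ∧ γ 1 = p ∧
      γ 0 = reach w p := by
  induction w with
  | nil => exact ⟨fun _ => p, continuous_const, fun y _ => ⟨p, rfl⟩, rfl, rfl⟩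
  | cons i u ih =>
    obtain ⟨γ, hγ, hc, h1, h0⟩ := ih
    generalize hr : reach u p = r at h0
    obtain ⟨e, he, hce, he1, he0⟩ : ∃ e : ℝ → ℝ, Continuous e ∧ (∀ y ∈ I, ∃ q, e y = layer i q y) ∧
        e 1 = r ∧ e 0 = prj i r := by
      by_cases hp : At i (r - 1)
      · exact ⟨layer i (r - 1), continuous_layer _ _, fun y _ => ⟨_, rfl⟩,
          by simp [layer, hp], by simp [layer, prj, hp]⟩
      by_cases hp' : At i r
      · refine ⟨fun y => min (layer i r y) (layer i (r + 1) y),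
          (continuous_layer _ _).min (continuous_layer _ _), fun y _ => ?_, ?_, ?_⟩
        · rcases min_choice (layer i r y) (layer i (r + 1) y) with h | h
          exacts [⟨_, h⟩, ⟨_, h⟩]
        · simp [layer, hp', hp'.not_add_one hn]
        · simp [layer, prj, hp, hp', hp'.not_add_one hn]
      · exact ⟨layer i r, continuous_layer _ _, fun y _ => ⟨_, rfl⟩,
          by simp [layer, hp, hp'], by simp [layer, prj, hp, hp']⟩
    refine ⟨fun y => if y ≤ 1 / 2 then e (2 * y) else γ (2 * y - 1), ?_, ?_, ?_, ?_⟩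
    · refine Continuous.if_le (by fun_prop) (by fun_prop) continuous_id continuous_const ?_
      intro y hy
      change y = 1 / 2 at hy
      subst hy
      norm_num [he1, h0]
    · rintro y ⟨hy0, hy1⟩
      dsimp only
      split_ifs with hy
      · obtain ⟨q, hq⟩ := hce (2 * y) ⟨by linarith, by linarith⟩
        exact ⟨q, by rw [hq, wordCoord, stackCoord, if_pos hy]⟩
      · obtain ⟨q, hq⟩ := hc (2 * y - 1) ⟨by linarith, by linarith⟩
        exact ⟨swp i q, by rw [hq, wordCoord, stackCoord, if_neg hy, swp_swp hn]⟩
    · norm_num [h1]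
    · norm_num [he0, reach, hr]

/-- In the diagram of a word, the descending paths from `p` end at positions that are not to the
left of `reach w p`. -/
theorem leftReach_wordDiagram {n : ℕ} (hn : 3 ≤ n) (w : List (Fin n)) (p x : ℤ) :
    LeftReach (wordDiagram hn w).1 p x ↔ reach w p ≤ x := by
  have c := coords_wordDiagram hn w
  constructor
  · intro h
    obtain ⟨s, s', h, h0, h1⟩ := leftReach_iff_climb.1 h
    -- `leftmost` does not increase along climbs
    have hanti : ∀ a b : (Fin n × ℤ) × I, Climb (wordDiagram hn w).1 a b →
        leftmost w (b.1.1.val + 1 + b.1.2 * n) b.2 ≤ leftmost w (a.1.1.val + 1 + a.1.2 * n) a.2 := by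
      intro a b hab
      induction hab with
      | refl => exact le_rfl
      | @tail b d _ hbd ih =>
        refine le_trans ?_ ih
        rcases hbd with ⟨e, hle⟩ | e
        · rw [e]
          exact leftmost_anti hn w _ b.2.2.1 hle
        · obtain ⟨e1, e2⟩ := (c.pos_eq_pos_iff _ _ _ _).1 e
          rw [leftmost_eq_of_meet hn w e2, e1]
    have := hanti _ _ h
    simp only [c.pos_eq, Set.Icc.coe_zero, c.zero] at h0
    simp only [c.pos_eq, Set.Icc.coe_one, c.one] at h1
    simp only [Set.Icc.coe_one, Set.Icc.coe_zero, leftmost_one, leftmost_zero] at this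
    rw [show strand w (s'.1.val + 1 + s'.2 * n) = p by exact_mod_cast h1] at this
    exact this.trans (by exact_mod_cast h0)
  · intro h
    obtain ⟨γ, hγ, hc, h1, h0⟩ := exists_path_wordCoord hn w p
    refine ⟨γ, hγ, fun y hy => ?_, h1, by rw [h0]; exact_mod_cast h⟩
    obtain ⟨q, hq⟩ := hc y hy
    exact (c.mem_support hn _ _).2 ⟨hy, q, by rw [hq]⟩

/-- The endpoints of descending paths, up to moving them to the right, are an invariant of the
local moves and of isotopies. -/
theorem DC.leftReach_iff {n : ℕ} {hn : 3 ≤ n} {D D' : Diagram hn} (h : DC.mk D = DC.mk D')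
    (p x : ℤ) : LeftReach D.1 p x ↔ LeftReach D'.1 p x := by
  have e := Quot.eqvGen_exact h
  clear h
  induction e with
  | rel D D' h =>
    rcases h with h | h | h | h
    · exact h.leftReach_iff p x
    · exact h.leftReach_iff (by omega) leftConnected_one_one leftConnected_one p x
    · exact h.leftReach_iff (by omega) leftConnected_one_two_one leftConnected_two_one_two p x
    · exact h.leftReach_iff (by omega) leftConnected_two_one_two leftConnected_one_two p x
  | refl D => exact Iff.rfl
  | symm D D' _ ih => exact ih.symm
  | trans D D' D'' _ _ ih ih' => exact ih.trans ih'

/-- The leftmost descending paths of a word only depend on the class of its diagram. -/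
theorem DC.reach_eq {n : ℕ} {hn : 3 ≤ n} {u v : List (Fin n)}
    (h : DC.mk (wordDiagram hn u) = DC.mk (wordDiagram hn v)) (p : ℤ) : reach u p = reach v p := by
  refine eq_of_forall_ge_iff fun x => ?_
  rw [← leftReach_wordDiagram hn, ← leftReach_wordDiagram hn]
  exact DC.leftReach_iff h p x

/-! ### The bijections -/

/-- The homomorphism is injective because the leftmost descending paths determine the normal form
and hence the element; it is surjective because every diagram is isotopic to the diagram of a word.
-/
theorem toDC_bijective {n : ℕ} (hn : 3 ≤ n) : Function.Bijective (toDC hn) := by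
  constructor
  · intro x y h
    obtain ⟨u, rfl⟩ := exists_ofWord x
    obtain ⟨v, rfl⟩ := exists_ofWord y
    rw [toDC_ofWord, toDC_ofWord] at h
    exact ofWord_eq_of_normalForm_eq hn (normalForm_eq_of_reach_eq (DC.reach_eq h))
  · intro x
    obtain ⟨w, rfl⟩ := x.exists_mk_eq_wordDiagram
    exact ⟨ofWord w, toDC_ofWord hn w⟩

/-- The class of the web of a web word. -/
noncomputable def WC.ofWebWord {n : ℕ} (hn : 3 ≤ n) {w : List (Fin n)} (hw : IsWebWord w) : WC hn :=
  WC.mk ⟨wordDiagram hn w, hw.isWeb hn⟩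

theorem WC.exists_ofWebWord {n : ℕ} {hn : 3 ≤ n} (W : WC hn) :
    ∃ (w : List (Fin n)) (hw : IsWebWord w), W = WC.ofWebWord hn hw := by
  obtain ⟨⟨D, hD⟩, rfl⟩ := Quot.exists_rep W
  obtain ⟨w, h⟩ := exists_mk_eq_wordDiagram D
  obtain ⟨h1, -, h3⟩ := IsotopyClass.web_of_eq h
  have hw := isWebWord_of_isWeb hn (h1.1 hD)
  exact ⟨w, hw, h3 hD (hw.isWeb hn)⟩

theorem WC.ofWebWord_eq {n : ℕ} {hn : 3 ≤ n} {u v : List (Fin n)} (hu : IsWebWord u)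
    (hv : IsWebWord v) (h : normalForm u = normalForm v) :
    WC.ofWebWord hn hu = WC.ofWebWord hn hv :=
  (IsotopyClass.web_of_eq ((hu.commEq_of_normalForm_eq hn hv h).mk_wordDiagram_eq hn)).2.2 _ _

theorem webInclusion_ofWebWord {n : ℕ} {hn : 3 ≤ n} {w : List (Fin n)} (hw : IsWebWord w) :
    webInclusion (WC.ofWebWord hn hw) = toDC hn (ofWord w) :=
  (toDC_ofWord hn w).symm

theorem webInclusion_bijective {n : ℕ} (hn : 3 ≤ n) :
    Function.Bijective (webInclusion (hn := hn)) := by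
  constructor
  · intro W W' h
    obtain ⟨u, hu, rfl⟩ := W.exists_ofWebWord
    obtain ⟨v, hv, rfl⟩ := W'.exists_ofWebWord
    rw [webInclusion_ofWebWord, webInclusion_ofWebWord] at h
    exact WC.ofWebWord_eq hu hv (normalForm_eq_of_ofWord_eq hn ((toDC_bijective hn).1 h))
  · intro x
    obtain ⟨y, rfl⟩ := (toDC_bijective hn).2 x
    obtain ⟨w, rfl⟩ := exists_ofWord y
    obtain ⟨u, hu, -, e⟩ := exists_webWord hn w
    exact ⟨WC.ofWebWord hn hu, by rw [webInclusion_ofWebWord, e]⟩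

theorem IsWebWord.rightCouple_eq {n : ℕ} (hn : 3 ≤ n) {w : List (Fin n)} (hw : IsWebWord w) :
    (wordDiagram hn w).1.rightCouple = normalForm w := by
  rw [rightCouple_wordDiagram, hw.normalForm_eq hn]

theorem IsWeb.isIIC {n : ℕ} {hn : 3 ≤ n} {D : Diagram hn} (hD : IsWeb D.1) :
    IsIIC n D.1.rightCouple := by
  obtain ⟨w, h⟩ := exists_mk_eq_wordDiagram D
  obtain ⟨h1, h2, -⟩ := IsotopyClass.web_of_eq h
  rw [h2, rightCouple_wordDiagram]
  exact (isWebWord_of_isWeb hn (h1.1 hD)).isIIC hn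

/-- The map that sends a web to its right sequence couple. -/
noncomputable def WC.rightCouple {n : ℕ} {hn : 3 ≤ n} : WC hn → IIC n :=
  Quot.lift (fun W => ⟨W.1.1.rightCouple, IsWeb.isIIC W.2⟩)
    fun _ _ h => Subtype.ext h.rightCouple_eq.symm

theorem WC.rightCouple_ofWebWord {n : ℕ} {hn : 3 ≤ n} {w : List (Fin n)} (hw : IsWebWord w) :
    (WC.rightCouple (WC.ofWebWord hn hw)).1 = normalForm w := hw.rightCouple_eq hn

theorem WC.rightCouple_bijective {n : ℕ} (hn : 3 ≤ n) :
    Function.Bijective (WC.rightCouple (hn := hn)) := by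
  constructor
  · intro W W' h
    obtain ⟨u, hu, rfl⟩ := W.exists_ofWebWord
    obtain ⟨v, hv, rfl⟩ := W'.exists_ofWebWord
    refine WC.ofWebWord_eq (hn := hn) hu hv ?_
    rw [← rightCouple_ofWebWord (hn := hn) hu, h, rightCouple_ofWebWord hv]
  · intro c
    obtain ⟨w, hw, h⟩ := c.2.exists_webWord hn
    refine ⟨WC.ofWebWord hn hw, Subtype.ext ?_⟩
    rw [WC.rightCouple_ofWebWord hw, hw.normalForm_eq hn, h]

/-- The isomorphism between the presented monoid and the monoid of diagrams. -/
noncomputable def equivDC {n : ℕ} (hn : 3 ≤ n) : CMonoid n ≃* DC hn :=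
  MulEquiv.ofBijective (toDC hn) (toDC_bijective hn)

/-- Every diagram is equivalent to exactly one web up to isotopy. -/
noncomputable def webEquiv {n : ℕ} (hn : 3 ≤ n) : WC hn ≃ DC hn :=
  Equiv.ofBijective _ (webInclusion_bijective hn)

/-- Webs up to isotopy are classified by their right sequence couples. -/
noncomputable def coupleEquiv {n : ℕ} (hn : 3 ≤ n) : WC hn ≃ IIC n :=
  Equiv.ofBijective _ (WC.rightCouple_bijective hn)

/-- The normal form of a word is the right sequence couple of the web that is equivalent to the
diagram of the word. -/
theorem coupleEquiv_webEquiv_symm {n : ℕ} (hn : 3 ≤ n) (w : List (Fin n)) :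
    (coupleEquiv hn ((webEquiv hn).symm (equivDC hn (ofWord w)))).1 = normalForm w := by
  obtain ⟨u, hu, -, e⟩ := exists_webWord hn w
  have h : (webEquiv hn).symm (equivDC hn (ofWord w)) = WC.ofWebWord hn hu := by
    rw [Equiv.symm_apply_eq, e]
    exact (webInclusion_ofWebWord hu).symm
  rw [h, normalForm_eq_of_ofWord_eq hn e]
  exact WC.rightCouple_ofWebWord hu

/-! ### Running programs -/

/-- The effect of a program without loops; the value for a loop is irrelevant. -/
def Prog.eval : Prog → Mem → Mem
  | .const x c, s => { s with reg := Function.update s.reg x c }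
  | .add x y z, s => { s with reg := Function.update s.reg x (s.reg y + s.reg z) }
  | .sub x y z, s => { s with reg := Function.update s.reg x (s.reg y - s.reg z) }
  | .load x a y, s => { s with reg := Function.update s.reg x (s.arr a (s.reg y)) }
  | .store a y x, s =>
    { s with arr := Function.update s.arr a (Function.update (s.arr a) (s.reg y) (s.reg x)) }
  | .seq p q, s => q.eval (p.eval s)
  | .ifPos x p q, s => if 0 < s.reg x then p.eval s else q.eval s
  | .whilePos _ _, s => s

/-- Programs without loops. -/
def Prog.LoopFree : Prog → Prop
  | .seq p q => p.LoopFree ∧ q.LoopFree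
  | .ifPos _ p q => p.LoopFree ∧ q.LoopFree
  | .whilePos _ _ => False
  | _ => True

/-- A bound of the running time of a program without loops. -/
def Prog.size : Prog → ℕ
  | .seq p q => p.size + q.size
  | .ifPos _ p q => p.size + q.size + 1
  | _ => 1

theorem Prog.LoopFree.exists_exec {p : Prog} (h : p.LoopFree) (s : Mem) :
    ∃ t ≤ p.size, Exec p s t (p.eval s) := by
  induction p generalizing s with
  | const x c => exact ⟨1, le_rfl, .const x c s⟩
  | add x y z => exact ⟨1, le_rfl, .add x y z s⟩
  | sub x y z => exact ⟨1, le_rfl, .sub x y z s⟩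
  | load x a y => exact ⟨1, le_rfl, .load x a y s⟩
  | store a y x => exact ⟨1, le_rfl, .store a y x s⟩
  | seq p q ihp ihq =>
    obtain ⟨t, ht, e⟩ := ihp h.1 s
    obtain ⟨t', ht', e'⟩ := ihq h.2 (p.eval s)
    exact ⟨t + t', Nat.add_le_add ht ht', .seq e e'⟩
  | ifPos x p q ihp ihq =>
    simp only [Prog.eval, Prog.size]
    split_ifs with hx
    · obtain ⟨t, ht, e⟩ := ihp h.1 s
      exact ⟨t + 1, by omega, .ifPos_true hx e⟩
    · obtain ⟨t, ht, e⟩ := ihq h.2 s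
      exact ⟨t + 1, by omega, .ifPos_false hx e⟩
  | whilePos x p => exact h.elim

/-- Started in the state `s`, the program `p` halts after at most `b` steps in a state that
satisfies `Q`. -/
def Halts (p : Prog) (s : Mem) (b : ℕ) (Q : Mem → Prop) : Prop :=
  ∃ t s', Exec p s t s' ∧ t ≤ b ∧ Q s'

theorem Halts.of_loopFree {p : Prog} {s : Mem} {Q : Mem → Prop} (h : p.LoopFree)
    (hQ : Q (p.eval s)) : Halts p s p.size Q := by
  obtain ⟨t, ht, e⟩ := h.exists_exec s
  exact ⟨t, _, e, ht, hQ⟩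

theorem Halts.seq {p q : Prog} {s : Mem} {b b' : ℕ} {Q R : Mem → Prop} (h : Halts p s b Q)
    (h' : ∀ s, Q s → Halts q s b' R) : Halts (.seq p q) s (b + b') R := by
  obtain ⟨t, s', e, ht, hQ⟩ := h
  obtain ⟨t', s'', e', ht', hR⟩ := h' s' hQ
  exact ⟨t + t', s'', .seq e e', Nat.add_le_add ht ht', hR⟩

/-- The running time of a loop whose register `x` counts the remaining passes; `P k` is the
invariant when `k` passes remain. -/
theorem Halts.whilePos {x : ℕ} {p : Prog} {P : ℕ → Mem → Prop} (hp : p.LoopFree)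
    (hx : ∀ k s, P k s → s.reg x = k) (hstep : ∀ k s, P (k + 1) s → P k (p.eval s)) {k : ℕ}
    {s : Mem} (h : P k s) : Halts (.whilePos x p) s ((p.size + 1) * k + 1) (P 0) := by
  induction k generalizing s with
  | zero => exact ⟨1, s, .whilePos_false (by simp [hx 0 s h]), by simp, h⟩
  | succ k ih =>
    obtain ⟨t, ht, e⟩ := hp.exists_exec s
    obtain ⟨t', s', e', ht', hQ⟩ := ih (hstep k s h)
    refine ⟨t + t' + 1, s', .whilePos_true ?_ e e', ?_, hQ⟩
    · rw [hx _ s h]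
      positivity
    · rw [Nat.mul_succ]
      omega

/-- A sequence of commands, followed by an assignment to the register `7`, which is only used for
intermediate results. -/
def Prog.block : List Prog → Prog
  | [] => .const 7 0
  | p :: l => .seq p (block l)

/-! ### Computing the normal form in linear time -/

/-- The command that writes the numbers `1, …, n` into the arrays `3` and `4`. -/
def initBody : Prog := .block [.store 3 2 2, .store 4 2 2, .sub 2 2 9]

/-- The command that lets the next letter of the word act on the sequence in the array `3` and
updates the residues in the array `4`. The residue of an entry is copied, as adding `n` does not
change it; this avoids divisions. -/
def actBody : Prog := .block [.load 4 0 3, .add 3 3 9, .sub 1 1 9, .load 5 3 4, .load 6 4 4,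
  .sub 7 0 4, .ifPos 7 (.add 4 4 9) (.block [.add 5 5 0, .const 4 1]), .store 3 4 5, .store 4 4 6]

/-- The command that compares the entry at the next place with the largest entry with the same
residue so far, and records the entry and its place if it is not smaller. -/
def maxBody : Prog := .block [.add 2 2 9, .load 4 4 2, .load 5 3 2, .load 6 5 4, .sub 7 6 5,
  .ifPos 7 (.block []) (.block [.store 5 4 5, .store 6 4 2]), .sub 1 1 9]

/-- The command that appends a pair to the output. -/
def emit : Prog := .block [.store 1 3 2, .store 2 3 5, .add 3 3 9]

/-- The command that computes the pair belonging to the next residue and appends it to the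
output, unless the residue does not occur or its pair is to be discarded. -/
def outBody : Prog := .block [.add 2 2 9, .load 4 5 2,
  .ifPos 4 (.block [.load 5 6 2, .add 5 5 4, .sub 5 5 2, .sub 6 5 2, .sub 7 2 5,
    .ifPos 6 emit (.ifPos 7 emit (.block []))]) (.block []), .sub 1 1 9]

/-- The program that computes the normal form of a word. Register `0` contains `n`, register `1`
the number of the remaining passes of a loop, register `2` the current place (and, in the first
loop, also the number of the remaining passes), register `3` the current position in the word or
the output, registers `4` to `7` intermediate results, and registers `8` and `9` the constants `0`
and `1`. Arrays `0`, `1` and `2` contain the word and the output, array `3` the sequence that is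
acted on, array `4` the residues in `{1, …, n}` of its entries, and arrays `5` and `6`, indexed by
these residues, the largest entry and its rightmost place. -/
def normalFormProg : Prog :=
  .seq (.block [.const 9 1, .add 2 0 8]) <| .seq (.whilePos 2 initBody) <|
  .seq (.whilePos 1 actBody) <| .seq (.add 1 0 8) <| .seq (.whilePos 1 maxBody) <|
  .seq (.block [.const 2 0, .const 3 0, .add 1 0 8]) <| .seq (.whilePos 1 outBody) (.add 0 3 8)

/-- The registers that contain constants. -/
structure Base (n : ℕ) (s : Mem) : Prop where
  reg_zero : s.reg 0 = n
  reg_eight : s.reg 8 = 0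
  reg_nine : s.reg 9 = 1

/-- The residue of `y` modulo `n` in `{1, …, n}`. -/
def resid (n y : ℕ) : ℤ := ((y : ℤ) - 1) % n + 1

theorem resid_eq_iff {n : ℕ} {y a : ℕ} (ha : 1 ≤ a) (han : a ≤ n) :
    resid n y = a ↔ y ≡ a [MOD n] := by
  have e : ((a : ℤ) - 1) % n = a - 1 := Int.emod_eq_of_lt (by omega) (by omega)
  unfold resid
  rw [← Int.natCast_modEq_iff]
  constructor
  · intro h
    have : (y : ℤ) - 1 ≡ a - 1 [ZMOD n] := by unfold Int.ModEq; rw [e]; omega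
    simpa using this.add_right 1
  · intro h
    have : (y : ℤ) - 1 ≡ a - 1 [ZMOD n] := h.sub_right 1
    unfold Int.ModEq at this
    omega

theorem resid_add_n (n y : ℕ) : resid n (y + n) = resid n y := by
  unfold resid
  rw [show ((y + n : ℕ) : ℤ) - 1 = y - 1 + n by push_cast; ring, Int.add_emod_right]

/-- The sequence `y` is stored in the array `3`, and its residues in the array `4`. -/
def Stores {n : ℕ} (y : Fin n → ℕ) (s : Mem) : Prop :=
  ∀ j : Fin n, s.arr 3 (j.val + 1) = y j ∧ s.arr 4 (j.val + 1) = resid n (y j)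

/-- The first loop stores the sequence `(1, …, n)`. -/
theorem halts_init {n : ℕ} (w : List (Fin n)) (s : Mem) (hb : Base n s) (h0 : s.arr 0 = (inputMem w).arr 0)
    (h1 : s.reg 1 = w.length) (h2 : s.reg 2 = n) (h3 : s.reg 3 = 0) (h5 : s.arr 5 = 0)
    (h6 : s.arr 6 = 0) :
    Halts (.whilePos 2 initBody) s ((initBody.size + 1) * n + 1) fun s => Base n s ∧
      s.arr 0 = (inputMem w).arr 0 ∧ s.reg 1 = w.length ∧ s.reg 2 = 0 ∧ s.reg 3 = 0 ∧
      s.arr 5 = 0 ∧ s.arr 6 = 0 ∧ Stores (start n) s := by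
  have := Halts.whilePos (x := 2) (p := initBody) (P := fun k s => Base n s ∧
    s.arr 0 = (inputMem w).arr 0 ∧ s.reg 1 = w.length ∧ s.reg 2 = k ∧ s.reg 3 = 0 ∧
    s.arr 5 = 0 ∧ s.arr 6 = 0 ∧ ∀ p : ℤ, k < p → p ≤ n → s.arr 3 p = p ∧ s.arr 4 p = p)
    (by simp [initBody, Prog.block, Prog.LoopFree]) (fun k s h => h.2.2.2.1) ?_
    (k := n) (s := s) ⟨hb, h0, h1, h2, h3, h5, h6, fun p h h' => by omega⟩
  · obtain ⟨t, s', e, ht, hb, h0, h1, h2, h3, h5, h6, h⟩ := this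
    refine ⟨t, s', e, ht, hb, h0, h1, by simpa using h2, h3, h5, h6, fun j => ?_⟩
    have hj := j.isLt
    have := h (j.val + 1) (by omega) (by omega)
    refine ⟨by rw [this.1]; simp [start], ?_⟩
    rw [this.2, resid, start, Int.emod_eq_of_lt] <;> push_cast <;> omega
  · rintro k s ⟨hb, h0, h1, h2, h3, h5, h6, h⟩
    simp only [initBody, Prog.block, Prog.eval]
    refine ⟨⟨?_, ?_, ?_⟩, ?_, ?_, ?_, ?_, ?_, ?_, ?_⟩
    · simp [hb.reg_zero]
    · simp [hb.reg_eight]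
    · simp [hb.reg_nine]
    · simp [h0]
    · simp [h1]
    · simp [h2, hb.reg_nine]
    · simp [h3]
    · simp [h5]
    · simp [h6]
    · intro p hp hpn
      by_cases e : p = k + 1
      · simp [h2, e]
      · have := h p (by push_cast; omega) hpn
        simp [h2, e, this]

theorem nxt_val {n : ℕ} (i : Fin n) :
    (nxt i).val = if i.val + 1 = n then 0 else i.val + 1 := by
  have := i.isLt
  unfold nxt
  split_ifs with h
  · simp [h]
  · exact Nat.mod_eq_of_lt (by omega)

theorem stores_actBody {n : ℕ} {y : Fin n → ℕ} {s : Mem} (i : Fin n) (h0 : s.reg 0 = n)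
    (h9 : s.reg 9 = 1) (hi : s.arr 0 (s.reg 3) = i.val + 1) (hs : Stores y s) :
    Stores (sigma i y) (actBody.eval s) := by
  have hlt := i.isLt
  have hv := nxt_val i
  intro j
  simp only [actBody, Prog.block, Prog.eval]
  by_cases hin : i.val + 1 = n
  · rw [if_pos hin] at hv
    have c : ¬ (i.val : ℤ) + 1 < n := by omega
    by_cases hj : j = nxt i
    · have e : (j.val : ℤ) = 0 := by rw [hj, hv]; rfl
      simp [hi, h0, h9, c, hs i, hj, sigma, hin, resid_add_n, hv]
    · have e : j.val ≠ 0 := fun e => hj (Fin.ext (by rw [hv, e]))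
      simp [hi, h0, h9, c, hs j, hj, sigma, hin, e]
  · rw [if_neg hin] at hv
    have c : (i.val : ℤ) + 1 < n := by omega
    by_cases hj : j = nxt i
    · simp [hi, h0, h9, c, hs i, hj, sigma, hin, hv]
    · have e : (j.val : ℤ) ≠ i.val + 1 := fun e => hj (Fin.ext (by rw [hv]; omega))
      simp [hi, h0, h9, c, hs j, hj, sigma, hin, e]

theorem actBody_frame (s : Mem) : (actBody.eval s).reg 0 = s.reg 0 ∧
    (actBody.eval s).reg 1 = s.reg 1 - s.reg 9 ∧ (actBody.eval s).reg 2 = s.reg 2 ∧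
    (actBody.eval s).reg 3 = s.reg 3 + s.reg 9 ∧ (actBody.eval s).reg 8 = s.reg 8 ∧
    (actBody.eval s).reg 9 = s.reg 9 ∧ (actBody.eval s).arr 0 = s.arr 0 ∧
    (actBody.eval s).arr 5 = s.arr 5 ∧ (actBody.eval s).arr 6 = s.arr 6 := by
  simp only [actBody, Prog.block, Prog.eval]
  by_cases c : s.arr 0 (s.reg 3) < s.reg 0 <;> simp [c]

theorem inputMem_arr {n : ℕ} (u : List (Fin n)) (i : Fin n) (v : List (Fin n)) :
    (inputMem (u ++ i :: v)).arr 0 u.length = i.val + 1 := by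
  simp [inputMem]

/-- The second loop applies the letters of the word. -/
theorem halts_act {n : ℕ} (w : List (Fin n)) (s : Mem) (hb : Base n s)
    (h0 : s.arr 0 = (inputMem w).arr 0) (h1 : s.reg 1 = w.length) (h2 : s.reg 2 = 0)
    (h3 : s.reg 3 = 0) (h5 : s.arr 5 = 0) (h6 : s.arr 6 = 0) (hs : Stores (start n) s) :
    Halts (.whilePos 1 actBody) s ((actBody.size + 1) * w.length + 1) fun s => Base n s ∧
      s.reg 1 = 0 ∧ s.reg 2 = 0 ∧ s.arr 5 = 0 ∧ s.arr 6 = 0 ∧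
      Stores (w.foldl (fun y i => sigma i y) (start n)) s := by
  have := Halts.whilePos (x := 1) (p := actBody) (P := fun k s => s.reg 1 = k ∧ Base n s ∧
    s.reg 2 = 0 ∧ s.arr 5 = 0 ∧ s.arr 6 = 0 ∧ s.arr 0 = (inputMem w).arr 0 ∧
    ∃ u v, w = u ++ v ∧ v.length = k ∧ s.reg 3 = u.length ∧
      Stores (u.foldl (fun y i => sigma i y) (start n)) s)
    (by simp [actBody, Prog.block, Prog.LoopFree]) (fun k s h => h.1) ?_
    (k := w.length) (s := s) ⟨h1, hb, h2, h5, h6, h0, [], w, rfl, rfl, h3, hs⟩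
  · obtain ⟨t, s', e, ht, h1', hb', h2', h5', h6', -, u, v, hw, hv, -, hs'⟩ := this
    obtain rfl := List.length_eq_zero_iff.1 hv
    rw [List.append_nil] at hw
    subst hw
    exact ⟨t, s', e, ht, hb', h1', h2', h5', h6', hs'⟩
  · rintro k s ⟨h1, hb, h2, h5, h6, h0, u, v, hw, hv, h3, hs⟩
    obtain ⟨i, v, rfl⟩ := List.exists_cons_of_length_eq_add_one hv
    have hi : s.arr 0 (s.reg 3) = i.val + 1 := by rw [h0, h3, hw, inputMem_arr]
    have hs' := stores_actBody i hb.reg_zero hb.reg_nine hi hs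
    obtain ⟨e0, e1, e2, e3, e8, e9, a0, a5, a6⟩ := actBody_frame s
    refine ⟨?_, ⟨e0.trans hb.reg_zero, e8.trans hb.reg_eight, e9.trans hb.reg_nine⟩, e2.trans h2,
      a5.trans h5, a6.trans h6, a0.trans h0, u ++ [i], v, by simp [hw], by simpa using hv, ?_, ?_⟩
    · rw [e1, h1, hb.reg_nine]
      push_cast
      ring
    · rw [e3, h3, hb.reg_nine]
      simp
    · rw [List.foldl_append]
      exact hs'

/-- Among the entries of `y` at the places `1, …, p` congruent to `a`, the largest one is `m`, and
`r` is the rightmost place where it occurs; if there are no such entries, these numbers are `0`. -/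
def IsBest {n : ℕ} (y : Fin n → ℕ) (p a : ℕ) (m r : ℤ) : Prop :=
  (∀ j : Fin n, j.val < p → y j ≡ a [MOD n] → y j ≤ m ∧ (y j = m → (j.val : ℤ) + 1 ≤ r)) ∧
    ((m = 0 ∧ r = 0) ∨ ∃ j : Fin n, j.val < p ∧ y j ≡ a [MOD n] ∧ (y j : ℤ) = m ∧
      (j.val : ℤ) + 1 = r)

theorem maxBody_frame (s : Mem) : (maxBody.eval s).reg 0 = s.reg 0 ∧
    (maxBody.eval s).reg 1 = s.reg 1 - s.reg 9 ∧
    (maxBody.eval s).reg 2 = s.reg 2 + s.reg 9 ∧ (maxBody.eval s).reg 8 = s.reg 8 ∧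
    (maxBody.eval s).reg 9 = s.reg 9 ∧ (maxBody.eval s).arr 3 = s.arr 3 ∧
    (maxBody.eval s).arr 4 = s.arr 4 ∧
    ∀ a, (maxBody.eval s).arr 5 a = (if a = s.arr 4 (s.reg 2 + s.reg 9) ∧
        s.arr 5 a ≤ s.arr 3 (s.reg 2 + s.reg 9) then s.arr 3 (s.reg 2 + s.reg 9) else s.arr 5 a) ∧
      (maxBody.eval s).arr 6 a = (if a = s.arr 4 (s.reg 2 + s.reg 9) ∧
        s.arr 5 a ≤ s.arr 3 (s.reg 2 + s.reg 9) then s.reg 2 + s.reg 9 else s.arr 6 a) := by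
  simp only [maxBody, Prog.block, Prog.eval]
  by_cases c : s.arr 3 (s.reg 2 + s.reg 9) < s.arr 5 (s.arr 4 (s.reg 2 + s.reg 9))
  · simp [c]
    intro a
    constructor
    · rintro rfl h
      exact absurd h (not_le.2 c)
    · rintro rfl h
      exact absurd h (not_le.2 c)
  · simp [c]
    rw [not_lt] at c
    intro a
    by_cases h : a = s.arr 4 (s.reg 2 + s.reg 9)
    · subst h
      simp [c]
    · simp [h]

/-- The third loop finds the largest entries of all residues and their rightmost places. -/
theorem halts_max {n : ℕ} {y : Fin n → ℕ} (hy : ∀ j, 1 ≤ y j) (s : Mem)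
    (hb : Base n s) (h1 : s.reg 1 = n) (h2 : s.reg 2 = 0) (h5 : s.arr 5 = 0) (h6 : s.arr 6 = 0)
    (hs : Stores y s) :
    Halts (.whilePos 1 maxBody) s ((maxBody.size + 1) * n + 1) fun s => Base n s ∧
      ∀ a : ℕ, 1 ≤ a → a ≤ n → IsBest y n a (s.arr 5 a) (s.arr 6 a) := by
  have := Halts.whilePos (x := 1) (p := maxBody) (P := fun k s => s.reg 1 = k ∧ Base n s ∧
    Stores y s ∧ ∃ p : ℕ, p + k = n ∧ s.reg 2 = p ∧
      ∀ a : ℕ, 1 ≤ a → a ≤ n → IsBest y p a (s.arr 5 a) (s.arr 6 a))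
    (by simp [maxBody, Prog.block, Prog.LoopFree]) (fun k s h => h.1) ?_
    (k := n) (s := s) ⟨h1, hb, hs, 0, by simp, by simp [h2], fun a _ _ => by simp [IsBest, h5, h6]⟩
  · obtain ⟨t, s', e, ht, -, hb', -, p, hp, -, h⟩ := this
    obtain rfl : p = n := hp
    exact ⟨t, s', e, ht, hb', h⟩
  · rintro k s ⟨h1, hb, hs, p, hp, h2, h⟩
    obtain ⟨e0, e1, e2, e8, e9, a3, a4, a56⟩ := maxBody_frame s
    have hpn : p < n := by omega
    obtain ⟨hs3, hs4⟩ := hs ⟨p, hpn⟩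
    simp only [h2, hb.reg_nine] at a56 hs3 hs4
    rw [hs3, hs4] at a56
    refine ⟨?_, ⟨e0.trans hb.reg_zero, e8.trans hb.reg_eight, e9.trans hb.reg_nine⟩, ?_, p + 1,
      by omega, ?_, ?_⟩
    · rw [e1, h1, hb.reg_nine]
      push_cast
      ring
    · unfold Stores
      rw [a3, a4]
      exact hs
    · rw [e2, h2, hb.reg_nine]
      push_cast
      ring
    · intro a ha han
      obtain ⟨b1, b2⟩ := h a ha han
      rw [(a56 a).1, (a56 a).2]
      have hsplit : ∀ j : Fin n, j.val < p + 1 → j.val < p ∨ j = ⟨p, hpn⟩ := fun j hj => by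
        rcases Nat.lt_succ_iff_lt_or_eq.1 hj with h | h
        exacts [Or.inl h, Or.inr (Fin.ext h)]
      have hres : (a : ℤ) = resid n (y ⟨p, hpn⟩) ↔ y ⟨p, hpn⟩ ≡ a [MOD n] := by
        rw [eq_comm, resid_eq_iff ha han]
      by_cases c : (a : ℤ) = resid n (y ⟨p, hpn⟩) ∧ s.arr 5 a ≤ y ⟨p, hpn⟩
      · rw [if_pos c, if_pos c]
        refine ⟨fun j hj hja => ?_, Or.inr ⟨⟨p, hpn⟩, Nat.lt_succ_self p, hres.1 c.1, rfl, rfl⟩⟩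
        rcases hsplit j hj with h | rfl
        · have := (b1 j h hja).1
          exact ⟨this.trans c.2, fun _ => by omega⟩
        · exact ⟨le_rfl, fun _ => le_rfl⟩
      · rw [if_neg c, if_neg c]
        refine ⟨fun j hj hja => ?_, ?_⟩
        · rcases hsplit j hj with h | rfl
          · exact b1 j h hja
          · have : ¬ s.arr 5 a ≤ y ⟨p, hpn⟩ := fun h => c ⟨hres.2 hja, h⟩
            omega
        · rcases b2 with h | ⟨j, hj, h⟩
          · exact Or.inl h
          · exact Or.inr ⟨j, by omega, h⟩

/-- The largest entry of a residue is positive exactly if this residue occurs, as all entries are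
positive. -/
theorem IsBest.exists_iff {n : ℕ} {y : Fin n → ℕ} (hy : ∀ j, 1 ≤ y j) {a : ℕ} {m r : ℤ}
    (h : IsBest y n a m r) : 0 < m ↔ ∃ j, y j ≡ a [MOD n] := by
  obtain ⟨h1, h2⟩ := h
  constructor
  · rcases h2 with ⟨rfl, -⟩ | ⟨j, -, hj, -⟩
    · exact fun h => absurd h (lt_irrefl _)
    · exact fun _ => ⟨j, hj⟩
  · rintro ⟨j, hj⟩
    have := (h1 j j.isLt hj).1
    have := hy j
    omega

theorem IsBest.bValue_eq {n : ℕ} {y : Fin n → ℕ} {a : ℕ} {m r : ℤ} (h : IsBest y n a m r)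
    (hm : 0 < m) : bValue y a = r + m - a := by
  obtain ⟨h1, ⟨rfl, -⟩ | ⟨j, -, hj, rfl, rfl⟩⟩ := h
  · exact absurd hm (lt_irrefl _)
  have e : maxEntry y a = y j := by
    refine le_antisymm (Finset.sup_le fun k hk => ?_)
      (Finset.le_sup (f := y) (Finset.mem_filter.2 ⟨Finset.mem_univ _, hj⟩))
    exact_mod_cast (h1 k k.isLt (Finset.mem_filter.1 hk).2).1
  have e' : maxPlace y a = j.val + 1 := by
    refine le_antisymm (Finset.sup_le fun k hk => ?_)
      (Finset.le_sup (f := fun j : Fin n => j.val + 1) (Finset.mem_filter.2 ⟨Finset.mem_univ _, e.symm⟩))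
    have hk := (Finset.mem_filter.1 hk).2
    rw [e] at hk
    exact_mod_cast (h1 k k.isLt (hk ▸ hj)).2 (by rw [hk])
  rw [bValue, e, e']
  push_cast
  rfl

theorem outBody_frame (s : Mem) : (outBody.eval s).reg 0 = s.reg 0 ∧
    (outBody.eval s).reg 1 = s.reg 1 - s.reg 9 ∧
    (outBody.eval s).reg 2 = s.reg 2 + s.reg 9 ∧ (outBody.eval s).reg 8 = s.reg 8 ∧
    (outBody.eval s).reg 9 = s.reg 9 ∧ (outBody.eval s).arr 5 = s.arr 5 ∧
    (outBody.eval s).arr 6 = s.arr 6 := by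
  simp only [outBody, emit, Prog.block, Prog.eval]
  by_cases c1 : 0 < s.arr 5 (s.reg 2 + s.reg 9)
  · by_cases c2 : s.reg 2 + s.reg 9 <
      s.arr 6 (s.reg 2 + s.reg 9) + s.arr 5 (s.reg 2 + s.reg 9) - (s.reg 2 + s.reg 9)
    · simp [c1, c2]
    by_cases c3 : s.arr 6 (s.reg 2 + s.reg 9) + s.arr 5 (s.reg 2 + s.reg 9) - (s.reg 2 + s.reg 9) <
      s.reg 2 + s.reg 9 <;> simp [c1, c2, c3]
  · simp [c1]

/-- The effect of `outBody` on the output. -/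
theorem outBody_output (s : Mem) {a m r : ℤ} (ha : s.reg 2 + s.reg 9 = a) (hm : s.arr 5 a = m)
    (hr : s.arr 6 a = r) : (outBody.eval s).reg 3 =
      (if 0 < m ∧ r + m - a ≠ a then s.reg 3 + s.reg 9 else s.reg 3) ∧
    (outBody.eval s).arr 1 = (if 0 < m ∧ r + m - a ≠ a then
      Function.update (s.arr 1) (s.reg 3) a else s.arr 1) ∧
    (outBody.eval s).arr 2 = (if 0 < m ∧ r + m - a ≠ a then
      Function.update (s.arr 2) (s.reg 3) (r + m - a) else s.arr 2) := by
  subst ha hm hr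
  simp only [outBody, emit, Prog.block, Prog.eval]
  by_cases c1 : 0 < s.arr 5 (s.reg 2 + s.reg 9)
  · rcases lt_trichotomy (s.reg 2 + s.reg 9)
      (s.arr 6 (s.reg 2 + s.reg 9) + s.arr 5 (s.reg 2 + s.reg 9) - (s.reg 2 + s.reg 9)) with c | c | c
    · simp [c1, c, c.ne']
    · simp [c1, c.symm]
    · simp [c1, c, c.ne, c.not_gt]
  · simp [c1]

/-- The numbers `a ≤ p` for which `coupleOf y` contains a pair. -/
def firsts {n : ℕ} (y : Fin n → ℕ) (p : ℕ) : List ℕ :=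
  ((List.range p).map (· + 1)).filter fun a => decide ((∃ j, y j ≡ a [MOD n]) ∧ bValue y a ≠ a)

theorem firsts_succ {n : ℕ} (y : Fin n → ℕ) (p : ℕ) : firsts y (p + 1) = firsts y p ++
    if (∃ j, y j ≡ p + 1 [MOD n]) ∧ bValue y (p + 1) ≠ (p + 1 : ℕ) then [p + 1] else [] := by
  unfold firsts
  rw [List.range_succ, List.map_append, List.filter_append]
  congr 1
  simp only [List.map_cons, List.map_nil, List.filter_cons, List.filter_nil, decide_eq_true_eq]

/-- The fourth loop writes the couple. -/
theorem halts_out {n : ℕ} {y : Fin n → ℕ} (hy : ∀ j, 1 ≤ y j) (s : Mem)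
    (hb : Base n s) (h1 : s.reg 1 = n) (h2 : s.reg 2 = 0) (h3 : s.reg 3 = 0)
    (hbest : ∀ a : ℕ, 1 ≤ a → a ≤ n → IsBest y n a (s.arr 5 a) (s.arr 6 a)) :
    Halts (.whilePos 1 outBody) s ((outBody.size + 1) * n + 1) fun s => Base n s ∧
      s.reg 3 = (coupleOf y).1.length ∧ (∀ t < (coupleOf y).1.length,
        s.arr 1 t = (coupleOf y).1.getD t 0) ∧
      ∀ t < (coupleOf y).2.length, s.arr 2 t = (coupleOf y).2.getD t 0 := by
  have := Halts.whilePos (x := 1) (p := outBody) (P := fun k s => s.reg 1 = k ∧ Base n s ∧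
    (∀ a : ℕ, 1 ≤ a → a ≤ n → IsBest y n a (s.arr 5 a) (s.arr 6 a)) ∧
    ∃ p : ℕ, p + k = n ∧ s.reg 2 = p ∧ s.reg 3 = (firsts y p).length ∧
      ∀ (t : ℕ) (ht : t < (firsts y p).length),
        s.arr 1 t = (firsts y p)[t] ∧ s.arr 2 t = bValue y (firsts y p)[t])
    (by simp [outBody, emit, Prog.block, Prog.LoopFree]) (fun k s h => h.1) ?_
    (k := n) (s := s) ⟨h1, hb, hbest, 0, by simp, by simp [h2], by simp [h3, firsts],
      by simp [firsts]⟩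
  · obtain ⟨t, s', e, ht, -, hb', -, p, hp, -, h3', h⟩ := this
    obtain rfl : p = n := hp
    have e1 : (coupleOf y).1 = List.map (fun a : ℕ => (a : ℤ)) (firsts y p) := by
      simp only [coupleOf, firsts, bind_pure_comp, List.map_eq_map, List.map_id']
    have e2 : (coupleOf y).2 = (firsts y p).map (bValue y) := rfl
    refine ⟨t, s', e, ht, hb', ?_, fun t ht => ?_, fun t ht => ?_⟩
    · rw [e1, List.length_map, h3']
    · rw [e1, List.length_map] at ht
      rw [(h t ht).1, e1, List.getD_eq_getElem _ _ (by simpa using ht), List.getElem_map]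
    · rw [e2, List.length_map] at ht
      rw [(h t ht).2, e2, List.getD_eq_getElem _ _ (by simpa using ht), List.getElem_map]
  · rintro k s ⟨h1, hb, hbest, p, hp, h2, h3, h⟩
    obtain ⟨e0, e1, e2, e8, e9, a5, a6⟩ := outBody_frame s
    have hbe := hbest (p + 1) (by omega) (by omega)
    have hout := outBody_output s (a := (p + 1 : ℕ)) (by rw [h2, hb.reg_nine]; push_cast; rfl)
      rfl rfl
    rw [h3, hb.reg_nine] at hout
    have hc : (0 < s.arr 5 (p + 1 : ℕ) ∧ s.arr 6 (p + 1 : ℕ) + s.arr 5 (p + 1 : ℕ) - (p + 1 : ℕ) ≠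
        (p + 1 : ℕ)) ↔ (∃ j, y j ≡ p + 1 [MOD n]) ∧ bValue y (p + 1) ≠ (p + 1 : ℕ) := by
      rw [← hbe.exists_iff hy]
      exact and_congr_right fun hm => by rw [hbe.bValue_eq hm]
    refine ⟨?_, ⟨e0.trans hb.reg_zero, e8.trans hb.reg_eight, e9.trans hb.reg_nine⟩,
      by rw [a5, a6]; exact hbest, p + 1, by omega, ?_, ?_⟩
    · rw [e1, h1, hb.reg_nine]
      push_cast
      ring
    · rw [e2, h2, hb.reg_nine]
      push_cast
      ring
    · obtain ⟨o3, o1, o2⟩ := hout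
      rw [o3, o1, o2, firsts_succ]
      by_cases c : (∃ j, y j ≡ p + 1 [MOD n]) ∧ bValue y (p + 1) ≠ (p + 1 : ℕ)
      · have hm := (hc.2 c).1
        rw [if_pos (hc.2 c), if_pos (hc.2 c), if_pos (hc.2 c), if_pos c]
        refine ⟨by simp, fun t ht => ?_⟩
        rw [List.length_append, List.length_singleton] at ht
        rcases Nat.lt_succ_iff_lt_or_eq.1 ht with ht | rfl
        · have hne : (t : ℤ) ≠ (firsts y p).length := by omega
          rw [Function.update_of_ne hne, Function.update_of_ne hne, List.getElem_append_left ht]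
          exact h t ht
        · rw [Function.update_self, Function.update_self, List.getElem_append_right le_rfl]
          simp only [Nat.sub_self, List.getElem_cons_zero]
          exact ⟨trivial, (hbe.bValue_eq hm).symm⟩
      · simp only [if_neg (fun h => c (hc.1 h)), if_neg c, List.append_nil]
        exact ⟨trivial, h⟩

theorem one_le_foldl_sigma {n : ℕ} (w : List (Fin n)) {y : Fin n → ℕ} (hy : ∀ j, 1 ≤ y j)
    (j : Fin n) : 1 ≤ w.foldl (fun y i => sigma i y) y j := by
  induction w generalizing y with
  | nil => exact hy j
  | cons i w ih =>
    refine ih fun k => ?_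
    have := hy i
    have := hy k
    simp only [sigma, Function.update_apply]
    split_ifs <;> omega

theorem halts_normalFormProg {n : ℕ} (w : List (Fin n)) :
    ∃ b, Halts normalFormProg (inputMem w) b (fun s => IsOutput s (normalForm w)) ∧
      b ≤ 200 * (n + w.length + 1) := by
  have hy := one_le_foldl_sigma w (y := start n) (fun j => Nat.le_add_left 1 _)
  refine ⟨_, Halts.seq (Q := fun s => Base n s ∧ s.arr 0 = (inputMem w).arr 0 ∧
      s.reg 1 = w.length ∧ s.reg 2 = n ∧ s.reg 3 = 0 ∧ s.arr 5 = 0 ∧ s.arr 6 = 0)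
    (.of_loopFree (by simp [Prog.block, Prog.LoopFree]) ?_) fun s h => Halts.seq
    (halts_init w s h.1 h.2.1 h.2.2.1 h.2.2.2.1 h.2.2.2.2.1 h.2.2.2.2.2.1 h.2.2.2.2.2.2)
    fun s h => Halts.seq
    (halts_act w s h.1 h.2.1 h.2.2.1 h.2.2.2.1 h.2.2.2.2.1 h.2.2.2.2.2.1 h.2.2.2.2.2.2.1
      h.2.2.2.2.2.2.2) fun s h => Halts.seq
    (Q := fun s => Base n s ∧ s.reg 1 = n ∧ s.reg 2 = 0 ∧ s.arr 5 = 0 ∧ s.arr 6 = 0 ∧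
      Stores (w.foldl (fun y i => sigma i y) (start n)) s)
    (.of_loopFree (by simp [Prog.LoopFree]) ?_) fun s h => Halts.seq
    (halts_max hy s h.1 h.2.1 h.2.2.1 h.2.2.2.1 h.2.2.2.2.1 h.2.2.2.2.2)
    fun s h => Halts.seq
    (Q := fun s => Base n s ∧ s.reg 1 = n ∧ s.reg 2 = 0 ∧ s.reg 3 = 0 ∧
      ∀ a : ℕ, 1 ≤ a → a ≤ n → IsBest (w.foldl (fun y i => sigma i y) (start n)) n a
        (s.arr 5 a) (s.arr 6 a))
    (.of_loopFree (by simp [Prog.block, Prog.LoopFree]) ?_) fun s h => Halts.seq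
    (halts_out hy s h.1 h.2.1 h.2.2.1 h.2.2.2.1 h.2.2.2.2) fun s h =>
    .of_loopFree (by simp [Prog.LoopFree]) ?_, ?_⟩
  · refine ⟨⟨?_, ?_, ?_⟩, ?_, ?_, ?_, ?_, ?_, ?_⟩
    any_goals simp [Prog.block, Prog.eval, inputMem]
    all_goals rfl
  · obtain ⟨hb, h1, h2, h5, h6, hs⟩ := h
    exact ⟨⟨by simp [Prog.eval, hb.reg_zero], by simp [Prog.eval, hb.reg_eight],
      by simp [Prog.eval, hb.reg_nine]⟩, by simp [Prog.eval, hb.reg_zero, hb.reg_eight],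
      by simp [Prog.eval, h2], h5, h6, hs⟩
  · obtain ⟨hb, hbest⟩ := h
    exact ⟨⟨by simp [Prog.eval, Prog.block, hb.reg_zero],
      by simp [Prog.eval, Prog.block, hb.reg_eight],
      by simp [Prog.eval, Prog.block, hb.reg_nine]⟩,
      by simp [Prog.eval, Prog.block, hb.reg_zero, hb.reg_eight],
      by simp [Prog.eval, Prog.block], by simp [Prog.eval, Prog.block], hbest⟩
  · obtain ⟨hb, h3, o1, o2⟩ := h
    refine ⟨by simp [Prog.eval, hb.reg_eight, h3, normalForm], ?_, o1, o2⟩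
    simp [normalForm, coupleOf]
  · simp only [Prog.block, Prog.size, initBody, actBody, maxBody, outBody, emit]
    omega

theorem exists_linear_time_prog : ∃ (P : Prog) (K : ℕ), ∀ n : ℕ, 3 ≤ n → ∀ w : List (Fin n),
    ∃ (t : ℕ) (s : Mem), Exec P (inputMem w) t s ∧ t ≤ K * max n w.length ∧
      IsOutput s (normalForm w) := by
  refine ⟨normalFormProg, 600, fun n hn w => ?_⟩
  obtain ⟨b, ⟨t, s, e, ht, h⟩, hb⟩ := halts_normalFormProg w
  refine ⟨t, s, e, ?_, h⟩
  have := le_max_left n w.length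
  have := le_max_right n w.length
  omega

end HeckeKiselman

theorem theoremT :
    (∀ (n : ℕ) (hn : 3 ≤ n),
      ∃ (ε : CMonoid n ≃ DC hn) (ι : WC hn ≃ DC hn) (ρ : WC hn ≃ IIC n)
        (action : CMonoid n →* (Function.End (Fin n → ℕ))ᵐᵒᵖ),
        -- `ε` is the monoid map sending generators to elementary diagrams
        (ε 1 = DC.mk (Diagram.trivial hn) ∧
          (∀ i : Fin n, ε (gen i) = DC.mk (Diagram.elem hn i)) ∧
          ∀ D D' : Diagram hn,
            ε.symm (DC.mk (D.comp D')) = ε.symm (DC.mk D) * ε.symm (DC.mk D')) ∧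
        -- `ι` is induced by the inclusion of webs into diagrams
        (∀ W : WC hn, ι W = webInclusion W) ∧
        -- `ρ` sends a web to its right sequence couple
        (∀ W : Web hn, (ρ (WC.mk W)).1 = W.1.1.rightCouple) ∧
        -- the action on sequences of natural numbers, and the resulting normal form
        (∀ i : Fin n, action (gen i) = MulOpposite.op (sigma i)) ∧
        (∀ x : CMonoid n,
          (ρ (ι.symm (ε x))).1 = coupleOf ((action x).unop (start n))) ∧
        (∀ w : List (Fin n), (ρ (ι.symm (ε (ofWord w)))).1 = normalForm w) ∧
        -- solution of the word problem
        ∀ w w' : List (Fin n), ofWord w = ofWord w' ↔ normalForm w = normalForm w') ∧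
    -- the normal form of a word is computed in linear time, uniformly in `n`
    ∃ (P : Prog) (K : ℕ), ∀ (n : ℕ), 3 ≤ n → ∀ w : List (Fin n),
      ∃ (t : ℕ) (s : Mem), Exec P (inputMem w) t s ∧ t ≤ K * max n w.length ∧
        IsOutput s (normalForm w) := by
  refine ⟨fun n hn => ⟨(equivDC hn).toEquiv, webEquiv hn, coupleEquiv hn, actionHom hn,
    ⟨rfl, fun i => rfl, fun D D' => ?_⟩, fun W => rfl, fun W => rfl, fun i => rfl, fun x => ?_,
    coupleEquiv_webEquiv_symm hn, fun w w' => ⟨normalForm_eq_of_ofWord_eq hn,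
      ofWord_eq_of_normalForm_eq hn⟩⟩, exists_linear_time_prog⟩
  · exact map_mul (equivDC hn).symm (DC.mk D) (DC.mk D')
  · obtain ⟨w, rfl⟩ := exists_ofWord x
    rw [coupleOf_actionHom]
    exact coupleEquiv_webEquiv_symm hn w
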